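/- Conventions. Let $\overline M$ be a smooth seven-dimensional Riemannian manifold with Levi-Civita connection $\overline\nabla$ and a $G_2$-structure: a smooth three-form $\varphi$ such that every tangent space has an orthonormal basis $e_0,\dots,e_6$ (a Cayley frame) with $\varphi=\sum_{i\in\mathbb Z_7}e_i\wedge e_{i+1}\wedge e_{i+3}$. Define $P$ by $\langle P(x,y),z\rangle=\varphi(x,y,z)$, and $*\varphi=-\sum_{i\in\mathbb Z_7}e_{i+2}\wedge e_{i+4}\wedge e_{i+5}\wedge e_{i+6}$. The structure is of type $\mathcal P$ if $\overline\nabla\varphi=0$, and of type $\mathcal X_1$ if at each point $\overline\nabla\varphi$ is a multiple of $*\varphi$ (that is, $\overline\nabla_X\varphi=c\,X\lrcorner *\varphi$ for all $X$). Let $\iota:M\to\overline M$ be a nonempty (immersed) hypersurface with the induced metric, Levi-Civita connection $\nabla$ and smooth unit normal field $n$. Let $B(x,y)=\langle II(x,y),n\rangle$ be its second fundamental form, $h=\frac16\operatorname{Tr}B=\langle H,n\rangle$ with $H$ the mean curvature vector ($M$ is minimal if $h=0$, totally umbilic if $B$ is at each point a multiple of the metric, totally geodesic if $B=0$), and $\theta$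 a smooth real function on $M$. The induced $SU(3)$-structure is given by $Ix=P(n,x)$ and $\Psi=\psi_++i\psi_-$, where $$\psi_+=\cos\theta\,\iota^*\varphi-\sin\theta\,\iota^*(n\lrcorner *\varphi),\qquad \psi_-=\sin\theta\,\iota^*\varphi+\cos\theta\,\iota^*(n\lrcorner *\varphi).$$ Put $\omega(x,y)=\langle x,Iy\rangle$ and $(IB)(x,y)=B(Ix,Iy)$. The minimal $SU(3)$-connection is $\nabla+\eta+\xi$, where $\xi_XY=-\frac12I(\nabla_XI)Y$ and $\eta_XY=-\eta(IX)\,IY$ for a one-form $\eta$; it annihilates $\psi_\pm$. The intrinsic torsion $\eta+\xi$ is identified with the pair $(\nabla\omega,\eta)$, where $\nabla\omega\in T^*M\otimes\mathfrak u(3)^\perp=\mathcal W_1+\mathcal W_2+\mathcal W_3+\mathcal W_4$ (the Gray–Hervella modules), and $\mathcal W_5$ is the space of the one-forms $\eta$. For $i=1,2$, $\mathcal W_i^+$ (resp. $\mathcal W_i^-$) consists of those $a\in\mathcal W_i$ for which $r(a)(x,y)=\frac12\langle x\lrcorner a,y\lrcorner\psi_+\rangle$ is symmetric (resp. skew-symmetric).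 The structure is of type $\sum_j\mathcal W_j$ if the intrinsic torsion lies in that sum of modules at every point. Theorem. Suppose that the $G_2$-structure on $\overline M$ is of type $\mathcal X_1$ with $d\varphi=k*\varphi$, $k$ a real constant. Then every $SU(3)$-structure on $M$ as above is of type $\mathcal W_1^++\mathcal W_1^-+\mathcal W_2^++\mathcal W_2^-+\mathcal W_3+\mathcal W_5$. Moreover, it is of the type on the left if and only if the condition on the right holds: 1. $\mathcal W_1^++\mathcal W_1^-+\mathcal W_2^++\mathcal W_2^-+\mathcal W_3$: $\theta$ is constant (on each connected component of $M$, if $M$ is not connected); 2. $\mathcal W_1^++\mathcal W_1^-+\mathcal W_2^++\mathcal W_2^-+\mathcal W_5$: $IB=B$; 3. $\mathcal W_1^++\mathcal W_1^-+\mathcal W_2^++\mathcal W_3+\mathcal W_5$: $\sin\theta\,(1+I)B=2h\sin\theta\,\langle\cdot,\cdot\rangle$; 4. $\mathcal W_1^++\mathcal W_1^-+\mathcal W_2^-+\mathcal W_3+\mathcal W_5$: $\cos\theta\,(1+I)B=2h\cos\theta\,\langle\cdot,\cdot\rangle$; 5. $\mathcal W_1^++\mathcal W_2^++\mathcal W_2^-+\mathcal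 W_3+\mathcal W_5$: $-4h\sin\theta=k\cos\theta$; 6. $\mathcal W_1^-+\mathcal W_2^++\mathcal W_2^-+\mathcal W_3+\mathcal W_5$: $4h\cos\theta=k\sin\theta$; 7. $\mathcal W_1^++\mathcal W_1^-+\mathcal W_3+\mathcal W_5$: $(1+I)B=2h\,\langle\cdot,\cdot\rangle$; 8. $\mathcal W_2^++\mathcal W_2^-+\mathcal W_3+\mathcal W_5$: $M$ is minimal and $\overline M$ is of type $\mathcal P$; 9. $\mathcal W_1^++\mathcal W_1^-+\mathcal W_5$: $M$ is totally umbilic; 10. $\mathcal W_2^++\mathcal W_2^-+\mathcal W_5$: $IB=B$, $M$ is minimal and $\overline M$ is of type $\mathcal P$; 11. $\mathcal W_3+\mathcal W_5$: $IB=-B$ and $\overline M$ is of type $\mathcal P$; 12. $\mathcal W_5$: $M$ is totally geodesic and $\overline M$ is of type $\mathcal P$; 13. $\{0\}$: $M$ is totally geodesic, $\theta$ is constant (on each connected component of $M$) and $\overline M$ is of type $\mathcal P$. -/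

import Mathlib

open Bundle Set
open scoped Manifold ContDiff Topology

noncomputable section

namespace G2Hyp

/-! ### Linear algebra in a Euclidean vector space -/

section Linear

variable {V : Type*} [NormedAddCommGroup V] [InnerProductSpace ℝ V]

/-- The three-form `∑ i ∈ ℤ/7, b i ∧ b (i+1) ∧ b (i+3)` attached to vectors `b 0, …, b 6`,
identified with one-forms by the inner product (indices are added modulo `7` in `Fin 7`). -/
def stdG2Form (b : Fin 7 → V) (v : Fin 3 → V) : ℝ :=
  ∑ i : Fin 7, Matrix.det (Matrix.of fun r c : Fin 3 ↦ inner ℝ (b (![i, i + 1, i + 3] r)) (v c))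

/-- The four-form `-∑ i ∈ ℤ/7, b (i+2) ∧ b (i+4) ∧ b (i+5) ∧ b (i+6)`. -/
def stdG2StarForm (b : Fin 7 → V) (v : Fin 4 → V) : ℝ :=
  -∑ i : Fin 7, Matrix.det
    (Matrix.of fun r c : Fin 4 ↦ inner ℝ (b (![i + 2, i + 4, i + 5, i + 6] r)) (v c))

/-- `b` is a Cayley frame for the three-form `φ`. -/
def IsCayleyFrame (φ : V [⋀^Fin 3]→ₗ[ℝ] ℝ) (b : OrthonormalBasis (Fin 7) ℝ V) : Prop :=
  ∀ v : Fin 3 → V, φ v = stdG2Form b v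

theorem stdG2Form_right (b : OrthonormalBasis (Fin 7) ℝ V) (x y : V) (j : Fin 7) :
    stdG2Form b ![x, y, b j]
      = (inner ℝ (b (j + 1)) x * inner ℝ (b (j + 3)) y
          - inner ℝ (b (j + 3)) x * inner ℝ (b (j + 1)) y)
        + (inner ℝ (b (j + 4)) x * inner ℝ (b (j + 5)) y
          - inner ℝ (b (j + 5)) x * inner ℝ (b (j + 4)) y)
        + (inner ℝ (b (j + 2)) x * inner ℝ (b (j + 6)) y
          - inner ℝ (b (j + 6)) x * inner ℝ (b (j + 2)) y) := by
  have ob : ∀ i j, inner ℝ (b i) (b j) = if i = j then (1 : ℝ) else 0 :=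
    fun i j ↦ by simpa using orthonormal_iff_ite.1 b.orthonormal i j
  fin_cases j <;>
  · simp [stdG2Form, Fin.sum_univ_seven, Matrix.det_fin_three, ob]
    ring

variable [FiniteDimensional ℝ V]

/-- The two-fold vector cross product `P` of a three-form `φ`: `⟪P(x, y), z⟫ = φ(x, y, z)`,
as a linear map in the second argument. -/
def cross (φ : V [⋀^Fin 3]→ₗ[ℝ] ℝ) (x : V) : V →ₗ[ℝ] V where
  toFun y := ∑ i, φ ![x, y, stdOrthonormalBasis ℝ V i] • stdOrthonormalBasis ℝ V i
  map_add' y y' := by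
    rw [← Finset.sum_add_distrib]
    refine Finset.sum_congr rfl fun i _ ↦ ?_
    have h := φ.map_update_add ![x, y, stdOrthonormalBasis ℝ V i] 1 y y'
    have e : ∀ z, Function.update ![x, y, stdOrthonormalBasis ℝ V i] 1 z
        = ![x, z, stdOrthonormalBasis ℝ V i] := by
      intro z; ext j; fin_cases j <;> rfl
    rw [e, e, e] at h
    rw [h, add_smul]
  map_smul' c y := by
    rw [RingHom.id_apply, Finset.smul_sum]
    refine Finset.sum_congr rfl fun i _ ↦ ?_
    have h := φ.map_update_smul ![x, y, stdOrthonormalBasis ℝ V i] 1 c y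
    have e : ∀ z, Function.update ![x, y, stdOrthonormalBasis ℝ V i] 1 z
        = ![x, z, stdOrthonormalBasis ℝ V i] := by
      intro z; ext j; fin_cases j <;> rfl
    rw [e, e] at h
    rw [h, smul_smul, smul_eq_mul]

theorem inner_cross (φ : V [⋀^Fin 3]→ₗ[ℝ] ℝ) (x y z : V) :
    inner ℝ (cross φ x y) z = φ ![x, y, z] := by
  have e : ∀ z, Function.update ![x, y, 0] 2 z = ![x, y, z] := by
    intro z; ext j; fin_cases j <;> rfl
  have key : ∀ z, φ ![x, y, z] = φ.toMultilinearMap.toLinearMap ![x, y, 0] 2 z := by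
    intro z; rw [← e]; rfl
  conv_rhs => rw [key, ← (stdOrthonormalBasis ℝ V).sum_repr z, map_sum]
  simp only [cross, LinearMap.coe_mk, AddHom.coe_mk, sum_inner, real_inner_smul_left,
    OrthonormalBasis.repr_apply_apply]
  refine Finset.sum_congr rfl fun i _ ↦ ?_
  rw [map_smul, smul_eq_mul, ← key, mul_comm]

/-- The four-form `*φ`, written through the cross product: up to the normalising factor `-1/3` it is
the cyclic sum over `y, z, u` of `⟪P(x, y), P(z, u)⟫`. -/
def starForm (φ : V [⋀^Fin 3]→ₗ[ℝ] ℝ) (v : Fin 4 → V) : ℝ :=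
  -(1 / 3) * (inner ℝ (cross φ (v 0) (v 1)) (cross φ (v 2) (v 3))
    + inner ℝ (cross φ (v 0) (v 2)) (cross φ (v 3) (v 1))
    + inner ℝ (cross φ (v 0) (v 3)) (cross φ (v 1) (v 2)))

set_option maxHeartbeats 4000000 in
/-- In a Cayley frame `*φ` is the Hodge dual of `φ` for the volume form `b 0 ∧ ⋯ ∧ b 6`. -/
theorem starForm_eq_of_isCayleyFrame {φ : V [⋀^Fin 3]→ₗ[ℝ] ℝ} {b : OrthonormalBasis (Fin 7) ℝ V}
    (h : IsCayleyFrame φ b) (v : Fin 4 → V) : starForm φ v = stdG2StarForm b v := by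
  have key : ∀ x y z u : V, inner ℝ (cross φ x y) (cross φ z u)
      = ∑ j, stdG2Form b ![x, y, b j] * stdG2Form b ![z, u, b j] := by
    intro x y z u
    rw [← b.sum_inner_mul_inner]
    refine Finset.sum_congr rfl fun j _ ↦ ?_
    rw [inner_cross, real_inner_comm, inner_cross, h, h]
  have det4 : ∀ A : Matrix (Fin 4) (Fin 4) ℝ, A.det =
      A 0 0 * (A 1 1 * (A 2 2 * A 3 3 - A 2 3 * A 3 2) - A 1 2 * (A 2 1 * A 3 3 - A 2 3 * A 3 1)
        + A 1 3 * (A 2 1 * A 3 2 - A 2 2 * A 3 1))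
      - A 0 1 * (A 1 0 * (A 2 2 * A 3 3 - A 2 3 * A 3 2) - A 1 2 * (A 2 0 * A 3 3 - A 2 3 * A 3 0)
        + A 1 3 * (A 2 0 * A 3 2 - A 2 2 * A 3 0))
      + A 0 2 * (A 1 0 * (A 2 1 * A 3 3 - A 2 3 * A 3 1) - A 1 1 * (A 2 0 * A 3 3 - A 2 3 * A 3 0)
        + A 1 3 * (A 2 0 * A 3 1 - A 2 1 * A 3 0))
      - A 0 3 * (A 1 0 * (A 2 1 * A 3 2 - A 2 2 * A 3 1) - A 1 1 * (A 2 0 * A 3 2 - A 2 2 * A 3 0)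
        + A 1 2 * (A 2 0 * A 3 1 - A 2 1 * A 3 0)) := by
    intro A
    simp [Matrix.det_succ_row_zero, Fin.sum_univ_succ, Fin.succAbove]
    ring
  simp only [starForm, key, stdG2Form_right, stdG2StarForm, det4]
  generalize hf : (fun (i : Fin 7) (c : Fin 4) ↦ (inner ℝ (b i) (v c) : ℝ)) = f
  have hf' : ∀ i c, inner ℝ (b i) (v c) = f i c := fun i c ↦ by rw [← hf]
  simp only [hf', Matrix.of_apply]
  simp only [Fin.sum_univ_seven, Fin.isValue, Fin.reduceAdd, Matrix.cons_val]
  ring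

/-! ### The modules of the intrinsic torsion of an `SU(3)`-structure -/

/-- Trilinear forms, i.e. elements of `V* ⊗ V* ⊗ V*`. -/
abbrev Trilin (V : Type*) [NormedAddCommGroup V] [InnerProductSpace ℝ V] : Type _ :=
  V →ₗ[ℝ] V →ₗ[ℝ] V →ₗ[ℝ] ℝ

/-- The form `r(a)(x, y) = 1/2 ⟪x ⌟ a, y ⌟ ψ⟫`, where the inner product of two-forms is
`⟪α, β⟫ = 1/2 ∑ α(e_i, e_j) β(e_i, e_j)`. -/
def rForm (ψ : (Fin 3 → V) → ℝ) (a : Trilin V) (x y : V) : ℝ :=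
  (1 / 2) * ((1 / 2) * ∑ i, ∑ j,
    a x (stdOrthonormalBasis ℝ V i) (stdOrthonormalBasis ℝ V j)
      * ψ ![y, stdOrthonormalBasis ℝ V i, stdOrthonormalBasis ℝ V j])

/-- `T* ⊗ u(3)^⊥`: the trilinear forms `a` skew in the last two arguments with
`a(x, Jy, Jz) = -a(x, y, z)`. -/
def uPerp (J : V →ₗ[ℝ] V) : Submodule ℝ (Trilin V) where
  carrier := {a | (∀ x y z, a x y z = -a x z y) ∧ ∀ x y z, a x (J y) (J z) = -a x y z}
  zero_mem' := by simp
  add_mem' {a b} ha hb := by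
    refine ⟨fun x y z ↦ ?_, fun x y z ↦ ?_⟩
    · simp only [LinearMap.add_apply, ha.1 x y z, hb.1 x y z]; ring
    · simp only [LinearMap.add_apply, ha.2 x y z, hb.2 x y z]; ring
  smul_mem' c a ha := by
    refine ⟨fun x y z ↦ ?_, fun x y z ↦ ?_⟩
    · simp only [LinearMap.smul_apply, smul_eq_mul, ha.1 x y z]; ring
    · simp only [LinearMap.smul_apply, smul_eq_mul, ha.2 x y z]; ring

/-- The trilinear forms `a` for which `r(a)` is symmetric. -/
def rSymm (ψ : (Fin 3 → V) → ℝ) : Submodule ℝ (Trilin V) where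
  carrier := {a | ∀ x y, rForm ψ a x y = rForm ψ a y x}
  zero_mem' := by simp [rForm]
  add_mem' {a b} ha hb := by
    intro x y
    have h1 := ha x y
    have h2 := hb x y
    simp only [rForm, LinearMap.add_apply, add_mul, Finset.sum_add_distrib, mul_add] at *
    linarith
  smul_mem' c a ha := by
    intro x y
    have h1 := congrArg (c * ·) (ha x y)
    simp only [rForm, LinearMap.smul_apply, smul_eq_mul, mul_assoc, ← Finset.mul_sum] at *
    linarith

/-- The trilinear forms `a` for which `r(a)` is skew-symmetric. -/
def rSkew (ψ : (Fin 3 → V) → ℝ) : Submodule ℝ (Trilin V) where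
  carrier := {a | ∀ x y, rForm ψ a x y = -rForm ψ a y x}
  zero_mem' := by simp [rForm]
  add_mem' {a b} ha hb := by
    intro x y
    have h1 := ha x y
    have h2 := hb x y
    simp only [rForm, LinearMap.add_apply, add_mul, Finset.sum_add_distrib, mul_add] at *
    linarith
  smul_mem' c a ha := by
    intro x y
    have h1 := congrArg (c * ·) (ha x y)
    simp only [rForm, LinearMap.smul_apply, smul_eq_mul, mul_assoc, ← Finset.mul_sum] at *
    linarith

/-- The Gray–Hervella module `W₁` (nearly Kähler type): `a(x, x, z) = 0`. -/
def ghW1 (J : V →ₗ[ℝ] V) : Submodule ℝ (Trilin V) where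
  carrier := {a | a ∈ uPerp J ∧ ∀ x z, a x x z = 0}
  zero_mem' := ⟨zero_mem _, by simp⟩
  add_mem' {a b} ha hb := ⟨add_mem ha.1 hb.1, fun x z ↦ by simp [ha.2 x z, hb.2 x z]⟩
  smul_mem' c a ha := ⟨Submodule.smul_mem _ c ha.1, fun x z ↦ by simp [ha.2 x z]⟩

/-- The Gray–Hervella module `W₂` (almost Kähler type): the cyclic sum of `a` vanishes. -/
def ghW2 (J : V →ₗ[ℝ] V) : Submodule ℝ (Trilin V) where
  carrier := {a | a ∈ uPerp J ∧ ∀ x y z, a x y z + a y z x + a z x y = 0}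
  zero_mem' := ⟨zero_mem _, by simp⟩
  add_mem' {a b} ha hb := ⟨add_mem ha.1 hb.1, fun x y z ↦ by
    have h1 := ha.2 x y z
    have h2 := hb.2 x y z
    simp only [LinearMap.add_apply]
    linarith⟩
  smul_mem' c a ha := ⟨Submodule.smul_mem _ c ha.1, fun x y z ↦ by
    have h1 := ha.2 x y z
    simp only [LinearMap.smul_apply, smul_eq_mul]
    linear_combination c * h1⟩

/-- The Gray–Hervella module `W₃` (special Hermitian type): `a(Jx, Jy, z) = a(x, y, z)` and the
trace `∑ a(e_i, e_i, z)` vanishes. -/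
def ghW3 (J : V →ₗ[ℝ] V) : Submodule ℝ (Trilin V) where
  carrier := {a | a ∈ uPerp J ∧ (∀ x y z, a (J x) (J y) z = a x y z) ∧
    ∀ z, ∑ i, a (stdOrthonormalBasis ℝ V i) (stdOrthonormalBasis ℝ V i) z = 0}
  zero_mem' := ⟨zero_mem _, by simp, by simp⟩
  add_mem' {a b} ha hb := ⟨add_mem ha.1 hb.1,
    fun x y z ↦ by simp [ha.2.1 x y z, hb.2.1 x y z],
    fun z ↦ by simp [Finset.sum_add_distrib, ha.2.2 z, hb.2.2 z]⟩
  smul_mem' c a ha := ⟨Submodule.smul_mem _ c ha.1,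
    fun x y z ↦ by simp [ha.2.1 x y z],
    fun z ↦ by simp [← Finset.mul_sum, ha.2.2 z]⟩

/-- The Gray–Hervella module `W₄` (locally conformal Kähler type):
`a(x, y, z) = ⟪x, y⟫ δ(z) - ⟪x, z⟫ δ(y) - ⟪x, Jy⟫ δ(Jz) + ⟪x, Jz⟫ δ(Jy)` for a one-form `δ`. -/
def ghW4 (J : V →ₗ[ℝ] V) : Submodule ℝ (Trilin V) where
  carrier := {a | ∃ δ : Module.Dual ℝ V, ∀ x y z, a x y z =
    inner ℝ x y * δ z - inner ℝ x z * δ y - inner ℝ x (J y) * δ (J z) + inner ℝ x (J z) * δ (J y)}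
  zero_mem' := ⟨0, by simp⟩
  add_mem' := by
    rintro a b ⟨δ, hδ⟩ ⟨ε, hε⟩
    exact ⟨δ + ε, fun x y z ↦ by simp only [LinearMap.add_apply, hδ, hε]; ring⟩
  smul_mem' := by
    rintro c a ⟨δ, hδ⟩
    exact ⟨c • δ, fun x y z ↦ by simp only [LinearMap.smul_apply, smul_eq_mul, hδ]; ring⟩

/-- The names of the summands of the space of intrinsic `SU(3)`-torsions: `W₁⁺`, `W₁⁻`, `W₂⁺`,
`W₂⁻`, `W₃`, `W₄`, `W₅`. -/
inductive TorsionClass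
  | W1p | W1m | W2p | W2m | W3 | W4 | W5

/-- The summands themselves. The intrinsic torsion `ξ + η` of an `SU(3)`-structure is encoded by
the pair `(∇ω, η)`, with `∇ω = -ξω ∈ T* ⊗ u(3)^⊥` and the one-form `η ∈ T*`. -/
def torsionModule (J : V →ₗ[ℝ] V) (ψ : (Fin 3 → V) → ℝ) :
    TorsionClass → Submodule ℝ (Trilin V × Module.Dual ℝ V)
  | .W1p => (ghW1 J ⊓ rSymm ψ).prod ⊥
  | .W1m => (ghW1 J ⊓ rSkew ψ).prod ⊥
  | .W2p => (ghW2 J ⊓ rSymm ψ).prod ⊥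
  | .W2m => (ghW2 J ⊓ rSkew ψ).prod ⊥
  | .W3 => (ghW3 J).prod ⊥
  | .W4 => (ghW4 J).prod ⊥
  | .W5 => Submodule.prod ⊥ ⊤

end Linear

/-! ### Riemannian manifolds -/

instance instFiniteDimensionalTangentSpace {m : ℕ} {X : Type*} [TopologicalSpace X]
    [ChartedSpace (EuclideanSpace ℝ (Fin m)) X] (x : X) :
    FiniteDimensional ℝ (TangentSpace (𝓡 m) x) :=
  inferInstanceAs (FiniteDimensional ℝ (EuclideanSpace ℝ (Fin m)))

section Manifold

variable {m : ℕ} {X : Type*} [TopologicalSpace X] [ChartedSpace (EuclideanSpace ℝ (Fin m)) X]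
  [IsManifold (𝓡 m) ∞ X]

/-- Affine connections on a manifold. -/
abbrev Connection (m : ℕ) (X : Type*) [TopologicalSpace X]
    [ChartedSpace (EuclideanSpace ℝ (Fin m)) X] [IsManifold (𝓡 m) ∞ X] : Type _ :=
  CovariantDerivative (𝓡 m) (EuclideanSpace ℝ (Fin m)) (fun x : X ↦ TangentSpace (𝓡 m) x)

/-- The vector field constant in the coordinates of the chart at `x` whose value at `x` is `v`
(it is only meaningful near `x`). -/
abbrev coordExt {x : X} (v : TangentSpace (𝓡 m) x) (y : X) : TangentSpace (𝓡 m) y :=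
  FiberBundle.extend (E := fun x : X ↦ TangentSpace (𝓡 m) x) (EuclideanSpace ℝ (Fin m)) v y

/-- The covariant derivative `(∇_v α)(w)` of a covariant tensor field `α`:
`v (α(W_1, …, W_k)) - ∑ i, α(W_1, …, ∇_v W_i, …, W_k)` for extensions `W_i` of the `w_i`. -/
def covDeriv (D : Connection m X) {k : ℕ} (α : ∀ x : X, (Fin k → TangentSpace (𝓡 m) x) → ℝ) (x : X)
    (v : TangentSpace (𝓡 m) x) (w : Fin k → TangentSpace (𝓡 m) x) : ℝ :=
  mvfderiv (𝓡 m) (fun y ↦ α y fun i ↦ coordExt (w i) y) x v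
    - ∑ i, α x (Function.update w i (D (coordExt (w i)) x v))

/-- The exterior derivative in local coordinates: `∑ i, (-1)^i ∂_{w_i} (α(w_0, …, ŵ_i, …, w_k))`,
the `w_j` being extended to vector fields constant in a chart (so that their brackets vanish). -/
def extDer {k : ℕ} (α : ∀ x : X, (Fin k → TangentSpace (𝓡 m) x) → ℝ) (x : X)
    (w : Fin (k + 1) → TangentSpace (𝓡 m) x) : ℝ :=
  ∑ i : Fin (k + 1), (-1) ^ (i : ℕ) *
    mvfderiv (𝓡 m) (fun y ↦ α y fun j ↦ coordExt (w (i.succAbove j)) y) x (w i)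

/-- Smoothness of a vector field at a point. -/
def SmoothFieldAt (W : ∀ x : X, TangentSpace (𝓡 m) x) (x : X) : Prop :=
  ContMDiffAt (𝓡 m) (𝓡 m).tangent ∞ (fun y ↦ (⟨y, W y⟩ : TangentBundle (𝓡 m) X)) x

/-- Smoothness of a covariant tensor field: it is smooth on vector fields. -/
def SmoothTensor {k : ℕ} (α : ∀ x : X, (Fin k → TangentSpace (𝓡 m) x) → ℝ) : Prop :=
  ∀ (x : X) (W : Fin k → ∀ x : X, TangentSpace (𝓡 m) x), (∀ i, SmoothFieldAt (W i) x) →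
    ContMDiffAt (𝓡 m) 𝓘(ℝ, ℝ) ∞ (fun y ↦ α y fun i ↦ W i y) x

variable [RiemannianBundle (fun x : X ↦ TangentSpace (𝓡 m) x)]
  [IsContMDiffRiemannianBundle (𝓡 m) ∞ (EuclideanSpace ℝ (Fin m))
    (fun x : X ↦ TangentSpace (𝓡 m) x)]

/-- `D` is the Levi-Civita connection. -/
def IsLeviCivita (D : Connection m X) : Prop :=
  haveI : IsContMDiffRiemannianBundle (𝓡 m) 1 (EuclideanSpace ℝ (Fin m))
    (fun x : X ↦ TangentSpace (𝓡 m) x) := IsContMDiffRiemannianBundle.of_le (n := ∞) (by simp)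
  D.torsion = 0 ∧ D.IsMetricCompatible

end Manifold

/-! ### `G₂`-structures, hypersurfaces and the induced `SU(3)`-structures -/

section G2

variable (N : Type*) [TopologicalSpace N] [ChartedSpace (EuclideanSpace ℝ (Fin 7)) N]
  [IsManifold (𝓡 7) ∞ N] [RiemannianBundle (fun x : N ↦ TangentSpace (𝓡 7) x)]

/-- A `G₂`-structure on a Riemannian seven-manifold: a smooth three-form which at every point
has an orthonormal Cayley frame. -/
structure G2Structure where
  form : ∀ x : N, TangentSpace (𝓡 7) x [⋀^Fin 3]→ₗ[ℝ] ℝ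
  smooth : SmoothTensor fun x ↦ form x
  cayley : ∀ x, ∃ b : OrthonormalBasis (Fin 7) ℝ (TangentSpace (𝓡 7) x), IsCayleyFrame (form x) b

variable {N}

namespace G2Structure

variable (φ : G2Structure N)

/-- The four-form `*φ`. -/
def star (x : N) (w : Fin 4 → TangentSpace (𝓡 7) x) : ℝ := starForm (φ.form x) w

/-- Type `𝓧₁`: at every point `∇φ` lies in the one-dimensional `G₂`-module
`𝓧₁ ⊆ T* ⊗ Λ³T*` spanned by `*φ = ∑ e_i ⊗ (e_i ⌟ *φ)`. -/
def IsTypeX1 (D : Connection 7 N) : Prop :=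
  ∀ x, ∃ c : ℝ, ∀ v w, covDeriv D (fun y ↦ φ.form y) x v w = c * φ.star x (Matrix.vecCons v w)

/-- Type `𝓟` (parallel): `∇φ = 0`. -/
def IsTypeP (D : Connection 7 N) : Prop :=
  ∀ x v w, covDeriv D (fun y ↦ φ.form y) x v w = 0

end G2Structure

variable (M : Type*) [TopologicalSpace M] [ChartedSpace (EuclideanSpace ℝ (Fin 6)) M]
  [IsManifold (𝓡 6) ∞ M] [RiemannianBundle (fun p : M ↦ TangentSpace (𝓡 6) p)]

variable (N) in
/-- A hypersurface `ι : M → N` (immersed, with the induced metric on `M`) together with a smooth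
unit normal vector field. -/
structure Hypersurface where
  ι : M → N
  smooth : ContMDiff (𝓡 6) (𝓡 7) ∞ ι
  isometric : ∀ (p : M) (x y : TangentSpace (𝓡 6) p),
    inner ℝ (mfderiv (𝓡 6) (𝓡 7) ι p x) (mfderiv (𝓡 6) (𝓡 7) ι p y) = inner ℝ x y
  n : ∀ p : M, TangentSpace (𝓡 7) (ι p)
  smooth_n : ContMDiff (𝓡 6) (𝓡 7).tangent ∞ fun p ↦ (⟨ι p, n p⟩ : TangentBundle (𝓡 7) N)
  norm_n : ∀ p, ‖n p‖ = 1
  inner_n : ∀ (p : M) (x : TangentSpace (𝓡 6) p), inner ℝ (n p) (mfderiv (𝓡 6) (𝓡 7) ι p x) = 0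

variable {M}

namespace Hypersurface

variable (S : Hypersurface N M)

/-- The differential `dι` at `p`, as a linear map. -/
def dι (p : M) : TangentSpace (𝓡 6) p →ₗ[ℝ] TangentSpace (𝓡 7) (S.ι p) :=
  (mfderiv (𝓡 6) (𝓡 7) S.ι p).toLinearMap

/-- The covariant derivative `∇_v s` of a vector field `s` of `N` along `ι`, for the connection on
`ι* TN` induced by `D`: if `s = ∑ s^i E_i` in the coordinate frame `E_i` of `N` at `ι p`, it is
`∑ v(s^i) E_i + ∇_{dι v} (∑ s^i(p) E_i)`. -/
def derivAlong (D : Connection 7 N) (s : ∀ p : M, TangentSpace (𝓡 7) (S.ι p)) (p : M)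
    (v : TangentSpace (𝓡 6) p) : TangentSpace (𝓡 7) (S.ι p) :=
  let e := trivializationAt (EuclideanSpace ℝ (Fin 7)) (fun x : N ↦ TangentSpace (𝓡 7) x) (S.ι p)
  e.symm (S.ι p) (mvfderiv (𝓡 6) (fun q ↦ (e ⟨S.ι q, s q⟩).2) p v)
    + D (coordExt (s p)) (S.ι p) (S.dι p v)

/-- The second fundamental form `B(x, y) = ⟪II(x, y), n⟫ = ⟪∇_x (dι Y), n⟫`. -/
def B (D : Connection 7 N) (p : M) (x y : TangentSpace (𝓡 6) p) : ℝ :=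
  inner ℝ (S.derivAlong D (fun q ↦ S.dι q (coordExt y q)) p x) (S.n p)

/-- `h = ⟪H, n⟫`, where `H = 1/6 Tr II` is the mean curvature vector. -/
def h (D : Connection 7 N) (p : M) : ℝ :=
  (1 / 6) * ∑ i, S.B D p (stdOrthonormalBasis ℝ (TangentSpace (𝓡 6) p) i)
    (stdOrthonormalBasis ℝ (TangentSpace (𝓡 6) p) i)

/-- `M` is a minimal variety: `H = 0`. -/
def IsMinimal (D : Connection 7 N) : Prop := ∀ p, S.h D p = 0

/-- `M` is totally umbilic: at every point `B` is a multiple of the metric. -/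
def IsTotallyUmbilic (D : Connection 7 N) : Prop :=
  ∀ p, ∃ c : ℝ, ∀ x y, S.B D p x y = c * inner ℝ x y

/-- `M` is totally geodesic: `B = 0`. -/
def IsTotallyGeodesic (D : Connection 7 N) : Prop := ∀ p x y, S.B D p x y = 0

variable (φ : G2Structure N)

/-- The almost complex structure `I x = P(n, x)`. The vector `P(n, dι x)` is tangent to the
hypersurface, and the adjoint of the isometry `dι` takes it back to `T_p M`. -/
def I (p : M) : TangentSpace (𝓡 6) p →ₗ[ℝ] TangentSpace (𝓡 6) p :=
  LinearMap.adjoint (S.dι p) ∘ₗ cross (φ.form (S.ι p)) (S.n p) ∘ₗ S.dι p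

/-- The Kähler form `ω(x, y) = ⟪x, I y⟫`. -/
def kahler (p : M) (w : Fin 2 → TangentSpace (𝓡 6) p) : ℝ := inner ℝ (w 0) (S.I φ p (w 1))

/-- The pullback `ι* φ`. -/
def pullForm (p : M) (w : Fin 3 → TangentSpace (𝓡 6) p) : ℝ :=
  φ.form (S.ι p) fun i ↦ S.dι p (w i)

/-- The three-form `ι* (n ⌟ *φ)`. -/
def pullStar (p : M) (w : Fin 3 → TangentSpace (𝓡 6) p) : ℝ :=
  φ.star (S.ι p) (Matrix.vecCons (S.n p) fun i ↦ S.dι p (w i))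

/-- The real part `ψ₊` of the complex volume form. -/
def ψp (θ : M → ℝ) (p : M) (w : Fin 3 → TangentSpace (𝓡 6) p) : ℝ :=
  Real.cos (θ p) * S.pullForm φ p w - Real.sin (θ p) * S.pullStar φ p w

/-- The imaginary part `ψ₋` of the complex volume form. -/
def ψm (θ : M → ℝ) (p : M) (w : Fin 3 → TangentSpace (𝓡 6) p) : ℝ :=
  Real.sin (θ p) * S.pullForm φ p w + Real.cos (θ p) * S.pullStar φ p w

/-- The covariant derivative `(∇_v I) y`. -/
def covDerivI (D : Connection 6 M) (p : M) (v y : TangentSpace (𝓡 6) p) : TangentSpace (𝓡 6) p :=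
  D (fun q ↦ S.I φ q (coordExt y q)) p v - S.I φ p (D (coordExt y) p v)

/-- The action on `y` of `η_v + ξ_v`, where `ξ_v y = -1/2 I (∇_v I) y` and `η_v y = (Iη)(v) I y`
with `(Iη)(v) = -η(I v)`. -/
def torsionEnd (D : Connection 6 M) (p : M) (η : Module.Dual ℝ (TangentSpace (𝓡 6) p))
    (v y : TangentSpace (𝓡 6) p) : TangentSpace (𝓡 6) p :=
  (-η (S.I φ p v)) • S.I φ p y - (1 / 2 : ℝ) • S.I φ p (S.covDerivI φ D p v y)

/-- The connection `∇ + η + ξ` annihilates the three-form `ψ` at `p`. -/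
def Annihilates (D : Connection 6 M) (p : M) (η : Module.Dual ℝ (TangentSpace (𝓡 6) p))
    (ψ : ∀ q : M, (Fin 3 → TangentSpace (𝓡 6) q) → ℝ) : Prop :=
  ∀ v w, covDeriv D ψ p v w
    - ∑ i, ψ p (Function.update w i (S.torsionEnd φ D p η v (w i))) = 0

/-- `(a, η)` is the intrinsic torsion at `p` of the induced `SU(3)`-structure: `a = ∇ω`, and
`∇ + η + ξ` is the minimal `SU(3)`-connection, i.e. it annihilates `ψ₊` and `ψ₋`. -/
def IsIntrinsicTorsion (θ : M → ℝ) (D : Connection 6 M) (p : M)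
    (τ : Trilin (TangentSpace (𝓡 6) p) × Module.Dual ℝ (TangentSpace (𝓡 6) p)) : Prop :=
  (∀ v y z, τ.1 v y z = covDeriv D (S.kahler φ) p v ![y, z]) ∧
    S.Annihilates φ D p τ.2 (S.ψp φ θ) ∧ S.Annihilates φ D p τ.2 (S.ψm φ θ)

/-- The induced `SU(3)`-structure is of type `∑ c ∈ T, W_c`: at every point the intrinsic torsion
lies in that sum of modules. -/
def IsOfType (θ : M → ℝ) (D : Connection 6 M) (T : Set TorsionClass) : Prop :=
  ∀ p, ∃ τ ∈ ⨆ c ∈ T, torsionModule (S.I φ p) (S.ψp φ θ p) c, S.IsIntrinsicTorsion φ θ D p τ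

end Hypersurface

end G2

end G2Hyp

end

open G2Hyp TorsionClass

/-! Everything reduces to linear algebra in one tangent space. Write κ = k/4, J for `I`, Φ for ι*φ,
A for the Weingarten map, m = h = Tr A / 6, c = cos θ and s = sin θ. If ∇φ is a multiple of *φ at a
point, skew-symmetrisation gives dφ as four times that multiple, so ∇φ = κ *φ
(`IsTypeX1.covDeriv_eq`).

The identities of the cross product make (J, Φ) a linear SU(3)-structure (`IsHyperplane.isSU3`), and
ι*(n ⌟ *φ) = -Φ ∘ J, with J acting on the first argument; hence ψ₊ = c Φ + s Φ ∘ J. Differentiating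
ω(y, z) = φ(n, z, y) by means of ∇φ = κ *φ and the formulas of Gauss and Weingarten gives ∇ω = Φ ∘
(A - κJ) (`covDeriv_kahler`). The connection ∇ + ξ annihilates Φ and Φ ∘ J, so on ψ₊ and ψ₋ it only
sees dθ, and η is determined by dθ = -3 η ∘ J (`annihilates_iff`). The W₅ part therefore vanishes
exactly when θ is constant on components.

For an SU(3)-structure (J, Ψ), the map R ↦ Ψ ∘ R identifies operators with T* ⊗ u(3)^⊥, and r is its
inverse (`exists_eq_comp`, `rForm_comp`). Multiples of the identity and of J give W₁⁺ and W₁⁻;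
operators commuting with J that are symmetric and trace-free, or J times such, give W₂⁺ and W₂⁻;
symmetric operators anticommuting with J give elements of W₃. For Ψ = ψ₊ the operator representing
∇ω is (c - sJ)(A - κJ), because (c + sJ)(c - sJ) = 1. Split A = m + A₀ + A₁ into its trace part, the
trace-free part commuting with J and the part anticommuting with J. The components are c m - κ s,
-(κ c + s m) J, c A₀, -s J A₀ and (c - sJ) A₁; symmetry of A excludes W₄.

The criterion `isOfType_iff` says that each absent class kills its component. Since c² + s² = 1, the
absence of both W₁⁺ and W₁⁻ means m = κ = 0, and that of both W₂⁺ and W₂⁻ means A₀ = 0. -/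

open scoped InnerProductSpace

/-! ### Linear algebra of `SU(3)`-structures -/

section SU3

variable {W : Type*} [NormedAddCommGroup W] [InnerProductSpace ℝ W]

/-- The four-form-like expression `⟪Q(x, y), Q(z, u)⟫` of the complex cross product `Q` of a
three-dimensional Hermitian vector space. -/
def hermForm (J : W →ₗ[ℝ] W) (x y z u : W) : ℝ :=
  ⟪x, z⟫_ℝ * ⟪y, u⟫_ℝ - ⟪x, u⟫_ℝ * ⟪y, z⟫_ℝ - ⟪x, J z⟫_ℝ * ⟪y, J u⟫_ℝ + ⟪x, J u⟫_ℝ * ⟪y, J z⟫_ℝ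

theorem uPerp_J_comm {J : W →ₗ[ℝ] W} (hJ : ∀ x, J (J x) = -x) {a : Trilin W} (ha : a ∈ uPerp J)
    (x y z : W) :
    a x (J y) z = a x y (J z) := by
  have := ha.2 x y (J z)
  rw [hJ, map_neg] at this
  linarith

theorem ghW1_swap {J : W →ₗ[ℝ] W} {a : Trilin W} (ha : a ∈ ghW1 J) (x y z : W) : a x y z = -a y x z := by
  have := ha.2 (x + y) z
  simp only [map_add, LinearMap.add_apply, ha.2] at this
  linarith

/-- Rotation of the arguments of a trilinear form. -/
def rotTrilin (a : Trilin W) : Trilin W := (LinearMap.lflip.toLinearMap.comp a).flip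

@[simp]
theorem rotTrilin_apply (a : Trilin W) (x y z : W) : rotTrilin a x y z = a y z x := rfl

/-- The sum of a trilinear form over the cyclic permutations of its arguments. -/
def cycTrilin (a : Trilin W) : Trilin W := a + rotTrilin a + rotTrilin (rotTrilin a)

theorem cycTrilin_eq_zero {J : W →ₗ[ℝ] W} {a : Trilin W} (ha : a ∈ ghW2 J) : cycTrilin a = 0 := by
  ext x y z
  simpa [cycTrilin] using ha.2 x y z

variable [FiniteDimensional ℝ W]

local notation "𝐞" => stdOrthonormalBasis ℝ W

theorem sum_inner_mul_apply (f : W →ₗ[ℝ] ℝ) (y : W) : ∑ i, ⟪𝐞 i, y⟫_ℝ * f (𝐞 i) = f y := by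
  conv_rhs => rw [← (𝐞).sum_repr y, map_sum]
  simp [OrthonormalBasis.repr_apply_apply]

theorem sum_apply_mul_inner (f : W →ₗ[ℝ] ℝ) (y : W) : ∑ i, f (𝐞 i) * ⟪𝐞 i, y⟫_ℝ = f y := by
  rw [← sum_inner_mul_apply f y]
  exact Finset.sum_congr rfl fun i _ ↦ mul_comm _ _

theorem sum_inner_basis_mul (x y : W) : ∑ i, ⟪x, 𝐞 i⟫_ℝ * ⟪y, 𝐞 i⟫_ℝ = ⟪x, y⟫_ℝ := by
  rw [← (𝐞).sum_inner_mul_inner x y]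
  exact Finset.sum_congr rfl fun i _ ↦ by rw [real_inner_comm y]

/-- Moving an operator `T` across a contraction. -/
theorem sum_apply_basis_comm (f : W →ₗ[ℝ] W →ₗ[ℝ] ℝ) {T T' : W →ₗ[ℝ] W}
    (h : ∀ x y, ⟪T x, y⟫_ℝ = ⟪x, T' y⟫_ℝ) :
    ∑ i, f (T (𝐞 i)) (𝐞 i) = ∑ i, f (𝐞 i) (T' (𝐞 i)) := by
  have h1 : ∀ i, f (T (𝐞 i)) (𝐞 i) = ∑ j, ⟪𝐞 j, T (𝐞 i)⟫_ℝ * f (𝐞 j) (𝐞 i) := fun i ↦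
    (sum_inner_mul_apply (f.flip (𝐞 i)) (T (𝐞 i))).symm
  have h2 : ∀ i, f (𝐞 i) (T' (𝐞 i)) = ∑ j, ⟪𝐞 j, T' (𝐞 i)⟫_ℝ * f (𝐞 i) (𝐞 j) := fun i ↦
    (sum_inner_mul_apply (f (𝐞 i)) (T' (𝐞 i))).symm
  simp only [h1, h2]
  rw [Finset.sum_comm]
  refine Finset.sum_congr rfl fun i _ ↦ Finset.sum_congr rfl fun j _ ↦ ?_
  rw [← h, real_inner_comm]

theorem rForm_eq {Ψ : Trilin W} {ψ : (Fin 3 → W) → ℝ} (hψ : ∀ x y z, ψ ![x, y, z] = Ψ x y z)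
    (a : Trilin W) (x y : W) :
    rForm ψ a x y = 1 / 4 * ∑ i, ∑ j, a x (𝐞 i) (𝐞 j) * Ψ y (𝐞 i) (𝐞 j) := by
  simp only [rForm, hψ]
  ring

/-- Rotating the arguments of `a` only renames the summation indices when the other factor is
cyclically invariant. -/
theorem sum_rotTrilin_mul (a : Trilin W) {Φ : Trilin W} (hΦ : ∀ x y z, Φ x y z = Φ y z x) :
    ∑ i, ∑ j, ∑ k, rotTrilin a (𝐞 i) (𝐞 j) (𝐞 k) * Φ (𝐞 i) (𝐞 j) (𝐞 k)
      = ∑ i, ∑ j, ∑ k, a (𝐞 i) (𝐞 j) (𝐞 k) * Φ (𝐞 i) (𝐞 j) (𝐞 k) := by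
  simp only [rotTrilin_apply]
  rw [Finset.sum_comm]
  refine Finset.sum_congr rfl fun i _ ↦ ?_
  rw [Finset.sum_comm]
  exact Finset.sum_congr rfl fun j _ ↦ Finset.sum_congr rfl fun k _ ↦ by rw [hΦ (𝐞 k)]

theorem sum_rForm_self {Ψ : Trilin W} {ψ : (Fin 3 → W) → ℝ}
    (hψ : ∀ x y z, ψ ![x, y, z] = Ψ x y z) (a : Trilin W) : ∑ i, rForm ψ a (𝐞 i) (𝐞 i)
    = 1 / 4 * ∑ i, ∑ j, ∑ k, a (𝐞 i) (𝐞 j) (𝐞 k) * Ψ (𝐞 i) (𝐞 j) (𝐞 k) := by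
  simp only [rForm_eq hψ, Finset.mul_sum]

theorem sum_rForm_J (J : W →ₗ[ℝ] W) {Ψ : Trilin W} {ψ : (Fin 3 → W) → ℝ}
    (hψ : ∀ x y z, ψ ![x, y, z] = Ψ x y z) (a : Trilin W) : ∑ i, rForm ψ a (𝐞 i) (J (𝐞 i))
    = 1 / 4 * ∑ i, ∑ j, ∑ k, a (𝐞 i) (𝐞 j) (𝐞 k) * (Ψ ∘ₗ J) (𝐞 i) (𝐞 j) (𝐞 k) := by
  simp only [rForm_eq hψ, Finset.mul_sum, LinearMap.comp_apply]

/-- A linear `SU(3)`-structure: an orthogonal complex structure `J` and a three-form `Ψ` (the real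
part of a complex volume form). -/
structure IsSU3 (J : W →ₗ[ℝ] W) (Ψ : Trilin W) : Prop where
  J_sq : ∀ x, J (J x) = -x
  J_skew : ∀ x y, ⟪J x, y⟫_ℝ = -⟪x, J y⟫_ℝ
  swap₁₂ : ∀ x y z, Ψ x y z = -Ψ y x z
  swap₂₃ : ∀ x y z, Ψ x y z = -Ψ x z y
  J_left : ∀ x y z, Ψ (J x) y z = Ψ x (J y) z
  contr : ∀ x y z u, ∑ i, Ψ x y (𝐞 i) * Ψ z u (𝐞 i) = hermForm J x y z u
  finrank : Module.finrank ℝ W = 6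

namespace IsSU3

variable {J : W →ₗ[ℝ] W} {Ψ : Trilin W} (h : IsSU3 J Ψ)
include h

theorem cyclic (x y z : W) : Ψ x y z = Ψ y z x := by
  rw [h.swap₁₂, h.swap₂₃, neg_neg]

theorem inner_J_J (x y : W) : ⟪J x, J y⟫_ℝ = ⟪x, y⟫_ℝ := by
  rw [h.J_skew, h.J_sq, inner_neg_right, neg_neg]

theorem inner_J_self (x : W) : ⟪x, J x⟫_ℝ = 0 := by
  have := h.J_skew x x
  rw [real_inner_comm] at this
  linarith

theorem J_right (x y z : W) : Ψ x y (J z) = Ψ x (J y) z := by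
  rw [← h.cyclic (J z) x y, h.J_left, h.cyclic z (J x) y, h.J_left]

theorem contr_left (x y z u : W) : ∑ i, Ψ (𝐞 i) x y * Ψ (𝐞 i) z u = hermForm J x y z u := by
  rw [← h.contr]
  exact Finset.sum_congr rfl fun i _ ↦ by rw [h.cyclic, h.cyclic (𝐞 i)]

theorem sum_inner_self : ∑ i, ⟪𝐞 i, 𝐞 i⟫_ℝ = 6 := by
  simp [h.finrank]

/-- Contraction of the Hermitian form in the second and fourth arguments. -/
theorem sum_hermForm (x z : W) : ∑ i, hermForm J x (𝐞 i) z (𝐞 i) = 4 * ⟪x, z⟫_ℝ := by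
  have e : ∀ i, hermForm J x (𝐞 i) z (𝐞 i) = ⟪x, z⟫_ℝ * ⟪𝐞 i, 𝐞 i⟫_ℝ - ⟪x, 𝐞 i⟫_ℝ * ⟪z, 𝐞 i⟫_ℝ
      - ⟪J x, 𝐞 i⟫_ℝ * ⟪J z, 𝐞 i⟫_ℝ := by
    intro i
    rw [hermForm, h.inner_J_self, h.J_skew x, real_inner_comm z (𝐞 i), real_inner_comm (J z) (𝐞 i)]
    ring
  simp only [e, Finset.sum_sub_distrib, ← Finset.mul_sum, sum_inner_basis_mul, h.sum_inner_self,
    h.inner_J_J]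
  ring

/-- The double contraction of `Ψ` with itself is four times the metric, so `Ψ = 0` would force `W =
0`, against dimension six. -/
theorem exists_ne_zero : ∃ x y z, Ψ x y z ≠ 0 := by
  by_contra! hc
  have h1 := h.sum_hermForm
  simp only [← h.contr, hc, mul_zero, Finset.sum_const_zero] at h1
  have h2 : Subsingleton W := ⟨fun x y ↦ by
    have : ∀ z : W, z = 0 := fun z ↦ by
      have := h1 z z
      exact inner_self_eq_zero (𝕜 := ℝ).1 (by linarith)
    rw [this x, this y]⟩
  have h3 := h.finrank
  rw [Module.finrank_zero_of_subsingleton] at h3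
  omega

/-- The operator is the one representing the form r(a). Contracting the two copies of `Ψ` over their
common index leaves `hermForm`, which applied to a(x, ·, ·) produces four terms, all equal to a(x,
k, l) when a lies in u(3)^⊥; this explains the factor 1/4. -/
theorem exists_eq_comp {a : Trilin W} (ha : a ∈ uPerp J) :
    ∃ R : W →ₗ[ℝ] W, a = Ψ ∘ₗ R := by
  refine ⟨∑ m, (LinearMap.toSpanSingleton ℝ W (𝐞 m)) ∘ₗ
    ((1 / 4 : ℝ) • ∑ i, ∑ j, Ψ (𝐞 m) (𝐞 i) (𝐞 j) • (a.flip (𝐞 i)).flip (𝐞 j)), ?_⟩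
  ext x k l
  have e1 : ∀ i j, ∑ m, Ψ (𝐞 m) (𝐞 i) (𝐞 j) * Ψ (𝐞 m) k l = hermForm J (𝐞 i) (𝐞 j) k l :=
    fun i j ↦ h.contr_left _ _ _ _
  have e2 : ∀ u v, ∑ i, ∑ j, a x (𝐞 i) (𝐞 j) * (⟪𝐞 i, u⟫_ℝ * ⟪𝐞 j, v⟫_ℝ) = a x u v := by
    intro u v
    have e3 : ∀ i, ∑ j, a x (𝐞 i) (𝐞 j) * (⟪𝐞 i, u⟫_ℝ * ⟪𝐞 j, v⟫_ℝ)
        = (a x).flip v (𝐞 i) * ⟪𝐞 i, u⟫_ℝ := by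
      intro i
      rw [LinearMap.flip_apply, ← sum_apply_mul_inner (a x (𝐞 i)) v, Finset.sum_mul]
      exact Finset.sum_congr rfl fun j _ ↦ by ring
    simp only [e3]
    exact sum_apply_mul_inner ((a x).flip v) u
  have e4 : Ψ ((∑ m, (LinearMap.toSpanSingleton ℝ W (𝐞 m)) ∘ₗ
      ((1 / 4 : ℝ) • ∑ i, ∑ j, Ψ (𝐞 m) (𝐞 i) (𝐞 j) • (a.flip (𝐞 i)).flip (𝐞 j))) x) k l
      = 1 / 4 * ∑ i, ∑ j, a x (𝐞 i) (𝐞 j) * hermForm J (𝐞 i) (𝐞 j) k l := by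
    simp only [← e1, Finset.mul_sum]
    simp only [LinearMap.sum_apply, LinearMap.comp_apply, LinearMap.toSpanSingleton_apply, map_sum,
      map_smul, LinearMap.smul_apply, LinearMap.flip_apply, smul_eq_mul, Finset.mul_sum]
    rw [Finset.sum_comm]
    refine Finset.sum_congr rfl fun i _ ↦ ?_
    rw [Finset.sum_comm]
    exact Finset.sum_congr rfl fun j _ ↦ Finset.sum_congr rfl fun m _ ↦ by ring
  rw [LinearMap.comp_apply, e4]
  have e5 : ∀ i j, a x (𝐞 i) (𝐞 j) * hermForm J (𝐞 i) (𝐞 j) k l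
      = a x (𝐞 i) (𝐞 j) * (⟪𝐞 i, k⟫_ℝ * ⟪𝐞 j, l⟫_ℝ)
        - a x (𝐞 i) (𝐞 j) * (⟪𝐞 i, l⟫_ℝ * ⟪𝐞 j, k⟫_ℝ)
        - a x (𝐞 i) (𝐞 j) * (⟪𝐞 i, J k⟫_ℝ * ⟪𝐞 j, J l⟫_ℝ)
        + a x (𝐞 i) (𝐞 j) * (⟪𝐞 i, J l⟫_ℝ * ⟪𝐞 j, J k⟫_ℝ) := by
    intro i j; rw [hermForm]; ring
  simp only [e5, Finset.sum_add_distrib, Finset.sum_sub_distrib, e2]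
  rw [ha.2, ha.2, ha.1 x l k]
  ring

/-- The contraction of Ψ(w - w', ·, ·) with itself is 4|w - w'|², so `Ψ` is nondegenerate in its
first argument. -/
theorem eq_of_forall {w w' : W} (hw : ∀ y z, Ψ w y z = Ψ w' y z) : w = w' := by
  have h0 : ∀ y z, Ψ (w - w') y z = 0 := fun y z ↦ by simp [hw]
  have h1 := h.sum_hermForm (w - w') (w - w')
  simp only [← h.contr, h0, zero_mul, Finset.sum_const_zero] at h1
  rw [← sub_eq_zero, ← inner_self_eq_zero (𝕜 := ℝ)]
  linarith

theorem sum_apply_J_J (f : W →ₗ[ℝ] W →ₗ[ℝ] ℝ) :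
    ∑ i, f (J (𝐞 i)) (J (𝐞 i)) = ∑ i, f (𝐞 i) (𝐞 i) := by
  have := sum_apply_basis_comm (f.compl₂ J) (T := J) (T' := -J)
    (fun x y ↦ by rw [h.J_skew, LinearMap.neg_apply, inner_neg_right])
  simpa [h.J_sq] using this

theorem sum_eq_zero_of_J_J {f : W →ₗ[ℝ] W →ₗ[ℝ] ℝ} (hf : ∀ x y, f (J x) (J y) = -f x y) :
    ∑ i, f (𝐞 i) (𝐞 i) = 0 := by
  have := h.sum_apply_J_J f
  simp only [hf, Finset.sum_neg_distrib] at this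
  linarith

theorem comp_mem_uPerp (R : W →ₗ[ℝ] W) : Ψ ∘ₗ R ∈ uPerp J :=
  ⟨fun x y z ↦ h.swap₂₃ _ _ _, fun x y z ↦ by
    rw [LinearMap.comp_apply, h.J_right, h.J_sq]; simp⟩

/-- An element of W₁ is totally skew, so `J` can be moved from any argument to any other. The factor
`-1` is kept explicit to match the parameter `s` of `rForm_J_J`. -/
theorem ghW1_J_J {a : Trilin W} (ha : a ∈ ghW1 J) (x y z : W) :
    a (J x) (J y) z = -1 * a x y z := by
  rw [uPerp_J_comm h.J_sq ha.1, ghW1_swap ha, ha.1.2, neg_neg, ghW1_swap ha]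
  ring

/-- The sum a(x, y, z) + a(Jx, Jy, z) is symmetric in x, y by the cyclic identity and skew in y, z.
A trilinear form with these two symmetries vanishes. -/
theorem ghW2_J_J {a : Trilin W} (ha : a ∈ ghW2 J) (x y z : W) :
    a (J x) (J y) z = -1 * a x y z := by
  have hb : ∀ x y z, a x y z + a (J x) (J y) z = a y x z + a (J y) (J x) z := by
    intro x y z
    have h1 := ha.2 z x y
    have h2 := ha.2 z (J x) (J y)
    rw [ha.1.2, ← uPerp_J_comm h.J_sq ha.1 (J y)] at h2
    have h3 := ha.1.1 y z x
    have h4 := ha.1.1 (J y) (J z) x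
    have h5 := uPerp_J_comm h.J_sq ha.1 (J y) x z
    linarith
  have hs : ∀ x y z, a x y z + a (J x) (J y) z = -(a x z y + a (J x) (J z) y) := by
    intro x y z
    have h3 := ha.1.1 x y z
    have h4 := ha.1.1 (J x) (J y) z
    have h5 := uPerp_J_comm h.J_sq ha.1 (J x) z y
    linarith
  linarith [hb x y z, hs y x z, hb y z x, hs z y x, hb z x y, hs x z y]

variable {ψ : (Fin 3 → W) → ℝ} (hψ : ∀ x y z, ψ ![x, y, z] = Ψ x y z)
include hψ

/-- One contraction gives `hermForm`, the second gives 4⟪R x, y⟫, and the normalisation of r cancels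
the 4. Thus r inverts R ↦ Ψ ∘ R. -/
theorem rForm_comp (R : W →ₗ[ℝ] W) (x y : W) : rForm ψ (Ψ ∘ₗ R) x y = ⟪R x, y⟫_ℝ := by
  rw [rForm_eq hψ]
  simp only [LinearMap.comp_apply, h.contr, h.sum_hermForm]
  ring

/-- In terms of the operator R of `a` the hypothesis reads J R J = s R, so s = -1 means that R
commutes with J and s = 1 that it anticommutes. -/
theorem rForm_J_J {a : Trilin W} (ha : a ∈ uPerp J) {s : ℝ}
    (hs : ∀ x y z, a (J x) (J y) z = s * a x y z) (x y : W) :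
    rForm ψ a (J x) (J y) = -s * rForm ψ a x y := by
  obtain ⟨R, rfl⟩ := h.exists_eq_comp ha
  simp only [h.rForm_comp hψ]
  have : J (R (J x)) = s • R x := h.eq_of_forall fun y z ↦ by
    rw [h.J_left, map_smul]; exact hs x y z
  have h2 := h.J_skew (R (J x)) y
  rw [this, real_inner_smul_left] at h2
  linarith

/-- The form `r(a)` of a form `a` of nearly Kähler type is a complex multiple of the metric. -/
theorem exists_rForm_of_mem_ghW1 {a : Trilin W} (ha : a ∈ ghW1 J) :
    ∃ l m : ℝ, ∀ x y, rForm ψ a x y = l * ⟪x, y⟫_ℝ + m * ⟪J x, y⟫_ℝ := by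
  have hJJ := h.rForm_J_J hψ ha.1 (h.ghW1_J_J ha)
  have hsw := ghW1_swap ha
  obtain ⟨R, rfl⟩ := h.exists_eq_comp ha.1
  simp only [h.rForm_comp hψ] at hJJ ⊢
  refine ⟨1 / 6 * ∑ i, ⟪R (𝐞 i), 𝐞 i⟫_ℝ, 1 / 6 * ∑ i, ⟪R (𝐞 i), J (𝐞 i)⟫_ℝ, fun x z ↦ ?_⟩
  -- Skewness of Ψ(R x, y, ·) in x and y is contracted with Ψ(z, y, ·) over y. The first term
  -- contributes 4⟪R x, z⟫ and the second 2⟪R x, z⟫, since R commutes with J, together with the two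
  -- traces; their sum 6 is the denominator in the witnesses.
  have key : ∑ i, (hermForm J (R x) (𝐞 i) z (𝐞 i) + hermForm J (R (𝐞 i)) x z (𝐞 i)) = 0 := by
    refine Finset.sum_eq_zero fun i _ ↦ ?_
    rw [← h.contr, ← h.contr, ← Finset.sum_add_distrib]
    refine Finset.sum_eq_zero fun j _ ↦ ?_
    have := hsw x (𝐞 i) (𝐞 j)
    simp only [LinearMap.comp_apply] at this
    rw [this]; ring
  have e : ∀ i, hermForm J (R (𝐞 i)) x z (𝐞 i) =
      ((innerₗ W).flip z ∘ₗ R) (𝐞 i) * ⟪𝐞 i, x⟫_ℝ - ⟪x, z⟫_ℝ * ⟪R (𝐞 i), 𝐞 i⟫_ℝ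
      + ((innerₗ W).flip (J z) ∘ₗ R) (𝐞 i) * ⟪𝐞 i, J x⟫_ℝ
      + ⟪x, J z⟫_ℝ * ⟪R (𝐞 i), J (𝐞 i)⟫_ℝ := by
    intro i
    have h1 := h.J_skew x (𝐞 i)
    simp only [hermForm, LinearMap.comp_apply, LinearMap.flip_apply, innerₗ_apply_apply,
      real_inner_comm (J x) (𝐞 i), real_inner_comm x (𝐞 i)]
    linear_combination (-⟪R (𝐞 i), J z⟫_ℝ) * h1
  rw [Finset.sum_add_distrib, h.sum_hermForm] at key
  simp only [e, Finset.sum_add_distrib, Finset.sum_sub_distrib, ← Finset.mul_sum,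
    sum_apply_mul_inner] at key
  simp only [LinearMap.comp_apply, LinearMap.flip_apply, innerₗ_apply_apply, hJJ] at key
  rw [h.J_skew]
  linear_combination 1 / 6 * key

omit hψ in
theorem comp_J_cyclic (x y z : W) : (Ψ ∘ₗ J) x y z = (Ψ ∘ₗ J) y z x := by
  rw [LinearMap.comp_apply, LinearMap.comp_apply, h.J_left, h.cyclic]

/-- The trace of r(a) is the full contraction of `a` with `Ψ`, and by cyclic invariance of `Ψ` the
three rotations of `a` contribute equally. The same holds for the trace against `J`, with `Ψ ∘ J` in
place of `Ψ`. -/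
theorem sum_rForm_cycTrilin (a : Trilin W) :
    ∑ i, rForm ψ (cycTrilin a) (𝐞 i) (𝐞 i) = 3 * ∑ i, rForm ψ a (𝐞 i) (𝐞 i) := by
  rw [sum_rForm_self hψ, sum_rForm_self hψ]
  simp only [cycTrilin, LinearMap.add_apply, add_mul, Finset.sum_add_distrib,
    sum_rotTrilin_mul _ h.cyclic]
  ring

theorem sum_rForm_J_cycTrilin (a : Trilin W) :
    ∑ i, rForm ψ (cycTrilin a) (𝐞 i) (J (𝐞 i)) = 3 * ∑ i, rForm ψ a (𝐞 i) (J (𝐞 i)) := by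
  rw [sum_rForm_J J hψ, sum_rForm_J J hψ]
  simp only [cycTrilin, LinearMap.add_apply, add_mul, Finset.sum_add_distrib,
    sum_rotTrilin_mul _ h.comp_J_cyclic]
  ring

theorem sum_rForm_of_mem_ghW2 {a : Trilin W} (ha : a ∈ ghW2 J) :
    ∑ i, rForm ψ a (𝐞 i) (𝐞 i) = 0 := by
  have := h.sum_rForm_cycTrilin hψ a
  rw [cycTrilin_eq_zero ha] at this
  simp only [rForm, LinearMap.zero_apply, zero_mul, Finset.sum_const_zero, mul_zero] at this ⊢
  linarith

theorem sum_rForm_J_of_mem_ghW2 {a : Trilin W} (ha : a ∈ ghW2 J) :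
    ∑ i, rForm ψ a (𝐞 i) (J (𝐞 i)) = 0 := by
  have := h.sum_rForm_J_cycTrilin hψ a
  rw [cycTrilin_eq_zero ha] at this
  simp only [rForm, LinearMap.zero_apply, zero_mul, Finset.sum_const_zero, mul_zero] at this ⊢
  linarith

/-- The cyclic sum of such an `a` is totally skew and lies in W₁, so its image under r is a
combination of the metric and of ⟪J ·, ·⟫. The two traces are the two coefficients up to nonzero
factors, so the cyclic sum is zero. -/
theorem mem_ghW2 {a : Trilin W} (ha : a ∈ uPerp J) (hJ : ∀ x y z, a (J x) (J y) z = -a x y z)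
    (h1 : ∑ i, rForm ψ a (𝐞 i) (𝐞 i) = 0) (h2 : ∑ i, rForm ψ a (𝐞 i) (J (𝐞 i)) = 0) :
    a ∈ ghW2 J := by
  have hC : cycTrilin a ∈ ghW1 J := by
    refine ⟨⟨fun x y z ↦ ?_, fun x y z ↦ ?_⟩, fun x z ↦ ?_⟩
    · simp only [cycTrilin, LinearMap.add_apply, rotTrilin_apply]
      linarith [ha.1 x y z, ha.1 y z x, ha.1 z x y]
    · simp only [cycTrilin, LinearMap.add_apply, rotTrilin_apply]
      linarith [ha.2 x y z, hJ y z x, hJ z x y, uPerp_J_comm h.J_sq ha (J z) x y]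
    · simp only [cycTrilin, LinearMap.add_apply, rotTrilin_apply]
      linarith [ha.1 x x z, ha.1 z x x]
  obtain ⟨l, m, hlm⟩ := h.exists_rForm_of_mem_ghW1 hψ hC
  have hl : l = 0 := by
    have := h.sum_rForm_cycTrilin hψ a
    have e : ∀ i, rForm ψ (cycTrilin a) (𝐞 i) (𝐞 i) = l * ⟪𝐞 i, 𝐞 i⟫_ℝ := fun i ↦ by
      rw [hlm, h.J_skew, h.inner_J_self]; ring
    simp only [e, ← Finset.mul_sum, h.sum_inner_self, h1] at this
    linarith
  have hm : m = 0 := by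
    have := h.sum_rForm_J_cycTrilin hψ a
    have e : ∀ i, rForm ψ (cycTrilin a) (𝐞 i) (J (𝐞 i)) = m * ⟪𝐞 i, 𝐞 i⟫_ℝ := fun i ↦ by
      rw [hlm, h.inner_J_J, h.inner_J_self]; ring
    simp only [e, ← Finset.mul_sum, h.sum_inner_self, h2] at this
    linarith
  obtain ⟨R, hR⟩ := h.exists_eq_comp hC.1
  have hR0 : R = 0 := by
    ext x
    refine ext_inner_right ℝ fun y ↦ ?_
    rw [← h.rForm_comp hψ, ← hR, hlm, hl, hm]
    simp
  refine ⟨ha, fun x y z ↦ ?_⟩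
  have : cycTrilin a x y z = 0 := by rw [hR, hR0]; simp
  simpa [cycTrilin] using this

end IsSU3

end SU3

open scoped InnerProductSpace

/-! ### Decomposition of the torsion space in terms of operators -/

noncomputable section Modules

variable {W : Type*} [NormedAddCommGroup W] [InnerProductSpace ℝ W] [FiniteDimensional ℝ W]

local notation "𝐞" => stdOrthonormalBasis ℝ W

/-- `rForm` as a linear map. -/
def rFormL (ψ : (Fin 3 → W) → ℝ) : Trilin W →ₗ[ℝ] W → W → ℝ where
  toFun a x y := rForm ψ a x y
  map_add' a b := by
    funext x y
    simp only [rForm, LinearMap.add_apply, add_mul, Finset.sum_add_distrib, mul_add, Pi.add_apply]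
  map_smul' c a := by
    funext x y
    simp only [rForm, LinearMap.smul_apply, smul_eq_mul, mul_assoc, ← Finset.mul_sum, Pi.smul_apply,
      RingHom.id_apply]
    ring

/-- The components of an operator with respect to the decomposition of `T* ⊗ u(3)^⊥` into
`W₁⁺`, `W₁⁻`, `W₂⁺`, `W₂⁻`, `W₃` and `W₄`, the last one being zero. -/
structure IsTorsionSplit (J : W →ₗ[ℝ] W) (P Q N : W →ₗ[ℝ] W) : Prop where
  P_symm : ∀ x y, ⟪P x, y⟫_ℝ = ⟪x, P y⟫_ℝ
  P_J : ∀ x, P (J x) = J (P x)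
  P_trace : ∑ i, ⟪P (𝐞 i), 𝐞 i⟫_ℝ = 0
  Q_skew : ∀ x y, ⟪Q x, y⟫_ℝ = -⟪x, Q y⟫_ℝ
  Q_J : ∀ x, Q (J x) = J (Q x)
  Q_trace : ∑ i, ⟪Q (𝐞 i), J (𝐞 i)⟫_ℝ = 0
  N_symm : ∀ x y, ⟪N x, y⟫_ℝ = ⟪x, N y⟫_ℝ
  N_J : ∀ x, N (J x) = -J (N x)

section

variable {J : W →ₗ[ℝ] W} {Ψ : Trilin W} (h : IsSU3 J Ψ)
  {ψ : (Fin 3 → W) → ℝ} (hψ : ∀ x y z, ψ ![x, y, z] = Ψ x y z)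
include h hψ

theorem IsSU3.comp_one_mem (l : ℝ) :
    Ψ ∘ₗ (l • LinearMap.id) ∈ ghW1 J ⊓ rSymm ψ := by
  refine ⟨⟨h.comp_mem_uPerp _, fun x z ↦ ?_⟩, fun x y ↦ ?_⟩
  · have := h.swap₁₂ x x z
    have h0 : Ψ x x z = 0 := by linarith
    simp [h0]
  · rw [h.rForm_comp hψ, h.rForm_comp hψ]
    simp only [LinearMap.smul_apply, LinearMap.id_apply, real_inner_smul_left]
    rw [real_inner_comm]

theorem IsSU3.comp_J_mem (m : ℝ) :
    Ψ ∘ₗ (m • J) ∈ ghW1 J ⊓ rSkew ψ := by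
  refine ⟨⟨h.comp_mem_uPerp _, fun x z ↦ ?_⟩, fun x y ↦ ?_⟩
  · have h1 := h.swap₁₂ (J x) x z
    rw [← h.J_left] at h1
    have h0 : Ψ (J x) x z = 0 := by linarith
    simp [h0]
  · rw [h.rForm_comp hψ, h.rForm_comp hψ]
    simp only [LinearMap.smul_apply, real_inner_smul_left, h.J_skew x, real_inner_comm x (J y)]
    ring

theorem IsSU3.rForm_of_mem_W1p {a : Trilin W} (ha : a ∈ ghW1 J ⊓ rSymm ψ) :
    ∃ l : ℝ, ∀ x y, rForm ψ a x y = l * ⟪x, y⟫_ℝ := by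
  obtain ⟨l, m, hlm⟩ := h.exists_rForm_of_mem_ghW1 hψ ha.1
  refine ⟨l, fun x y ↦ ?_⟩
  have h3 := ha.2 x y
  have h4 := h.J_skew x y
  rw [hlm, hlm, real_inner_comm x y, real_inner_comm x (J y)] at h3
  rw [hlm]
  linear_combination h3 / 2 + m / 2 * h4

theorem IsSU3.rForm_of_mem_W1m {a : Trilin W} (ha : a ∈ ghW1 J ⊓ rSkew ψ) :
    ∃ m : ℝ, ∀ x y, rForm ψ a x y = m * ⟪J x, y⟫_ℝ := by
  obtain ⟨l, m, hlm⟩ := h.exists_rForm_of_mem_ghW1 hψ ha.1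
  refine ⟨m, fun x y ↦ ?_⟩
  have h3 := ha.2 x y
  have h4 := h.J_skew x y
  rw [hlm, hlm, real_inner_comm x y, real_inner_comm x (J y)] at h3
  rw [hlm]
  linear_combination h3 / 2 - m / 2 * h4

/-- W₂ corresponds to operators commuting with J and W₃ to operators anticommuting with J. This sign
separates W₃ from the other modules below. -/
theorem IsSU3.rForm_J_J_of_mem_ghW2 {a : Trilin W} (ha : a ∈ ghW2 J) (x y : W) :
    rForm ψ a (J x) (J y) = rForm ψ a x y := by
  rw [h.rForm_J_J hψ ha.1 (h.ghW2_J_J ha)]; ring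

theorem IsSU3.rForm_J_J_of_mem_ghW3 {a : Trilin W} (ha : a ∈ ghW3 J) (x y : W) :
    rForm ψ a (J x) (J y) = -rForm ψ a x y := by
  rw [h.rForm_J_J hψ ha.1 (s := 1) (fun x y z ↦ by rw [ha.2.1, one_mul])]; ring

theorem IsSU3.sum_rForm_of_mem_ghW3 {a : Trilin W} (ha : a ∈ ghW3 J) :
    ∑ i, rForm ψ a (𝐞 i) (𝐞 i) = 0 ∧ ∑ i, rForm ψ a (𝐞 i) (J (𝐞 i)) = 0 := by
  have hJ := h.rForm_J_J_of_mem_ghW3 hψ ha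
  obtain ⟨R, rfl⟩ := h.exists_eq_comp ha.1
  simp only [h.rForm_comp hψ] at hJ ⊢
  exact ⟨h.sum_eq_zero_of_J_J (f := (innerₗ W) ∘ₗ R) hJ,
    h.sum_eq_zero_of_J_J (f := ((innerₗ W) ∘ₗ R).compl₂ J) fun x y ↦ hJ x (J y)⟩

end

/-- The pairs `(a, η)` for which the form `r(a)` satisfies a linear condition. -/
def rCondition (ψ : (Fin 3 → W) → ℝ) (S : Submodule ℝ (W → W → ℝ)) :
    Submodule ℝ (Trilin W × Module.Dual ℝ W) :=
  S.comap (rFormL ψ ∘ₗ LinearMap.fst ℝ _ _)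

/-- Bilinear forms with vanishing contraction. -/
def contractionZero (T : W →ₗ[ℝ] W) : Submodule ℝ (W → W → ℝ) where
  carrier := {f | ∑ i, f (𝐞 i) (T (𝐞 i)) = 0}
  zero_mem' := by simp
  add_mem' {f g} hf hg := by
    simp only [mem_ofPred_eq, Pi.add_apply, Finset.sum_add_distrib] at *
    rw [hf, hg, add_zero]
  smul_mem' c f hf := by
    simp only [mem_ofPred_eq, Pi.smul_apply, smul_eq_mul, ← Finset.mul_sum] at *
    rw [hf, mul_zero]

/-- Bilinear forms whose `J`-invariant part of parity `ε` is a multiple of `g`. -/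
def invariantPartSpan (J : W →ₗ[ℝ] W) (ε : ℝ) (g : W → W → ℝ) : Submodule ℝ (W → W → ℝ) where
  carrier := {f | ∃ l : ℝ, ∀ x y,
    f x y + ε * f y x + (f (J x) (J y) + ε * f (J y) (J x)) = l * g x y}
  zero_mem' := ⟨0, by simp⟩
  add_mem' := by
    rintro f f' ⟨l, hl⟩ ⟨l', hl'⟩
    refine ⟨l + l', fun x y ↦ ?_⟩
    simp only [Pi.add_apply]
    linear_combination hl x y + hl' x y
  smul_mem' := by
    rintro c f ⟨l, hl⟩
    refine ⟨c * l, fun x y ↦ ?_⟩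
    simp only [Pi.smul_apply, smul_eq_mul]
    linear_combination c * hl x y

/-- `J`-invariant bilinear forms. -/
def invariantForms (J : W →ₗ[ℝ] W) : Submodule ℝ (W → W → ℝ) where
  carrier := {f | ∀ x y, f (J x) (J y) = f x y}
  zero_mem' := by simp
  add_mem' {f g} hf hg x y := by simp only [Pi.add_apply, hf x y, hg x y]
  smul_mem' c f hf x y := by simp only [Pi.smul_apply, hf x y]

namespace IsTorsionSplit

variable {J : W →ₗ[ℝ] W} {Ψ : Trilin W} (h : IsSU3 J Ψ)
  {ψ : (Fin 3 → W) → ℝ} (hψ : ∀ x y z, ψ ![x, y, z] = Ψ x y z)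
  {P Q N : W →ₗ[ℝ] W} (H : IsTorsionSplit J P Q N)
include h H

theorem sum_P_J : ∑ i, ⟪P (𝐞 i), J (𝐞 i)⟫_ℝ = 0 := by
  refine Finset.sum_eq_zero fun i _ ↦ ?_
  have h1 := H.P_symm (𝐞 i) (J (𝐞 i))
  have h2 := h.J_skew (P (𝐞 i)) (𝐞 i)
  rw [H.P_J] at h1
  linarith [real_inner_comm (𝐞 i) (J (P (𝐞 i)))]

omit h in
theorem sum_Q : ∑ i, ⟪Q (𝐞 i), 𝐞 i⟫_ℝ = 0 := by
  refine Finset.sum_eq_zero fun i _ ↦ ?_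
  have h1 := H.Q_skew (𝐞 i) (𝐞 i)
  rw [real_inner_comm] at h1
  linarith [real_inner_comm (𝐞 i) (Q (𝐞 i))]

theorem inner_N_J_J (x y : W) : ⟪N (J x), J y⟫_ℝ = -⟪N x, y⟫_ℝ := by
  rw [H.N_J, inner_neg_left, h.inner_J_J]

theorem sum_N : ∑ i, ⟪N (𝐞 i), 𝐞 i⟫_ℝ = 0 :=
  h.sum_eq_zero_of_J_J (f := (innerₗ W) ∘ₗ N) (H.inner_N_J_J h)

theorem sum_N_J : ∑ i, ⟪N (𝐞 i), J (𝐞 i)⟫_ℝ = 0 :=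
  h.sum_eq_zero_of_J_J (f := ((innerₗ W) ∘ₗ N).compl₂ J) fun x y ↦ H.inner_N_J_J h x (J y)

/-- The trace of `P` against `J` vanishes automatically because `J ∘ P` is skew, so the trace-free
condition suffices for `mem_ghW2`. For `Q` below the roles of the two traces are exchanged. -/
theorem comp_P_mem (hψ : ∀ x y z, ψ ![x, y, z] = Ψ x y z) : Ψ ∘ₗ P ∈ ghW2 J ⊓ rSymm ψ := by
  refine ⟨h.mem_ghW2 hψ (h.comp_mem_uPerp P) (fun x y z ↦ ?_) ?_ ?_, fun x y ↦ ?_⟩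
  · rw [LinearMap.comp_apply, LinearMap.comp_apply, H.P_J, ← h.J_left, h.J_sq]; simp
  · simpa only [h.rForm_comp hψ] using H.P_trace
  · simpa only [h.rForm_comp hψ] using H.sum_P_J h
  · rw [h.rForm_comp hψ, h.rForm_comp hψ, H.P_symm, real_inner_comm]

theorem comp_Q_mem (hψ : ∀ x y z, ψ ![x, y, z] = Ψ x y z) : Ψ ∘ₗ Q ∈ ghW2 J ⊓ rSkew ψ := by
  refine ⟨h.mem_ghW2 hψ (h.comp_mem_uPerp Q) (fun x y z ↦ ?_) ?_ ?_, fun x y ↦ ?_⟩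
  · rw [LinearMap.comp_apply, LinearMap.comp_apply, H.Q_J, ← h.J_left, h.J_sq]; simp
  · simpa only [h.rForm_comp hψ] using H.sum_Q
  · simpa only [h.rForm_comp hψ] using H.Q_trace
  · rw [h.rForm_comp hψ, h.rForm_comp hψ, H.Q_skew, real_inner_comm]

/-- Anticommutation with J gives the type condition. The trace condition of W₃ is the contraction of
`Ψ`, skew in its first two arguments, with the symmetric operator `N`. -/
theorem comp_N_mem : Ψ ∘ₗ N ∈ ghW3 J := by
  refine ⟨h.comp_mem_uPerp N, fun x y z ↦ ?_, fun z ↦ ?_⟩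
  · rw [LinearMap.comp_apply, LinearMap.comp_apply, H.N_J, ← h.J_left, map_neg, h.J_sq, neg_neg]
  · have h1 := sum_apply_basis_comm (W := W) (rotTrilin Ψ z) H.N_symm
    have h2 : ∀ i, Ψ (𝐞 i) (N (𝐞 i)) z = -Ψ (N (𝐞 i)) (𝐞 i) z := fun i ↦ h.swap₁₂ _ _ _
    have h3 : ∑ i, Ψ (N (𝐞 i)) (𝐞 i) z = ∑ i, Ψ (𝐞 i) (N (𝐞 i)) z := h1
    simp only [h2, Finset.sum_neg_distrib] at h3
    simp only [LinearMap.comp_apply]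
    linarith

include hψ

/-- For each class absent from `T` there is a linear condition satisfied by every other module
except W₄, hence by their sum, which forces the corresponding component to vanish. In order: r(a)
has zero trace; it has zero trace against J; its symmetric J-invariant part is a multiple of the
metric; its skew J-invariant part is a multiple of ⟪J ·, ·⟫; it is J-invariant; the one-form is
zero. No independence of the modules has to be known beforehand. -/
theorem inner_split_of_mem (T : Set TorsionClass) (hT : W4 ∉ T) (l m : ℝ)
    {η : Module.Dual ℝ W}
    (hmem : (Ψ ∘ₗ (l • LinearMap.id + m • J + P + Q + N), η)
      ∈ ⨆ c ∈ T, torsionModule J ψ c) :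
    (W1p ∉ T → l = 0) ∧ (W1m ∉ T → m = 0) ∧ (W2p ∉ T → P = 0) ∧ (W2m ∉ T → Q = 0) ∧
      (W3 ∉ T → N = 0) ∧ (W5 ∉ T → η = 0) := by
  have hle : ∀ K : Submodule ℝ (Trilin W × Module.Dual ℝ W),
      (∀ c ∈ T, torsionModule J ψ c ≤ K) →
        (Ψ ∘ₗ (l • LinearMap.id + m • J + P + Q + N), η) ∈ K :=
    fun K hK ↦ iSup₂_le hK hmem
  have hR : ∀ x y, rForm ψ (Ψ ∘ₗ (l • LinearMap.id + m • J + P + Q + N)) x y =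
      l * ⟪x, y⟫_ℝ + m * ⟪J x, y⟫_ℝ + ⟪P x, y⟫_ℝ + ⟪Q x, y⟫_ℝ + ⟪N x, y⟫_ℝ := fun x y ↦ by
    rw [h.rForm_comp hψ]
    simp only [LinearMap.add_apply, LinearMap.smul_apply, LinearMap.id_apply, inner_add_left,
      real_inner_smul_left]
  have hz : ∀ x y, rForm ψ 0 x y = 0 := fun x y ↦ by simp [rForm]
  have hJi : ∀ i, ⟪J (𝐞 i), 𝐞 i⟫_ℝ = 0 := fun i ↦ by rw [h.J_skew, h.inner_J_self, neg_zero]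
  have heq0 : ∀ {A : W →ₗ[ℝ] W}, (∀ x y, ⟪A x, y⟫_ℝ = 0) → A = 0 := fun hA ↦ by
    ext x; exact ext_inner_right ℝ fun y ↦ by rw [hA]; simp
  refine ⟨fun hc ↦ ?_, fun hc ↦ ?_, fun hc ↦ ?_, fun hc ↦ ?_, fun hc ↦ ?_, fun hc ↦ ?_⟩
  · have key : ∑ i, rForm ψ (Ψ ∘ₗ (l • LinearMap.id + m • J + P + Q + N)) (𝐞 i) (𝐞 i) = 0 := by
      refine hle (rCondition ψ (contractionZero LinearMap.id)) fun c hcT τ hτ ↦ ?_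
      change ∑ i, rForm ψ τ.1 (𝐞 i) (𝐞 i) = 0
      cases c with
      | W1p => exact absurd hcT hc
      | W1m =>
        obtain ⟨m, hm⟩ := h.rForm_of_mem_W1m hψ hτ.1
        exact Finset.sum_eq_zero fun i _ ↦ by rw [hm, hJi, mul_zero]
      | W2p => exact h.sum_rForm_of_mem_ghW2 hψ hτ.1.1
      | W2m => exact h.sum_rForm_of_mem_ghW2 hψ hτ.1.1
      | W3 => exact (h.sum_rForm_of_mem_ghW3 hψ hτ.1).1
      | W4 => exact absurd hcT hT
      | W5 => exact Finset.sum_eq_zero fun i _ ↦ by rw [(hτ.1 : τ.1 = 0), hz]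
    simp only [hR, Finset.sum_add_distrib, ← Finset.mul_sum, h.sum_inner_self, hJi, H.P_trace,
      H.sum_Q, H.sum_N h, Finset.sum_const_zero] at key
    linarith
  · have key : ∑ i, rForm ψ (Ψ ∘ₗ (l • LinearMap.id + m • J + P + Q + N)) (𝐞 i) (J (𝐞 i)) = 0 := by
      refine hle (rCondition ψ (contractionZero J)) fun c hcT τ hτ ↦ ?_
      change ∑ i, rForm ψ τ.1 (𝐞 i) (J (𝐞 i)) = 0
      cases c with
      | W1m => exact absurd hcT hc
      | W1p =>
        obtain ⟨l, hl⟩ := h.rForm_of_mem_W1p hψ hτ.1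
        exact Finset.sum_eq_zero fun i _ ↦ by rw [hl, h.inner_J_self, mul_zero]
      | W2p => exact h.sum_rForm_J_of_mem_ghW2 hψ hτ.1.1
      | W2m => exact h.sum_rForm_J_of_mem_ghW2 hψ hτ.1.1
      | W3 => exact (h.sum_rForm_of_mem_ghW3 hψ hτ.1).2
      | W4 => exact absurd hcT hT
      | W5 => exact Finset.sum_eq_zero fun i _ ↦ by rw [(hτ.1 : τ.1 = 0), hz]
    simp only [hR, Finset.sum_add_distrib, ← Finset.mul_sum, h.inner_J_self, h.inner_J_J,
      h.sum_inner_self, H.sum_P_J h, H.Q_trace, H.sum_N_J h, Finset.sum_const_zero] at key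
    linarith
  · obtain ⟨l', hl'⟩ : ∃ l' : ℝ, ∀ x y, rForm ψ (Ψ ∘ₗ (l • LinearMap.id + m • J + P + Q + N)) x y
        + 1 * rForm ψ (Ψ ∘ₗ (l • LinearMap.id + m • J + P + Q + N)) y x
        + (rForm ψ (Ψ ∘ₗ (l • LinearMap.id + m • J + P + Q + N)) (J x) (J y)
        + 1 * rForm ψ (Ψ ∘ₗ (l • LinearMap.id + m • J + P + Q + N)) (J y) (J x))
        = l' * ⟪x, y⟫_ℝ := by
      refine hle (rCondition ψ (invariantPartSpan J 1 fun x y ↦ ⟪x, y⟫_ℝ)) fun c hcT τ hτ ↦ ?_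
      change ∃ l' : ℝ, ∀ x y, rForm ψ τ.1 x y + 1 * rForm ψ τ.1 y x
        + (rForm ψ τ.1 (J x) (J y) + 1 * rForm ψ τ.1 (J y) (J x)) = l' * ⟪x, y⟫_ℝ
      cases c with
      | W1p =>
        obtain ⟨l, hl⟩ := h.rForm_of_mem_W1p hψ hτ.1
        refine ⟨4 * l, fun x y ↦ ?_⟩
        simp only [hl, h.inner_J_J, real_inner_comm x y]
        ring
      | W1m =>
        refine ⟨0, fun x y ↦ ?_⟩
        rw [hτ.1.2 x y, hτ.1.2 (J x) (J y)]
        ring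
      | W2p => exact absurd hcT hc
      | W2m =>
        refine ⟨0, fun x y ↦ ?_⟩
        rw [hτ.1.2 x y, hτ.1.2 (J x) (J y)]
        ring
      | W3 =>
        refine ⟨0, fun x y ↦ ?_⟩
        rw [h.rForm_J_J_of_mem_ghW3 hψ hτ.1, h.rForm_J_J_of_mem_ghW3 hψ hτ.1]
        ring
      | W4 => exact absurd hcT hT
      | W5 =>
        have h0 : τ.1 = 0 := hτ.1
        exact ⟨0, fun x y ↦ by simp only [h0, hz]; ring⟩
    -- In the symmetrised, J-averaged sum the identity and `P` survive with factor 4, while `J`, `Q`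
    -- and `N` cancel. So `P` is a multiple of the identity, and its zero trace makes the multiple
    -- zero.
    have hP : ∀ x y, ⟪P x, y⟫_ℝ = (l' / 4 - l) * ⟪x, y⟫_ℝ := by
      intro x y
      have h1 := hl' x y
      have e1 := H.inner_N_J_J h x y
      have e2 := H.inner_N_J_J h y x
      simp only [hR, H.P_J, H.Q_J, h.inner_J_J, e1, e2, real_inner_comm x y] at h1
      have e3 := h.J_skew x y
      have e4 := H.Q_skew x y
      have e5 := H.P_symm x y
      rw [real_inner_comm x (J y), real_inner_comm x (P y), real_inner_comm x (Q y)] at h1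
      linear_combination h1 / 4 - m / 2 * e3 - e4 / 2 + e5 / 2
    have h0 := H.P_trace
    simp only [hP, ← Finset.mul_sum, h.sum_inner_self] at h0
    have h0' : l' / 4 - l = 0 := by linarith
    exact heq0 fun x y ↦ by rw [hP, h0', zero_mul]
  · obtain ⟨l', hl'⟩ : ∃ l' : ℝ, ∀ x y, rForm ψ (Ψ ∘ₗ (l • LinearMap.id + m • J + P + Q + N)) x y
        + -1 * rForm ψ (Ψ ∘ₗ (l • LinearMap.id + m • J + P + Q + N)) y x
        + (rForm ψ (Ψ ∘ₗ (l • LinearMap.id + m • J + P + Q + N)) (J x) (J y)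
        + -1 * rForm ψ (Ψ ∘ₗ (l • LinearMap.id + m • J + P + Q + N)) (J y) (J x))
        = l' * ⟪J x, y⟫_ℝ := by
      refine hle (rCondition ψ (invariantPartSpan J (-1) fun x y ↦ ⟪J x, y⟫_ℝ))
        fun c hcT τ hτ ↦ ?_
      change ∃ l' : ℝ, ∀ x y, rForm ψ τ.1 x y + -1 * rForm ψ τ.1 y x
        + (rForm ψ τ.1 (J x) (J y) + -1 * rForm ψ τ.1 (J y) (J x)) = l' * ⟪J x, y⟫_ℝ
      cases c with
      | W1p =>
        refine ⟨0, fun x y ↦ ?_⟩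
        rw [hτ.1.2 x y, hτ.1.2 (J x) (J y)]
        ring
      | W1m =>
        obtain ⟨l, hl⟩ := h.rForm_of_mem_W1m hψ hτ.1
        refine ⟨4 * l, fun x y ↦ ?_⟩
        simp only [hl, h.inner_J_J, h.J_skew y x, real_inner_comm (J x) y]
        ring
      | W2p =>
        refine ⟨0, fun x y ↦ ?_⟩
        rw [hτ.1.2 x y, hτ.1.2 (J x) (J y)]
        ring
      | W2m => exact absurd hcT hc
      | W3 =>
        refine ⟨0, fun x y ↦ ?_⟩
        rw [h.rForm_J_J_of_mem_ghW3 hψ hτ.1, h.rForm_J_J_of_mem_ghW3 hψ hτ.1]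
        ring
      | W4 => exact absurd hcT hT
      | W5 =>
        have h0 : τ.1 = 0 := hτ.1
        exact ⟨0, fun x y ↦ by simp only [h0, hz]; ring⟩
    -- Skew-symmetrisation keeps `J` and `Q` instead, and the trace of `Q` against `J` removes the
    -- remaining multiple.
    have hQ : ∀ x y, ⟪Q x, y⟫_ℝ = (l' / 4 - m) * ⟪J x, y⟫_ℝ := by
      intro x y
      have h1 := hl' x y
      have e1 := H.inner_N_J_J h x y
      have e2 := H.inner_N_J_J h y x
      simp only [hR, H.P_J, H.Q_J, h.inner_J_J, e1, e2, real_inner_comm x y] at h1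
      have e3 := h.J_skew x y
      have e4 := H.Q_skew x y
      have e5 := H.P_symm x y
      rw [real_inner_comm x (J y), real_inner_comm x (P y), real_inner_comm x (Q y)] at h1
      linear_combination h1 / 4 + m / 2 * e3 + e4 / 2 - e5 / 2
    have h0 := H.Q_trace
    simp only [hQ, h.inner_J_J, ← Finset.mul_sum, h.sum_inner_self] at h0
    have h0' : l' / 4 - m = 0 := by linarith
    exact heq0 fun x y ↦ by rw [hQ, h0', zero_mul]
  · have key : ∀ x y, rForm ψ (Ψ ∘ₗ (l • LinearMap.id + m • J + P + Q + N)) (J x) (J y)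
        = rForm ψ (Ψ ∘ₗ (l • LinearMap.id + m • J + P + Q + N)) x y := by
      refine hle (rCondition ψ (invariantForms J)) fun c hcT τ hτ ↦ ?_
      change ∀ x y, rForm ψ τ.1 (J x) (J y) = rForm ψ τ.1 x y
      cases c with
      | W1p =>
        obtain ⟨l, hl⟩ := h.rForm_of_mem_W1p hψ hτ.1
        exact fun x y ↦ by rw [hl, hl, h.inner_J_J]
      | W1m =>
        obtain ⟨l, hl⟩ := h.rForm_of_mem_W1m hψ hτ.1
        exact fun x y ↦ by rw [hl, hl, h.inner_J_J]
      | W2p => exact h.rForm_J_J_of_mem_ghW2 hψ hτ.1.1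
      | W2m => exact h.rForm_J_J_of_mem_ghW2 hψ hτ.1.1
      | W3 => exact absurd hcT hc
      | W4 => exact absurd hcT hT
      | W5 => exact fun x y ↦ by rw [(hτ.1 : τ.1 = 0), hz, hz]
    refine heq0 fun x y ↦ ?_
    have h1 := key x y
    simp only [hR, H.P_J, H.Q_J, h.inner_J_J, H.inner_N_J_J h] at h1
    linarith
  · refine hle (LinearMap.ker (LinearMap.snd ℝ _ _)) fun c hcT τ hτ ↦ ?_
    change τ.2 = 0
    cases c with
    | W5 => exact absurd hcT hc
    | W4 => exact absurd hcT hT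
    | _ => exact hτ.2

/-- Conversely, each of the six summands lies in its own module, and it is zero whenever that module
is absent from `T`. -/
theorem mem_iSup_torsionModule_iff (T : Set TorsionClass) (hT : W4 ∉ T) (l m : ℝ)
    (η : Module.Dual ℝ W) :
    (Ψ ∘ₗ (l • LinearMap.id + m • J + P + Q + N), η) ∈ ⨆ c ∈ T, torsionModule J ψ c ↔
    (W1p ∉ T → l = 0) ∧ (W1m ∉ T → m = 0) ∧ (W2p ∉ T → P = 0) ∧ (W2m ∉ T → Q = 0) ∧
      (W3 ∉ T → N = 0) ∧ (W5 ∉ T → η = 0) := by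
  refine ⟨H.inner_split_of_mem h hψ T hT l m, fun ⟨h1, h2, h3, h4, h5, h6⟩ ↦ ?_⟩
  have mem : ∀ (c : TorsionClass) (τ : Trilin W × Module.Dual ℝ W), τ ∈ torsionModule J ψ c →
      (c ∉ T → τ = 0) → τ ∈ ⨆ c ∈ T, torsionModule J ψ c := by
    intro c τ hτ h0
    by_cases hc : c ∈ T
    · exact Submodule.mem_iSup_of_mem c (Submodule.mem_iSup_of_mem hc hτ)
    · rw [h0 hc]; exact zero_mem _
  have e : (Ψ ∘ₗ (l • LinearMap.id + m • J + P + Q + N), η)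
      = (Ψ ∘ₗ (l • LinearMap.id), 0) + (Ψ ∘ₗ (m • J), 0) + (Ψ ∘ₗ P, 0) + (Ψ ∘ₗ Q, 0)
        + (Ψ ∘ₗ N, 0) + ((0 : Trilin W), η) := by
    simp [LinearMap.comp_add]
  rw [e]
  refine add_mem (add_mem (add_mem (add_mem (add_mem ?_ ?_) ?_) ?_) ?_) ?_
  · exact mem W1p _ ⟨h.comp_one_mem hψ l, rfl⟩ fun hc ↦ by simp [h1 hc]
  · exact mem W1m _ ⟨h.comp_J_mem hψ m, rfl⟩ fun hc ↦ by simp [h2 hc]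
  · exact mem W2p _ ⟨H.comp_P_mem h hψ, rfl⟩ fun hc ↦ by simp [h3 hc]
  · exact mem W2m _ ⟨H.comp_Q_mem h hψ, rfl⟩ fun hc ↦ by simp [h4 hc]
  · exact mem W3 _ ⟨H.comp_N_mem h, rfl⟩ fun hc ↦ by simp [h5 hc]
  · exact mem W5 _ ⟨rfl, trivial⟩ fun hc ↦ by simp [h6 hc]

end IsTorsionSplit

end Modules

open scoped InnerProductSpace

/-! ### Linear algebra of `G₂`-structures -/

noncomputable section Cayley

variable {V : Type*} [NormedAddCommGroup V] [InnerProductSpace ℝ V] [FiniteDimensional ℝ V]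

/-- In the coordinates of a Cayley frame both sides are explicit polynomials. All further identities
of the cross product are deduced from this one without a frame. -/
theorem cayley_inner_cross_cross {φ : V [⋀^Fin 3]→ₗ[ℝ] ℝ} {b : OrthonormalBasis (Fin 7) ℝ V}
    (h : IsCayleyFrame φ b) (x y z : V) :
    ⟪cross φ x y, cross φ x z⟫_ℝ = ⟪x, x⟫_ℝ * ⟪y, z⟫_ℝ - ⟪x, y⟫_ℝ * ⟪x, z⟫_ℝ := by
  have key : ∀ x y z u : V, ⟪cross φ x y, cross φ z u⟫_ℝ
      = ∑ j, stdG2Form b ![x, y, b j] * stdG2Form b ![z, u, b j] := by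
    intro x y z u
    rw [← b.sum_inner_mul_inner]
    refine Finset.sum_congr rfl fun j _ ↦ ?_
    rw [inner_cross, real_inner_comm, inner_cross, h, h]
  have hin : ∀ x y : V, ⟪x, y⟫_ℝ = ∑ j, ⟪b j, x⟫_ℝ * ⟪b j, y⟫_ℝ := fun x y ↦ by
    rw [← b.sum_inner_mul_inner]
    exact Finset.sum_congr rfl fun j _ ↦ by rw [real_inner_comm]
  rw [key, hin x x, hin y z, hin x y, hin x z]
  simp only [stdG2Form_right]
  generalize hf : (fun i : Fin 7 ↦ (⟪b i, x⟫_ℝ)) = f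
  generalize hg : (fun i : Fin 7 ↦ (⟪b i, y⟫_ℝ)) = g
  generalize hk : (fun i : Fin 7 ↦ (⟪b i, z⟫_ℝ)) = k
  have hf' : ∀ i, ⟪b i, x⟫_ℝ = f i := fun i ↦ by rw [← hf]
  have hg' : ∀ i, ⟪b i, y⟫_ℝ = g i := fun i ↦ by rw [← hg]
  have hk' : ∀ i, ⟪b i, z⟫_ℝ = k i := fun i ↦ by rw [← hk]
  simp only [hf', hg', hk', Fin.sum_univ_seven, Fin.isValue, Fin.reduceAdd]
  ring

/-- The four vectors are those of the summand i = 0, and only this summand is nonzero on them.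
Nonvanishing of *φ is what allows coefficients of *φ to be compared. -/
theorem exists_starForm_ne_zero {φ : V [⋀^Fin 3]→ₗ[ℝ] ℝ} {b : OrthonormalBasis (Fin 7) ℝ V}
    (h : IsCayleyFrame φ b) : ∃ v, starForm φ v ≠ 0 := by
  refine ⟨![b 2, b 4, b 5, b 6], ?_⟩
  have ob : ∀ i j, ⟪b i, b j⟫_ℝ = if i = j then (1 : ℝ) else 0 :=
    fun i j ↦ by simpa using orthonormal_iff_ite.1 b.orthonormal i j
  rw [starForm_eq_of_isCayleyFrame h]
  simp [stdG2StarForm, Matrix.det_succ_row_zero, Fin.sum_univ_succ,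
    Fin.succAbove, ob]

/-- The properties of the cross product of a `G₂`-structure from which the others follow. -/
def IsCrossProduct (φ : V [⋀^Fin 3]→ₗ[ℝ] ℝ) : Prop :=
  ∀ x y z, ⟪cross φ x y, cross φ x z⟫_ℝ = ⟪x, x⟫_ℝ * ⟪y, z⟫_ℝ - ⟪x, y⟫_ℝ * ⟪x, z⟫_ℝ

section

variable (φ : V [⋀^Fin 3]→ₗ[ℝ] ℝ)

omit [FiniteDimensional ℝ V] in
theorem alt3_swap₁₂ (x y z : V) : φ ![x, y, z] = -φ ![y, x, z] := by
  have := φ.map_swap ![y, x, z] (i := 0) (j := 1) (by decide)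
  rw [← this]
  congr 1
  ext i; fin_cases i <;> rfl

omit [FiniteDimensional ℝ V] in
theorem alt3_swap₂₃ (x y z : V) : φ ![x, y, z] = -φ ![x, z, y] := by
  have := φ.map_swap ![x, z, y] (i := 1) (j := 2) (by decide)
  rw [← this]
  congr 1
  ext i; fin_cases i <;> rfl

omit [FiniteDimensional ℝ V] in
theorem alt3_cyclic (x y z : V) : φ ![x, y, z] = φ ![y, z, x] := by
  rw [alt3_swap₁₂, alt3_swap₂₃, neg_neg]

theorem cross_swap (x y : V) : cross φ x y = -cross φ y x := by
  refine ext_inner_right ℝ fun z ↦ ?_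
  rw [inner_neg_left, inner_cross, inner_cross, alt3_swap₁₂]

/-- The cross product as a bilinear map. -/
def crossL : V →ₗ[ℝ] V →ₗ[ℝ] V where
  toFun := cross φ
  map_add' x x' := by
    ext y
    rw [LinearMap.add_apply, cross_swap, map_add, cross_swap φ x, cross_swap φ x']
    abel
  map_smul' c x := by
    ext y
    rw [RingHom.id_apply, LinearMap.smul_apply, cross_swap, map_smul, cross_swap φ x, smul_neg]

@[simp]
theorem crossL_apply (x y : V) : crossL φ x y = cross φ x y := rfl

/-- A three-form as a trilinear form. -/
def altTrilin : Trilin V := (crossL φ).compr₂ (innerₗ V)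

theorem altTrilin_apply (x y z : V) : altTrilin φ x y z = φ ![x, y, z] := inner_cross φ x y z

end

namespace IsCrossProduct

variable {φ : V [⋀^Fin 3]→ₗ[ℝ] ℝ} (h : IsCrossProduct φ)
include h

theorem polarized (x x' y z : V) : ⟪cross φ x y, cross φ x' z⟫_ℝ + ⟪cross φ x' y, cross φ x z⟫_ℝ
    = 2 * ⟪x, x'⟫_ℝ * ⟪y, z⟫_ℝ - ⟪x, y⟫_ℝ * ⟪x', z⟫_ℝ - ⟪x', y⟫_ℝ * ⟪x, z⟫_ℝ := by
  have h1 := h (x + x') y z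
  simp only [← crossL_apply, map_add, LinearMap.add_apply, inner_add_left, inner_add_right] at h1
  simp only [crossL_apply] at h1
  linear_combination h1 - h x y z - h x' y z + ⟪y, z⟫_ℝ * real_inner_comm x x'

/-- Modulo products of metrics the polarised identity makes ⟪P(x, y), P(z, u)⟫ totally skew. The
three terms of the cyclic sum then agree up to metric terms, which cancels the factor 1/3. -/
theorem starForm_eq (v : Fin 4 → V) : starForm φ v = ⟪v 0, v 2⟫_ℝ * ⟪v 1, v 3⟫_ℝ
    - ⟪v 0, v 3⟫_ℝ * ⟪v 1, v 2⟫_ℝ - ⟪cross φ (v 0) (v 1), cross φ (v 2) (v 3)⟫_ℝ := by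
  have h1 := h.polarized (v 0) (v 3) (v 2) (v 1)
  have h2 := h.polarized (v 0) (v 1) (v 3) (v 2)
  have e1 : ⟪cross φ (v 3) (v 2), cross φ (v 0) (v 1)⟫_ℝ
      = -⟪cross φ (v 0) (v 1), cross φ (v 2) (v 3)⟫_ℝ := by
    rw [cross_swap φ (v 3), inner_neg_left, real_inner_comm]
  have e2 : ⟪cross φ (v 1) (v 3), cross φ (v 0) (v 2)⟫_ℝ
      = -⟪cross φ (v 0) (v 2), cross φ (v 3) (v 1)⟫_ℝ := by
    rw [cross_swap φ (v 1), inner_neg_left, real_inner_comm]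
  rw [e1] at h1
  rw [e2] at h2
  rw [real_inner_comm (v 1) (v 2), real_inner_comm (v 1) (v 3), real_inner_comm (v 2) (v 3)] at h1
  rw [real_inner_comm (v 2) (v 3)] at h2
  rw [starForm]
  linear_combination (-1 / 3) * (2 * h1 + h2)

theorem starForm_vec (x y z u : V) : starForm φ ![x, y, z, u] = ⟪x, z⟫_ℝ * ⟪y, u⟫_ℝ
    - ⟪x, u⟫_ℝ * ⟪y, z⟫_ℝ - ⟪cross φ x y, cross φ z u⟫_ℝ := by
  rw [h.starForm_eq]; rfl

end IsCrossProduct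

/-- A hyperplane with unit normal `n` in a seven-dimensional space, as the image of an isometry. -/
structure IsHyperplane {W : Type*} [NormedAddCommGroup W] [InnerProductSpace ℝ W]
    (t : W →ₗ[ℝ] V) (n : V) : Prop where
  isometry : ∀ x y, ⟪t x, t y⟫_ℝ = ⟪x, y⟫_ℝ
  norm_n : ⟪n, n⟫_ℝ = 1
  inner_n : ∀ x, ⟪n, t x⟫_ℝ = 0
  finrank_W : Module.finrank ℝ W = 6
  finrank_V : Module.finrank ℝ V = 7

namespace IsHyperplane

variable {W : Type*} [NormedAddCommGroup W] [InnerProductSpace ℝ W] [FiniteDimensional ℝ W]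
  {t : W →ₗ[ℝ] V} {n : V} (H : IsHyperplane t n)
include H

local notation "𝐞" => stdOrthonormalBasis ℝ W

/-- Otherwise the range of `t`, of dimension 6, and the orthogonal plane spanned by `n` and `u`
would give dimension 8 inside a space of dimension 7. -/
theorem eq_zero_of_inner {u : V} (h0 : ⟪n, u⟫_ℝ = 0) (h1 : ∀ x, ⟪t x, u⟫_ℝ = 0) : u = 0 := by
  by_contra hu
  have hinj : Function.Injective t := by
    rw [← LinearMap.ker_eq_bot, LinearMap.ker_eq_bot']
    intro x hx
    rw [← inner_self_eq_zero (𝕜 := ℝ), ← H.isometry, hx, inner_zero_left]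
  let K : Submodule ℝ V := Submodule.span ℝ {n} ⊔ Submodule.span ℝ {u}
  have hn : n ≠ 0 := by rintro rfl; simpa using H.norm_n
  have hKr : LinearMap.range t ⟂ K := by
    refine Submodule.isOrtho_sup_right.2 ⟨?_, ?_⟩
    · rw [Submodule.isOrtho_comm, Submodule.isOrtho_iff_inner_eq]
      rintro a ha _ ⟨x, rfl⟩
      obtain ⟨c, rfl⟩ := Submodule.mem_span_singleton.1 ha
      rw [real_inner_smul_left, H.inner_n, mul_zero]
    · rw [Submodule.isOrtho_iff_inner_eq]
      rintro _ ⟨x, rfl⟩ b hb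
      obtain ⟨c, rfl⟩ := Submodule.mem_span_singleton.1 hb
      rw [real_inner_smul_right, h1, mul_zero]
  have hnu : Disjoint (Submodule.span ℝ {n}) (Submodule.span ℝ {u}) := by
    refine Submodule.IsOrtho.disjoint ?_
    rw [Submodule.isOrtho_span]
    rintro _ rfl _ rfl
    exact h0
  have hK : Module.finrank ℝ K = 2 := by
    have := Submodule.finrank_sup_add_finrank_inf_eq (Submodule.span ℝ {n}) (Submodule.span ℝ {u})
    rw [hnu.eq_bot, finrank_bot, finrank_span_singleton hn, finrank_span_singleton hu] at this
    exact this
  have h8 := Submodule.finrank_sup_add_finrank_inf_eq (LinearMap.range t) K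
  rw [hKr.disjoint.eq_bot, finrank_bot, hK, LinearMap.finrank_range_of_inj hinj, H.finrank_W] at h8
  have := Submodule.finrank_le (LinearMap.range t ⊔ K)
  rw [H.finrank_V] at this
  omega

theorem decomp (u : V) : u = t (LinearMap.adjoint t u) + ⟪n, u⟫_ℝ • n := by
  rw [← sub_eq_zero]
  refine H.eq_zero_of_inner ?_ fun x ↦ ?_
  · rw [inner_sub_right, inner_add_right, real_inner_smul_right, H.inner_n, H.norm_n]
    ring
  · rw [inner_sub_right, inner_add_right, real_inner_smul_right, H.isometry,
      LinearMap.adjoint_inner_right, real_inner_comm n, H.inner_n]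
    ring

theorem inner_adjoint (u v : V) :
    ⟪LinearMap.adjoint t u, LinearMap.adjoint t v⟫_ℝ = ⟪u, v⟫_ℝ - ⟪n, u⟫_ℝ * ⟪n, v⟫_ℝ := by
  rw [LinearMap.adjoint_inner_left]
  conv_rhs => rw [H.decomp v]
  simp only [inner_add_right, real_inner_smul_right, H.inner_n, H.norm_n, real_inner_comm u n]
  ring

section

variable {φ : V [⋀^Fin 3]→ₗ[ℝ] ℝ}

/-- The almost complex structure induced on the hyperplane. -/
def _root_.hypJ (t : W →ₗ[ℝ] V) (n : V) (φ : V [⋀^Fin 3]→ₗ[ℝ] ℝ) : W →ₗ[ℝ] W :=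
  LinearMap.adjoint t ∘ₗ cross φ n ∘ₗ t

/-- The pullback of a three-form to the hyperplane. -/
def _root_.hypForm (t : W →ₗ[ℝ] V) (φ : V [⋀^Fin 3]→ₗ[ℝ] ℝ) : Trilin W :=
  ((altTrilin φ).compl₁₂ t t).compr₂ (LinearMap.lcomp ℝ ℝ t)

omit H [FiniteDimensional ℝ W] in
theorem _root_.hypForm_apply (x y z : W) : hypForm t φ x y z = φ ![t x, t y, t z] :=
  altTrilin_apply φ _ _ _

/-- P(n, t x) is orthogonal to n, so nothing is lost when the adjoint projects it to the hyperplane.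
-/
theorem t_hypJ (x : W) : t (hypJ t n φ x) = cross φ n (t x) := by
  conv_rhs => rw [H.decomp (cross φ n (t x))]
  rw [real_inner_comm, inner_cross]
  have h0 : φ ![n, t x, n] = 0 := φ.map_eq_zero_of_eq _ (i := 0) (j := 2) rfl (by decide)
  rw [h0, zero_smul, add_zero]
  rfl

theorem inner_hypJ (x y : W) : ⟪hypJ t n φ x, y⟫_ℝ = φ ![n, t x, t y] := by
  rw [← H.isometry, H.t_hypJ, inner_cross]

theorem inner_n_cross (x y : W) : ⟪n, cross φ (t x) (t y)⟫_ℝ = ⟪hypJ t n φ x, y⟫_ℝ := by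
  rw [real_inner_comm, inner_cross, H.inner_hypJ, alt3_cyclic φ n, alt3_cyclic]

variable (hφ : IsCrossProduct φ)
include hφ

-- Summing over a tangent basis gives the full inner product of the cross products minus the product
-- of their normal components, and the normal component of P(t x, t y) is ⟪J x, y⟫.
omit hφ in
theorem sum_hypForm (x y z u : W) :
    ∑ i, hypForm t φ x y (𝐞 i) * hypForm t φ z u (𝐞 i)
      = ⟪cross φ (t x) (t y), cross φ (t z) (t u)⟫_ℝ
        - ⟪hypJ t n φ x, y⟫_ℝ * ⟪hypJ t n φ z, u⟫_ℝ := by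
  rw [← H.inner_n_cross, ← H.inner_n_cross, ← H.inner_adjoint, ← sum_inner_basis_mul]
  refine Finset.sum_congr rfl fun i _ ↦ ?_
  simp only [hypForm_apply, LinearMap.adjoint_inner_left, inner_cross]

theorem hypJ_sq (x : W) : hypJ t n φ (hypJ t n φ x) = -x := by
  refine ext_inner_right ℝ fun y ↦ ?_
  rw [H.inner_hypJ, H.t_hypJ, alt3_swap₂₃, ← inner_cross, hφ, H.norm_n, H.inner_n, H.isometry,
    inner_neg_left, real_inner_comm]
  ring

omit hφ in
theorem hypJ_skew (x y : W) : ⟪hypJ t n φ x, y⟫_ℝ = -⟪x, hypJ t n φ y⟫_ℝ := by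
  rw [H.inner_hypJ, real_inner_comm, H.inner_hypJ, alt3_swap₂₃]

omit [FiniteDimensional ℝ W] in
theorem inner_cross_n_cross (x y z : W) :
    ⟪cross φ n (t x), cross φ (t y) (t z)⟫_ℝ = -⟪cross φ n (t y), cross φ (t x) (t z)⟫_ℝ := by
  have := hφ.polarized (t x) (t y) n (t z)
  rw [real_inner_comm n (t x), real_inner_comm n (t y), H.inner_n, H.inner_n, H.inner_n] at this
  rw [cross_swap φ n, cross_swap φ n, inner_neg_left, inner_neg_left]
  linarith

omit hφ in
theorem hypForm_J (x y z : W) :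
    hypForm t φ (hypJ t n φ x) y z = ⟪cross φ n (t x), cross φ (t y) (t z)⟫_ℝ := by
  rw [hypForm_apply, H.t_hypJ, alt3_cyclic, ← inner_cross, real_inner_comm]

/-- The difference `D` of the two sides is shown to vanish by its symmetries. It is skew under
enough transpositions to be totally skew, and `J` passes from the first to the second argument
without a sign. Total skewness then lets `J` pass to the third argument without a sign, whereas
moving it across the contraction does produce one. Hence D(J x, y, z, u) = 0, and J is invertible.
-/
theorem sum_hypForm_eq_hermForm (x y z u : W) :
    ∑ i, hypForm t φ x y (𝐞 i) * hypForm t φ z u (𝐞 i) = hermForm (hypJ t n φ) x y z u := by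
  set J := hypJ t n φ with hJ
  have hsq := H.hypJ_sq hφ
  have hsk : ∀ x y, ⟪J x, y⟫_ℝ = -⟪x, J y⟫_ℝ := H.hypJ_skew
  rw [← hJ] at hsq
  have s12 : ∀ x y z, hypForm t φ x y z = -hypForm t φ y x z := fun x y z ↦ by
    simp only [hypForm_apply]; exact alt3_swap₁₂ φ _ _ _
  have hl : ∀ x y z, hypForm t φ (J x) y z = hypForm t φ x (J y) z := fun x y z ↦ by
    rw [s12 x, H.hypForm_J, H.hypForm_J, H.inner_cross_n_cross hφ]
  have s23 : ∀ x y z, hypForm t φ x y z = -hypForm t φ x z y := fun x y z ↦ by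
    simp only [hypForm_apply]; exact alt3_swap₂₃ φ _ _ _
  set F : W → W → W → W → ℝ := fun x y z u ↦ ∑ i, hypForm t φ x y (𝐞 i) * hypForm t φ z u (𝐞 i)
    with hF
  set D : W → W → W → W → ℝ := fun x y z u ↦ F x y z u - hermForm J x y z u with hD
  have hcr : ∀ x y z u, F x y z u = ⟪cross φ (t x) (t y), cross φ (t z) (t u)⟫_ℝ
      - ⟪J x, y⟫_ℝ * ⟪J z, u⟫_ℝ := H.sum_hypForm
  have d12 : ∀ x y z u, D x y z u = -D y x z u := by
    intro x y z u
    have e : F x y z u = -F y x z u := by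
      simp only [hF, s12 x y, neg_mul, Finset.sum_neg_distrib]
    simp only [hD, e, hermForm]; ring
  have d34 : ∀ x y z u, D x y z u = -D x y u z := by
    intro x y z u
    have e : F x y z u = -F x y u z := by
      simp only [hF, s12 z u, mul_neg, Finset.sum_neg_distrib]
    simp only [hD, e, hermForm]; ring
  have d13 : ∀ x y z u, D x y z u = -D z y x u := by
    intro x y z u
    have e := hφ.polarized (t x) (t z) (t y) (t u)
    simp only [H.isometry] at e
    have e1 := hsk x y
    have e2 := hsk z u
    have e3 := hsk z y
    have e4 := hsk x u
    have e5 := hsk y z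
    have e6 := hsk y x
    simp only [hD, hcr, hermForm, e1, e2, e3, e4]
    have e7 : ⟪x, J z⟫_ℝ = -⟪z, J x⟫_ℝ := by
      linarith [hsk x z, real_inner_comm z (J x)]
    have e8 : ⟪y, J z⟫_ℝ = -⟪z, J y⟫_ℝ := by
      linarith [hsk y z, real_inner_comm z (J y)]
    have e9 : ⟪y, J x⟫_ℝ = -⟪x, J y⟫_ℝ := by
      linarith [hsk y x, real_inner_comm x (J y)]
    rw [e7, e8, e9, real_inner_comm x y, real_inner_comm z y, real_inner_comm x z]
    linear_combination e
  have d23 : ∀ x y z u, D x y z u = -D x z y u := by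
    intro x y z u
    rw [d12, d13, d12, neg_neg]
  have dJ : ∀ x y z u, D (J x) y z u = D x (J y) z u := by
    intro x y z u
    have e : F (J x) y z u = F x (J y) z u := by simp only [hF, hl]
    simp only [hD, e, hermForm, hsk, hsq, inner_neg_right]; ring
  -- Here `J` goes to the contracted index of the first factor, crosses to the second factor with a
  -- sign because it is skew, and from there reaches `z`.
  have dJ' : ∀ x y z u, D (J x) y z u = -D x y (J z) u := by
    intro x y z u
    have e : F (J x) y z u = -F x y (J z) u := by
      have hr : ∀ x y z, hypForm t φ (J x) y z = hypForm t φ x y (J z) := fun x y z ↦ by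
        rw [s23 x y (J z), ← hl, s23 (J x) y z]
      have := sum_apply_basis_comm ((LinearMap.mul ℝ ℝ).compl₁₂ (hypForm t φ x y) (hypForm t φ z u))
        (T := J) (T' := -J) (fun x y ↦ by rw [hsk, LinearMap.neg_apply, inner_neg_right])
      simpa [hF, hr, Finset.sum_neg_distrib] using this
    simp only [hD, e, hermForm, hsk, hsq, inner_neg_right]; ring
  have h0 : D x y z u = 0 := by
    have k : ∀ x y z u, D (J x) y z u = 0 := by
      intro x y z u
      have k1 := dJ' x y z u
      have k2 : D x (J y) z u = D x y (J z) u := by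
        rw [← dJ, d23 x y, ← dJ, d23 (J x)]
      linarith [dJ x y z u]
    have k1 := k (J x) y z u
    rw [hsq] at k1
    have : D (-x) y z u = -D x y z u := by
      simp [hD, hF, hermForm, Finset.sum_neg_distrib]; ring
    linarith
  simp only [hD] at h0
  linarith

theorem isSU3 : IsSU3 (hypJ t n φ) (hypForm t φ) where
  J_sq := H.hypJ_sq hφ
  J_skew := H.hypJ_skew
  swap₁₂ x y z := by simp only [hypForm_apply]; exact alt3_swap₁₂ φ _ _ _
  swap₂₃ x y z := by simp only [hypForm_apply]; exact alt3_swap₂₃ φ _ _ _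
  J_left x y z := by
    rw [hypForm_apply x, alt3_swap₁₂, ← hypForm_apply, H.hypForm_J, H.hypForm_J,
      H.inner_cross_n_cross hφ]
  contr := H.sum_hypForm_eq_hermForm hφ
  finrank := H.finrank_W

/-- Since n is orthogonal to the hyperplane, the metric terms of *φ drop out. Consequently both
parts of the complex volume form are combinations of Φ and Φ ∘ J. -/
theorem starForm_n (x y z : W) :
    starForm φ ![n, t x, t y, t z] = -hypForm t φ (hypJ t n φ x) y z := by
  rw [hφ.starForm_vec, H.hypForm_J, H.inner_n, H.inner_n]
  ring

/-- Comparing the two expressions for the contraction of Φ with itself eliminates the inner product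
of cross products. The right-hand side is -½ ω ∧ ω. -/
theorem starForm_tangent (x y z u : W) : starForm φ ![t x, t y, t z, t u] =
    ⟪x, hypJ t n φ z⟫_ℝ * ⟪y, hypJ t n φ u⟫_ℝ - ⟪x, hypJ t n φ u⟫_ℝ * ⟪y, hypJ t n φ z⟫_ℝ
      - ⟪hypJ t n φ x, y⟫_ℝ * ⟪hypJ t n φ z, u⟫_ℝ := by
  have h1 := H.sum_hypForm (φ := φ) x y z u
  rw [H.sum_hypForm_eq_hermForm hφ, hermForm] at h1
  rw [hφ.starForm_vec, H.isometry, H.isometry, H.isometry, H.isometry]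
  linarith

end

end IsHyperplane

end Cayley

open scoped InnerProductSpace

/-! ### The torsion operator of a hypersurface at a point -/

noncomputable section TorsionOperator

variable {W : Type*} [NormedAddCommGroup W] [InnerProductSpace ℝ W] [FiniteDimensional ℝ W]

local notation "𝐞" => stdOrthonormalBasis ℝ W

/-- Multiplication of the complex volume form by a complex number of modulus one. -/
theorem IsSU3.rotate {J : W →ₗ[ℝ] W} {Φ : Trilin W} (h : IsSU3 J Φ) {c s : ℝ}
    (hcs : c ^ 2 + s ^ 2 = 1) : IsSU3 J (c • Φ + s • (Φ ∘ₗ J)) where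
  J_sq := h.J_sq
  J_skew := h.J_skew
  swap₁₂ x y z := by
    simp only [LinearMap.add_apply, LinearMap.smul_apply, LinearMap.comp_apply, smul_eq_mul,
      h.J_left]
    rw [h.swap₁₂ x y, h.swap₁₂ x (J y), h.J_left]; ring
  swap₂₃ x y z := by
    simp only [LinearMap.add_apply, LinearMap.smul_apply, LinearMap.comp_apply, smul_eq_mul]
    rw [h.swap₂₃ x y, h.swap₂₃ (J x) y]; ring
  J_left x y z := by
    simp only [LinearMap.add_apply, LinearMap.smul_apply, LinearMap.comp_apply, smul_eq_mul,
      h.J_left]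
  contr x y z u := by
    have e : ∀ i, (c • Φ + s • (Φ ∘ₗ J)) x y (𝐞 i) * (c • Φ + s • (Φ ∘ₗ J)) z u (𝐞 i)
        = c ^ 2 * (Φ x y (𝐞 i) * Φ z u (𝐞 i)) + c * s * (Φ x y (𝐞 i) * Φ (J z) u (𝐞 i))
          + c * s * (Φ (J x) y (𝐞 i) * Φ z u (𝐞 i)) + s ^ 2 * (Φ (J x) y (𝐞 i) * Φ (J z) u (𝐞 i)) := by
      intro i
      simp only [LinearMap.add_apply, LinearMap.smul_apply, LinearMap.comp_apply, smul_eq_mul]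
      ring
    simp only [e, Finset.sum_add_distrib, ← Finset.mul_sum, h.contr]
    simp only [hermForm, h.J_skew, h.J_sq, map_neg, inner_neg_right]
    linear_combination (⟪x, z⟫_ℝ * ⟪y, u⟫_ℝ - ⟪x, u⟫_ℝ * ⟪y, z⟫_ℝ - ⟪x, J z⟫_ℝ * ⟪y, J u⟫_ℝ
      + ⟪x, J u⟫_ℝ * ⟪y, J z⟫_ℝ) * hcs
  finrank := h.finrank

/-- The `J`-commuting part of an operator. -/
def commPart (J A : W →ₗ[ℝ] W) : W →ₗ[ℝ] W := (1 / 2 : ℝ) • (A - J ∘ₗ A ∘ₗ J)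

/-- The `J`-anticommuting part of an operator. -/
def antiPart (J A : W →ₗ[ℝ] W) : W →ₗ[ℝ] W := (1 / 2 : ℝ) • (A + J ∘ₗ A ∘ₗ J)

namespace IsSU3

variable {J : W →ₗ[ℝ] W} {Φ : Trilin W} (h : IsSU3 J Φ) {A : W →ₗ[ℝ] W}
include h

theorem inner_commPart (x y : W) :
    ⟪commPart J A x, y⟫_ℝ = 1 / 2 * (⟪A x, y⟫_ℝ + ⟪A (J x), J y⟫_ℝ) := by
  simp only [commPart, LinearMap.smul_apply, LinearMap.sub_apply, LinearMap.comp_apply,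
    real_inner_smul_left, inner_sub_left, h.J_skew, sub_neg_eq_add]

theorem inner_antiPart (x y : W) :
    ⟪antiPart J A x, y⟫_ℝ = 1 / 2 * (⟪A x, y⟫_ℝ - ⟪A (J x), J y⟫_ℝ) := by
  simp only [antiPart, LinearMap.smul_apply, LinearMap.add_apply, LinearMap.comp_apply,
    real_inner_smul_left, inner_add_left, h.J_skew]
  ring

theorem commPart_J (x : W) : commPart J A (J x) = J (commPart J A x) := by
  simp only [commPart, LinearMap.smul_apply, LinearMap.sub_apply, LinearMap.comp_apply, map_smul,
    map_sub, h.J_sq, map_neg]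
  congr 1
  abel

theorem antiPart_J (x : W) : antiPart J A (J x) = -J (antiPart J A x) := by
  simp only [antiPart, LinearMap.smul_apply, LinearMap.add_apply, LinearMap.comp_apply, map_smul,
    map_add, h.J_sq, map_neg, ← smul_neg]
  congr 1
  abel

theorem sum_inner_commPart :
    ∑ i, ⟪commPart J A (𝐞 i), 𝐞 i⟫_ℝ = ∑ i, ⟪A (𝐞 i), 𝐞 i⟫_ℝ := by
  have h1 : ∑ i, ⟪A (J (𝐞 i)), J (𝐞 i)⟫_ℝ = ∑ i, ⟪A (𝐞 i), 𝐞 i⟫_ℝ :=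
    h.sum_apply_J_J ((innerₗ W) ∘ₗ A)
  simp only [h.inner_commPart, ← Finset.mul_sum, Finset.sum_add_distrib, h1]
  ring

variable (hA : ∀ x y, ⟪A x, y⟫_ℝ = ⟪x, A y⟫_ℝ)
include hA

/-- Composing the skew map J with a symmetric operator gives a skew operator if the two commute and
a symmetric one if they anticommute. So J times the trace-free commuting part feeds W₂⁻, while both
anticommuting terms stay in W₃ and nothing falls into W₄. -/
theorem isTorsionSplit {m : ℝ} (hm : m = 1 / 6 * ∑ i, ⟪A (𝐞 i), 𝐞 i⟫_ℝ) (c s : ℝ) :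
    IsTorsionSplit J (c • (commPart J A - m • LinearMap.id))
      (-s • (J ∘ₗ (commPart J A - m • LinearMap.id)))
      (c • antiPart J A - s • (J ∘ₗ antiPart J A)) := by
  have hsA : ∀ x y, ⟪commPart J A x, y⟫_ℝ = ⟪x, commPart J A y⟫_ℝ := fun x y ↦ by
    rw [real_inner_comm (commPart J A y), h.inner_commPart, h.inner_commPart, hA, hA,
      real_inner_comm x, real_inner_comm (J x)]
  have hsB : ∀ x y, ⟪antiPart J A x, y⟫_ℝ = ⟪x, antiPart J A y⟫_ℝ := fun x y ↦ by
    rw [real_inner_comm (antiPart J A y), h.inner_antiPart, h.inner_antiPart, hA, hA,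
      real_inner_comm x, real_inner_comm (J x)]
  have hs0 : ∀ x y, ⟪(commPart J A - m • (LinearMap.id : W →ₗ[ℝ] W)) x, y⟫_ℝ
      = ⟪x, (commPart J A - m • (LinearMap.id : W →ₗ[ℝ] W)) y⟫_ℝ := fun x y ↦ by
    simp only [LinearMap.sub_apply, LinearMap.smul_apply, LinearMap.id_apply, inner_sub_left,
      inner_sub_right, hsA, real_inner_smul_left, real_inner_smul_right]
  have hc0 : ∀ x, (commPart J A - m • (LinearMap.id : W →ₗ[ℝ] W)) (J x)
      = J ((commPart J A - m • (LinearMap.id : W →ₗ[ℝ] W)) x) := fun x ↦ by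
    simp only [LinearMap.sub_apply, LinearMap.smul_apply, LinearMap.id_apply, h.commPart_J, map_sub,
      map_smul]
  have ht0 : ∑ i, ⟪(commPart J A - m • (LinearMap.id : W →ₗ[ℝ] W)) (𝐞 i), 𝐞 i⟫_ℝ = 0 := by
    simp only [LinearMap.sub_apply, LinearMap.smul_apply, LinearMap.id_apply, inner_sub_left,
      real_inner_smul_left, Finset.sum_sub_distrib, ← Finset.mul_sum, h.sum_inner_self,
      h.sum_inner_commPart, hm]
    ring
  -- From here on only symmetry, the (anti)commutation with J and the zero trace of the two
  -- operators are used.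
  generalize commPart J A - m • LinearMap.id = C at *
  generalize hB : antiPart J A = D at *
  have hD : ∀ x, D (J x) = -J (D x) := by rw [← hB]; exact h.antiPart_J
  constructor
  · intro x y
    simp only [LinearMap.smul_apply, real_inner_smul_left, real_inner_smul_right, hs0]
  · intro x
    simp only [LinearMap.smul_apply, hc0, map_smul]
  · simp only [LinearMap.smul_apply, real_inner_smul_left, ← Finset.mul_sum, ht0, mul_zero]
  · intro x y
    simp only [LinearMap.smul_apply, LinearMap.comp_apply, real_inner_smul_left,
      real_inner_smul_right, h.J_skew (C x), hs0, hc0]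
    ring
  · intro x
    simp only [LinearMap.smul_apply, LinearMap.comp_apply, hc0, map_smul]
  · simp only [LinearMap.smul_apply, LinearMap.comp_apply, real_inner_smul_left, h.inner_J_J,
      ← Finset.mul_sum, ht0, mul_zero]
  · intro x y
    simp only [LinearMap.sub_apply, LinearMap.smul_apply, LinearMap.comp_apply, inner_sub_left,
      inner_sub_right, real_inner_smul_left, real_inner_smul_right, hsB, h.J_skew (D x), hD,
      inner_neg_right]
    ring
  · intro x
    simp only [LinearMap.sub_apply, LinearMap.smul_apply, LinearMap.comp_apply, hD, map_neg,
      smul_neg, map_sub, map_smul]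
    abel

-- Passing from Φ to the rotated form multiplies the operator by c - sJ, the inverse of c + sJ. The
-- right-hand operator is (c - sJ)(A - κJ) expanded after splitting A into m, the rest of its
-- commuting part and its anticommuting part.
omit hA in
theorem comp_eq_rotate_comp {c s : ℝ} (hcs : c ^ 2 + s ^ 2 = 1) (κ m : ℝ) :
    Φ ∘ₗ (A - κ • J) = (c • Φ + s • (Φ ∘ₗ J)) ∘ₗ
      ((c * m - κ * s) • LinearMap.id + (-(κ * c + s * m)) • J
        + c • (commPart J A - m • LinearMap.id) + -s • (J ∘ₗ (commPart J A - m • LinearMap.id))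
        + (c • antiPart J A - s • (J ∘ₗ antiPart J A))) := by
  have hs : ∀ x, A x = commPart J A x + antiPart J A x := fun x ↦ by
    simp only [commPart, antiPart, LinearMap.smul_apply, LinearMap.add_apply, LinearMap.sub_apply]
    module
  ext x y z
  simp only [LinearMap.comp_apply, LinearMap.sub_apply, LinearMap.smul_apply, LinearMap.id_apply,
    LinearMap.add_apply, map_add, map_sub, map_smul, h.J_sq, map_neg, smul_eq_mul, hs x,
    LinearMap.neg_apply]
  linear_combination (κ * Φ (J x) y z - Φ (commPart J A x) y z - Φ (antiPart J A x) y z) * hcs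

/-- The components of the torsion of a hypersurface with Weingarten map `A` of mean curvature `m`,
in a nearly parallel manifold of constant `4 κ`. -/
theorem mem_iSup_iff {ψ : (Fin 3 → W) → ℝ} {c s : ℝ} (hcs : c ^ 2 + s ^ 2 = 1)
    (hψ : ∀ x y z, ψ ![x, y, z] = c * Φ x y z + s * Φ (J x) y z)
    {m : ℝ} (hm : m = 1 / 6 * ∑ i, ⟪A (𝐞 i), 𝐞 i⟫_ℝ) (κ : ℝ)
    (T : Set TorsionClass) (hT : W4 ∉ T) (η : Module.Dual ℝ W) :
    (Φ ∘ₗ (A - κ • J), η) ∈ ⨆ c ∈ T, torsionModule J ψ c ↔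
      (W1p ∉ T → c * m = κ * s) ∧ (W1m ∉ T → κ * c + s * m = 0) ∧
      (W2p ∉ T → ∀ x y, c * (⟪A x, y⟫_ℝ + ⟪A (J x), J y⟫_ℝ) = 2 * m * c * ⟪x, y⟫_ℝ) ∧
      (W2m ∉ T → ∀ x y, s * (⟪A x, y⟫_ℝ + ⟪A (J x), J y⟫_ℝ) = 2 * m * s * ⟪x, y⟫_ℝ) ∧
      (W3 ∉ T → ∀ x y, ⟪A (J x), J y⟫_ℝ = ⟪A x, y⟫_ℝ) ∧ (W5 ∉ T → η = 0) := by
  have hzero : ∀ L : W →ₗ[ℝ] W, L = 0 ↔ ∀ x y, ⟪L x, y⟫_ℝ = 0 := fun L ↦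
    ⟨fun h x y ↦ by simp [h], fun h ↦ by
      ext x; exact ext_inner_right ℝ fun y ↦ by rw [h]; simp⟩
  rw [h.comp_eq_rotate_comp hcs κ m, (h.isTorsionSplit hA hm c s).mem_iSup_torsionModule_iff
    (h.rotate hcs) (ψ := ψ) (fun x y z ↦ by rw [hψ]; rfl) T hT]
  refine and_congr (imp_congr_right fun _ ↦ ?_) <| and_congr (imp_congr_right fun _ ↦ ?_) <|
    and_congr (imp_congr_right fun _ ↦ ?_) <| and_congr (imp_congr_right fun _ ↦ ?_) <|
    and_congr (imp_congr_right fun _ ↦ ?_) Iff.rfl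
  · exact sub_eq_zero
  · exact neg_eq_zero
  · rw [hzero]
    refine forall₂_congr fun x y ↦ ?_
    simp only [LinearMap.smul_apply, LinearMap.sub_apply, LinearMap.id_apply, real_inner_smul_left,
      inner_sub_left, h.inner_commPart]
    constructor <;> intro H <;> linarith
  · rw [hzero]
    -- The W₂⁻ component carries an extra J, which is moved to the second argument and removed by
    -- substituting J y for y.
    have e : ∀ x y, ⟪(-s • (J ∘ₗ (commPart J A - m • LinearMap.id))) x, y⟫_ℝ
        = s / 2 * (⟪A x, J y⟫_ℝ + ⟪A (J x), J (J y)⟫_ℝ - 2 * m * ⟪x, J y⟫_ℝ) := fun x y ↦ by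
      simp only [LinearMap.smul_apply, LinearMap.comp_apply, LinearMap.sub_apply,
        LinearMap.id_apply, real_inner_smul_left, h.J_skew _ y, inner_sub_left, h.inner_commPart]
      ring
    constructor
    · intro H x y
      have := H x (J y)
      rw [e, h.J_sq] at this
      simp only [map_neg, inner_neg_right] at this
      linarith
    · intro H x y
      rw [e]
      have := H x (J y)
      linarith
  · constructor
    · intro H x y
      have h1 : ∀ x, c • antiPart J A x - s • J (antiPart J A x) = 0 := fun x ↦
        LinearMap.congr_fun H x
      have h2 : ⟪antiPart J A x, y⟫_ℝ = 0 := by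
        -- Applying c + sJ undoes c - sJ, so the W₃ condition does not depend on the angle.
        have h3 : antiPart J A x = c • (c • antiPart J A x - s • J (antiPart J A x))
            + s • J (c • antiPart J A x - s • J (antiPart J A x)) := by
          simp only [map_sub, map_smul, h.J_sq]
          have : antiPart J A x = (c ^ 2 + s ^ 2) • antiPart J A x := by rw [hcs, one_smul]
          conv_lhs => rw [this]
          module
        rw [h3, h1]
        simp
      rw [h.inner_antiPart] at h2
      linarith
    · intro H
      have : antiPart J A = 0 := (hzero _).2 fun x y ↦ by rw [h.inner_antiPart, H, sub_self, mul_zero]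
      simp [this]

-- Used with E = (∇_v I) y, which is dual to such a contraction of Φ: the term Φ(J E, z, w) becomes
-- a contraction of two copies of Φ, hence metric data.
omit hA in
theorem form_J_of_inner {E u y : W} (hE : ∀ x, ⟪x, E⟫_ℝ = Φ u x y) (z w : W) :
    Φ (J E) z w = hermForm J (J u) y z w := by
  rw [← h.contr, h.cyclic, ← sum_inner_mul_apply (Φ z w) (J E)]
  refine Finset.sum_congr rfl fun i _ ↦ ?_
  have h1 := h.J_skew (𝐞 i) E
  rw [hE, ← h.J_left, h.swap₂₃] at h1
  rw [show ⟪𝐞 i, J E⟫_ℝ = Φ (J u) y (𝐞 i) by linarith]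

omit hA in
/-- The identity expressing that `∇ + ξ` annihilates the pullback of the fundamental three-form. -/
theorem nabla_form_eq (κ : ℝ) (v y₁ y₂ y₃ : W) {E₁ E₂ E₃ : W}
    (h₁ : ∀ x, ⟪x, E₁⟫_ℝ = Φ ((A - κ • J) v) x y₁) (h₂ : ∀ x, ⟪x, E₂⟫_ℝ = Φ ((A - κ • J) v) x y₂)
    (h₃ : ∀ x, ⟪x, E₃⟫_ℝ = Φ ((A - κ • J) v) x y₃) :
    κ * (⟪v, J y₂⟫_ℝ * ⟪y₁, J y₃⟫_ℝ - ⟪v, J y₃⟫_ℝ * ⟪y₁, J y₂⟫_ℝ - ⟪J v, y₁⟫_ℝ * ⟪J y₂, y₃⟫_ℝ)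
      + (⟪A v, y₁⟫_ℝ * ⟪J y₂, y₃⟫_ℝ + ⟪A v, y₂⟫_ℝ * ⟪J y₃, y₁⟫_ℝ + ⟪A v, y₃⟫_ℝ * ⟪J y₁, y₂⟫_ℝ)
      = Φ (-(1 / 2 : ℝ) • J E₁) y₂ y₃ + Φ y₁ (-(1 / 2 : ℝ) • J E₂) y₃
        + Φ y₁ y₂ (-(1 / 2 : ℝ) • J E₃) := by
  -- The vectors `E₁`, `E₂`, `E₃` stand for (∇_v I) yᵢ. Each term on the right is rotated so that J
  -- E comes first; on the left are the contribution of *φ and those of the normal parts of ∇_v yᵢ.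
  have e2 : Φ y₁ (-(1 / 2 : ℝ) • J E₂) y₃ = Φ (-(1 / 2 : ℝ) • J E₂) y₃ y₁ := h.cyclic _ _ _
  have e3 : Φ y₁ y₂ (-(1 / 2 : ℝ) • J E₃) = Φ (-(1 / 2 : ℝ) • J E₃) y₁ y₂ := by
    rw [h.cyclic, h.cyclic]
  have hu : ∀ y, ⟪(A - κ • J) v, y⟫_ℝ = ⟪A v, y⟫_ℝ - κ * ⟪J v, y⟫_ℝ := fun y ↦ by
    simp only [LinearMap.sub_apply, LinearMap.smul_apply, inner_sub_left, real_inner_smul_left]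
  have hc : ∀ x y, ⟪y, J x⟫_ℝ = -⟪x, J y⟫_ℝ := fun x y ↦ by
    rw [← h.J_skew, real_inner_comm]
  rw [e2, e3]
  simp only [map_smul, LinearMap.smul_apply, h.form_J_of_inner h₁, h.form_J_of_inner h₂,
    h.form_J_of_inner h₃, smul_eq_mul, hermForm, h.inner_J_J, hu]
  have hv : ∀ y, ⟪v, J y⟫_ℝ = -⟪J v, y⟫_ℝ := fun y ↦ by rw [h.J_skew, neg_neg]
  rw [hv y₂, hv y₃, h.J_skew y₂, h.J_skew y₃, h.J_skew y₁, hc y₁ y₂, hc y₂ y₃, hc y₁ y₃,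
    real_inner_comm y₁ y₂, real_inner_comm y₁ y₃, real_inner_comm y₂ y₃]
  ring

end IsSU3

end TorsionOperator

/-! ### Coordinate vector fields and torsion-free connections -/

section CoordinateFrames

variable {m : ℕ} {X : Type*} [TopologicalSpace X] [ChartedSpace (EuclideanSpace ℝ (Fin m)) X]
  [IsManifold (𝓡 m) ∞ X]

theorem trivializationAt_self_apply {x : X} (v : TangentSpace (𝓡 m) x) :
    (trivializationAt (EuclideanSpace ℝ (Fin m)) (fun x : X ↦ TangentSpace (𝓡 m) x) x ⟨x, v⟩).2
      = v := by
  have h := (tangentBundleCore (𝓡 m) X).coordChange_self (achart _ x) x (mem_chart_source _ x) v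
  exact h

theorem coordExt_eq_symm {x : X} (v : TangentSpace (𝓡 m) x) (y : X) :
    coordExt v y = (trivializationAt (EuclideanSpace ℝ (Fin m))
      (fun x : X ↦ TangentSpace (𝓡 m) x) x).symm y v := by
  rw [coordExt, FiberBundle.extend, trivializationAt_self_apply]

theorem coordExt_eq_symmL {x : X} (v : TangentSpace (𝓡 m) x) {y : X}
    (hy : y ∈ (chartAt (EuclideanSpace ℝ (Fin m)) x).source) :
    coordExt v y = (trivializationAt (EuclideanSpace ℝ (Fin m))
      (fun x : X ↦ TangentSpace (𝓡 m) x) x).symmL ℝ y v := by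
  rw [coordExt_eq_symm]
  exact (Trivialization.symmL_apply _ hy _).symm

@[simp] theorem coordExt_self {x : X} (v : TangentSpace (𝓡 m) x) : coordExt v x = v :=
  FiberBundle.extend_apply_self _ v

theorem trivializationAt_symm_self (x : X) (v : EuclideanSpace ℝ (Fin m)) :
    (trivializationAt (EuclideanSpace ℝ (Fin m)) (fun x : X ↦ TangentSpace (𝓡 m) x) x).symm x v
      = v := by
  exact (coordExt_eq_symm (x := x) v x).symm.trans (coordExt_self (x := x) v)

theorem coordExt_eq_sum {x : X} (v : EuclideanSpace ℝ (Fin m)) {y : X}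
    (hy : y ∈ (chartAt (EuclideanSpace ℝ (Fin m)) x).source) :
    coordExt (x := x) v y
      = ∑ i, v i • coordExt (x := x) (EuclideanSpace.single i (1 : ℝ)) y := by
  have h2 : v = ∑ i, v i • (EuclideanSpace.single i (1 : ℝ)) := by
    simpa using ((EuclideanSpace.basisFun (Fin m) ℝ).sum_repr v).symm
  rw [coordExt_eq_symmL (x := x) v hy]
  refine (congrArg _ h2).trans ((map_sum _ _ _).trans (Finset.sum_congr rfl fun i _ ↦ ?_))
  exact (map_smul _ _ _).trans (congrArg _ (coordExt_eq_symmL (x := x) _ hy).symm)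

theorem mdifferentiableAt_coordExt {x : X} (v : TangentSpace (𝓡 m) x) :
    MDifferentiableAt (𝓡 m) (𝓡 m).tangent
      (fun y ↦ (⟨y, coordExt v y⟩ : TangentBundle (𝓡 m) X)) x :=
  FiberBundle.mdifferentiableAt_extend (𝓡 m) (EuclideanSpace ℝ (Fin m)) v

theorem smoothFieldAt_coordExt {x : X} (v : TangentSpace (𝓡 m) x) :
    SmoothFieldAt (coordExt v) x :=
  FiberBundle.contMDiffAt_extend (𝓡 m) (EuclideanSpace ℝ (Fin m)) v

open VectorField in
-- Pulled back by the chart, both fields are constant near the base point.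
theorem mlieBracket_coordExt {x : X} (v w : TangentSpace (𝓡 m) x) :
    mlieBracket (𝓡 m) (coordExt v) (coordExt w) x = 0 := by
  have key : ∀ u : TangentSpace (𝓡 m) x,
      mpullbackWithin 𝓘(ℝ, EuclideanSpace ℝ (Fin m)) (𝓡 m) (extChartAt (𝓡 m) x).symm (coordExt u)
        (range (𝓡 m)) =ᶠ[𝓝[range (𝓡 m)] (extChartAt (𝓡 m) x x)] fun _ ↦ u := by
    intro u
    filter_upwards [extChartAt_target_mem_nhdsWithin (I := 𝓡 m) x] with z hz
    have hz' := (extChartAt (𝓡 m) x).map_target hz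
    rw [extChartAt_source] at hz'
    have h2 := (extChartAt (𝓡 m) x).right_inv hz
    have h1 := TangentBundle.symmL_trivializationAt (I := 𝓡 m) hz'
    rw [h2] at h1
    rw [mpullbackWithin_apply, coordExt_eq_symmL _ hz']
    erw [h1]
    exact (isInvertible_mfderivWithin_extChartAt_symm hz).inverse_apply_eq.2 rfl
  rw [← mlieBracketWithin_univ, mlieBracketWithin_apply]
  rw [preimage_univ, univ_inter]
  rw [Filter.EventuallyEq.lieBracketWithin_vectorField_eq_of_mem (key v) (key w) (by simp)]
  have hc : ∀ (a b : EuclideanSpace ℝ (Fin m)) (s : Set (EuclideanSpace ℝ (Fin m))) z,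
      lieBracketWithin ℝ (fun _ ↦ a) (fun _ ↦ b) s z = 0 := by
    intro a b s z
    simp [lieBracketWithin]
  exact (congrArg _ (hc _ _ _ _)).trans (map_zero _)

/-- Since coordinate fields commute, zero torsion is the symmetry of the Christoffel symbols. -/
theorem torsion_free_coordExt {D : Connection m X} (hD : D.torsion = 0) {x : X}
    (v w : TangentSpace (𝓡 m) x) : D (coordExt w) x v = D (coordExt v) x w := by
  have h := (D.torsion_eq_zero_iff.1 hD) (mdifferentiableAt_coordExt v)
    (mdifferentiableAt_coordExt w)
  rw [mlieBracket_coordExt, coordExt_self, coordExt_self] at h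
  exact sub_eq_zero.1 h

end CoordinateFrames

/-! ### Calculus of directional derivatives -/

section DirDeriv

variable {a : ℕ} {M : Type*} [TopologicalSpace M] [ChartedSpace (EuclideanSpace ℝ (Fin a)) M]
  {F : Type*} [NormedAddCommGroup F] [NormedSpace ℝ F] {p : M} {v : TangentSpace (𝓡 a) p}

/-- `g` is differentiable at `p`, with derivative `d` in the direction `v`. -/
structure HasDirDeriv (g : M → F) (p : M) (v : TangentSpace (𝓡 a) p) (d : F) : Prop where
  mdiff : MDifferentiableAt (𝓡 a) 𝓘(ℝ, F) g p
  eq : mvfderiv (𝓡 a) g p v = d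

namespace HasDirDeriv

theorem of_mdiff {g : M → F} (h : MDifferentiableAt (𝓡 a) 𝓘(ℝ, F) g p) :
    HasDirDeriv g p v (mvfderiv (𝓡 a) g p v) := ⟨h, rfl⟩

theorem const (c : F) : HasDirDeriv (fun _ ↦ c) p v 0 :=
  ⟨mdifferentiableAt_const, by rw [mvfderiv_const]; rfl⟩

theorem congr {g g' : M → F} {d : F} (h : HasDirDeriv g p v d) (he : g' =ᶠ[𝓝 p] g) :
    HasDirDeriv g' p v d := by
  refine ⟨h.mdiff.congr_of_eventuallyEq he, ?_⟩
  rw [← h.eq, mvfderiv, mvfderiv, he.mfderiv_eq, he.self_of_nhds]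

theorem add {g g' : M → F} {d d' : F} (h : HasDirDeriv g p v d) (h' : HasDirDeriv g' p v d') :
    HasDirDeriv (fun q ↦ g q + g' q) p v (d + d') :=
  ⟨h.mdiff.add h'.mdiff, by rw [mvfderiv_fun_add h.mdiff h'.mdiff, ← h.eq, ← h'.eq]; rfl⟩

theorem neg {g : M → F} {d : F} (h : HasDirDeriv g p v d) :
    HasDirDeriv (fun q ↦ -g q) p v (-d) :=
  ⟨h.mdiff.neg, by rw [mvfderiv_fun_neg, ← h.eq]; rfl⟩

theorem sub {g g' : M → F} {d d' : F} (h : HasDirDeriv g p v d) (h' : HasDirDeriv g' p v d') :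
    HasDirDeriv (fun q ↦ g q - g' q) p v (d - d') :=
  ⟨h.mdiff.sub h'.mdiff, by rw [mvfderiv_fun_sub h.mdiff h'.mdiff, ← h.eq, ← h'.eq]; rfl⟩

theorem mul {g g' : M → ℝ} {d d' : ℝ} (h : HasDirDeriv g p v d) (h' : HasDirDeriv g' p v d') :
    HasDirDeriv (fun q ↦ g q * g' q) p v (d * g' p + g p * d') :=
  ⟨h.mdiff.mul h'.mdiff, by
    rw [mvfderiv_fun_mul h.mdiff h'.mdiff, ← h.eq, ← h'.eq, add_comm, mul_comm _ (g' p)]; rfl⟩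

theorem smul {g : M → ℝ} {g' : M → F} {d : ℝ} {d' : F} (h : HasDirDeriv g p v d)
    (h' : HasDirDeriv g' p v d') :
    HasDirDeriv (fun q ↦ g q • g' q) p v (g p • d' + d • g' p) :=
  ⟨h.mdiff.smul h'.mdiff, by rw [mvfderiv_fun_smul h.mdiff h'.mdiff, ← h.eq, ← h'.eq]; rfl⟩

theorem sum {ι : Type*} (t : Finset ι) {g : ι → M → F} {d : ι → F}
    (h : ∀ i ∈ t, HasDirDeriv (g i) p v (d i)) :
    HasDirDeriv (fun q ↦ ∑ i ∈ t, g i q) p v (∑ i ∈ t, d i) := by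
  classical
  induction t using Finset.induction_on with
  | empty => simpa using const (0 : F)
  | insert i t hi ih =>
    simp only [Finset.sum_insert hi]
    exact (h i (Finset.mem_insert_self i t)).add
      (ih fun j hj ↦ h j (Finset.mem_insert_of_mem hj))

theorem comp_of_hasDerivAt {g : M → ℝ} {d : ℝ} (h : HasDirDeriv g p v d) {r : ℝ → ℝ} {r' : ℝ}
    (hr : HasDerivAt r r' (g p)) : HasDirDeriv (fun q ↦ r (g q)) p v (r' * d) := by
  have h1 := hr.hasFDerivAt.hasMFDerivAt
  have h2 := h1.comp p h.mdiff.hasMFDerivAt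
  refine ⟨h2.mdifferentiableAt, ?_⟩
  rw [mvfderiv, show (fun q ↦ r (g q)) = r ∘ g from rfl, h2.mfderiv, ← h.eq, mul_comm]
  rfl

theorem clm {G : Type*} [NormedAddCommGroup G] [NormedSpace ℝ G] {g : M → F} {d : F}
    (h : HasDirDeriv g p v d) (L : F →L[ℝ] G) : HasDirDeriv (fun q ↦ L (g q)) p v (L d) := by
  have h1 := (L.hasFDerivAt (x := g p)).hasMFDerivAt
  have h2 := h1.comp p h.mdiff.hasMFDerivAt
  refine ⟨h2.mdifferentiableAt, ?_⟩
  rw [mvfderiv, show (fun q ↦ L (g q)) = L ∘ g from rfl, h2.mfderiv, ← h.eq]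
  rfl

end HasDirDeriv

end DirDeriv

/-! ### Vector fields along a map, in coordinates -/

section AlongMap

variable {a b : ℕ} {M : Type*} [TopologicalSpace M] [ChartedSpace (EuclideanSpace ℝ (Fin a)) M]
  {N : Type*} [TopologicalSpace N] [ChartedSpace (EuclideanSpace ℝ (Fin b)) N]
  [IsManifold (𝓡 b) ∞ N] {f : M → N} {p : M}

/-- The components of a vector field along `f` in the coordinate frame at `f p`. -/
noncomputable def alongCoord (f : M → N) (s : ∀ q, TangentSpace (𝓡 b) (f q)) (p q : M) :
    EuclideanSpace ℝ (Fin b) :=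
  (trivializationAt (EuclideanSpace ℝ (Fin b)) (fun x : N ↦ TangentSpace (𝓡 b) x) (f p)
    ⟨f q, s q⟩).2

/-- Differentiability at a point of a vector field along `f`. -/
def MDiffAlong (f : M → N) (s : ∀ q, TangentSpace (𝓡 b) (f q)) (p : M) : Prop :=
  MDifferentiableAt (𝓡 a) (𝓡 b).tangent (fun q ↦ (⟨f q, s q⟩ : TangentBundle (𝓡 b) N)) p

theorem mdiffAlong_iff {s : ∀ q, TangentSpace (𝓡 b) (f q)} : MDiffAlong (a := a) f s p ↔
    MDifferentiableAt (𝓡 a) (𝓡 b) f p ∧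
      MDifferentiableAt (𝓡 a) 𝓘(ℝ, EuclideanSpace ℝ (Fin b)) (alongCoord f s p) p :=
  mdifferentiableAt_totalSpace _ _

omit [TopologicalSpace M] in
theorem alongCoord_self (s : ∀ q, TangentSpace (𝓡 b) (f q)) : alongCoord f s p p = s p :=
  trivializationAt_self_apply (s p)

omit [TopologicalSpace M] in
theorem alongCoord_eq (s : ∀ q, TangentSpace (𝓡 b) (f q)) {q : M}
    (hq : f q ∈ (chartAt (EuclideanSpace ℝ (Fin b)) (f p)).source) :
    alongCoord f s p q = (trivializationAt (EuclideanSpace ℝ (Fin b))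
      (fun x : N ↦ TangentSpace (𝓡 b) x) (f p)).continuousLinearMapAt ℝ (f q) (s q) :=
  (Trivialization.continuousLinearMapAt_apply_of_mem (R := ℝ) (hb := hq) ..).symm

omit [TopologicalSpace M] in
theorem eq_coordExt_alongCoord (s : ∀ q, TangentSpace (𝓡 b) (f q)) {q : M}
    (hq : f q ∈ (chartAt (EuclideanSpace ℝ (Fin b)) (f p)).source) :
    s q = coordExt (x := f p) (alongCoord f s p q) (f q) := by
  have := (trivializationAt (EuclideanSpace ℝ (Fin b))
    (fun x : N ↦ TangentSpace (𝓡 b) x) (f p)).symmL_continuousLinearMapAt (R := ℝ) hq (s q)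
  rw [← alongCoord_eq s hq] at this
  exact this.symm.trans (coordExt_eq_symmL (x := f p) _ hq).symm

/-- The derivative of the components of a vector field along `f` in the coordinate frame at `f p`,
as a tangent vector at `f p`. -/
noncomputable def alongCoordDeriv (f : M → N) (s : ∀ q, TangentSpace (𝓡 b) (f q)) (p : M)
    (v : TangentSpace (𝓡 a) p) : TangentSpace (𝓡 b) (f p) :=
  mvfderiv (𝓡 a) (alongCoord f s p) p v

/-- The product rule for a linear form along `f` evaluated on a vector field along `f`. -/
theorem HasDirDeriv.apply_along {Λ : ∀ q, TangentSpace (𝓡 b) (f q) →ₗ[ℝ] ℝ}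
    {s : ∀ q, TangentSpace (𝓡 b) (f q)} {v : TangentSpace (𝓡 a) p} {d : ℝ}
    (hs : MDiffAlong (a := a) f s p)
    (hΛ : ∀ w : TangentSpace (𝓡 b) (f p),
      MDifferentiableAt (𝓡 a) 𝓘(ℝ, ℝ) (fun q ↦ Λ q (coordExt w (f q))) p)
    (hd : HasDirDeriv (fun q ↦ Λ q (coordExt (s p) (f q))) p v d) :
    HasDirDeriv (fun q ↦ Λ q (s q)) p v
      (d + Λ p (alongCoordDeriv f s p v)) := by
  obtain ⟨hf, hc⟩ := mdiffAlong_iff.1 hs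
  set c' : EuclideanSpace ℝ (Fin b) := mvfderiv (𝓡 a) (alongCoord f s p) p v
  have hci : ∀ i, HasDirDeriv (fun q ↦ alongCoord f s p q i) p v (c' i) := fun i ↦
    (HasDirDeriv.of_mdiff hc).clm (EuclideanSpace.proj i)
  have hev : ∀ᶠ q in 𝓝 p, f q ∈ (chartAt (EuclideanSpace ℝ (Fin b)) (f p)).source :=
    hf.continuousAt.eventually_mem ((chartAt _ (f p)).open_source.mem_nhds (mem_chart_source _ _))
  have hE : ∀ (q : M) (w : EuclideanSpace ℝ (Fin b)),
      f q ∈ (chartAt (EuclideanSpace ℝ (Fin b)) (f p)).source →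
      Λ q (coordExt (x := f p) w (f q))
        = ∑ i, w i * Λ q (coordExt (x := f p) (EuclideanSpace.single i (1 : ℝ)) (f q)) := by
    intro q w hq
    rw [coordExt_eq_sum (x := f p) w hq, map_sum]
    simp
  have h1 := HasDirDeriv.sum Finset.univ fun i (_ : i ∈ Finset.univ) ↦
    (hci i).mul (HasDirDeriv.of_mdiff (v := v) (hΛ (EuclideanSpace.single i (1 : ℝ))))
  -- The same sum with the components of `s` frozen at `p`: its derivative is `d`. The difference
  -- from `h1` is the derivative of the components alone.
  have h2 := HasDirDeriv.sum Finset.univ fun i (_ : i ∈ Finset.univ) ↦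
    (HasDirDeriv.const (p := p) (v := v) (alongCoord f s p p i)).mul
      (HasDirDeriv.of_mdiff (v := v) (hΛ (EuclideanSpace.single i (1 : ℝ))))
  have h3 := h2.congr (g' := fun q ↦ Λ q (coordExt (s p) (f q))) (by
    filter_upwards [hev] with q hq
    exact (hE q (s p) hq).trans (by rw [alongCoord_self]))
  have hd' := hd.eq.symm.trans h3.eq
  have h4 := h1.congr (g' := fun q ↦ Λ q (s q)) (by
    filter_upwards [hev] with q hq
    rw [← hE q _ hq, ← eq_coordExt_alongCoord s hq])
  refine ⟨h4.mdiff, h4.eq.trans ?_⟩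
  have h5 := (congrArg (Λ p) (coordExt_self (x := f p) c')).symm.trans
    (hE p c' (mem_chart_source _ _))
  refine Eq.trans ?_ (congrArg (d + ·) h5.symm)
  dsimp only
  rw [hd', ← Finset.sum_add_distrib]
  refine Finset.sum_congr rfl fun i _ ↦ ?_
  ring

end AlongMap

/-! ### Covariant differentiation along a map -/

section AlongDeriv

variable {a b : ℕ} {M : Type*} [TopologicalSpace M] [ChartedSpace (EuclideanSpace ℝ (Fin a)) M]
  {N : Type*} [TopologicalSpace N] [ChartedSpace (EuclideanSpace ℝ (Fin b)) N]
  [IsManifold (𝓡 b) ∞ N] {f : M → N} {p : M} {v : TangentSpace (𝓡 a) p}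

/-- The covariant derivative of a vector field along `f`. -/
noncomputable def alongDeriv (D : Connection b N) (f : M → N)
    (s : ∀ q, TangentSpace (𝓡 b) (f q)) (p : M) (v : TangentSpace (𝓡 a) p) :
    TangentSpace (𝓡 b) (f p) :=
  alongCoordDeriv f s p v + D (coordExt (s p)) (f p) (mfderiv (𝓡 a) (𝓡 b) f p v)

omit [IsManifold (𝓡 b) ∞ N] in
theorem HasDirDeriv.comp_map {g : N → ℝ} (hf : MDifferentiableAt (𝓡 a) (𝓡 b) f p)
    (hg : MDifferentiableAt (𝓡 b) 𝓘(ℝ, ℝ) g (f p)) :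
    HasDirDeriv (fun q ↦ g (f q)) p v (mvfderiv (𝓡 b) g (f p) (mfderiv (𝓡 a) (𝓡 b) f p v)) :=
  ⟨hg.comp p hf, mvfderiv_comp_apply p hg hf v⟩

/-- The product rule for a bilinear form evaluated on vector fields along `f`. -/
theorem HasDirDeriv.bilin_along (D : Connection b N)
    {β : ∀ x : N, TangentSpace (𝓡 b) x →ₗ[ℝ] TangentSpace (𝓡 b) x →ₗ[ℝ] ℝ}
    {s₁ s₂ : ∀ q, TangentSpace (𝓡 b) (f q)}
    (hβ : ∀ y z : TangentSpace (𝓡 b) (f p),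
      MDifferentiableAt (𝓡 b) 𝓘(ℝ, ℝ) (fun x ↦ β x (coordExt y x) (coordExt z x)) (f p))
    (h₁ : MDiffAlong (a := a) f s₁ p) (h₂ : MDiffAlong (a := a) f s₂ p) :
    HasDirDeriv (fun q ↦ β (f q) (s₁ q) (s₂ q)) p v
      (mvfderiv (𝓡 b) (fun x ↦ β x (coordExt (s₁ p) x) (coordExt (s₂ p) x)) (f p)
          (mfderiv (𝓡 a) (𝓡 b) f p v)
        - β (f p) (D (coordExt (s₁ p)) (f p) (mfderiv (𝓡 a) (𝓡 b) f p v)) (s₂ p)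
        - β (f p) (s₁ p) (D (coordExt (s₂ p)) (f p) (mfderiv (𝓡 a) (𝓡 b) f p v))
        + β (f p) (alongDeriv D f s₁ p v) (s₂ p) + β (f p) (s₁ p) (alongDeriv D f s₂ p v)) := by
  have hf := (mdiffAlong_iff.1 h₁).1
  -- The arguments are released from their coordinate extensions one at a time, the last one first.
  -- Each release adds the coordinate derivative of that field, and the connection terms of
  -- `alongDeriv` cancel against those subtracted in the statement.
  have e2 : ∀ y, HasDirDeriv (fun q ↦ β (f q) (coordExt y (f q)) (s₂ q)) p v _ := fun y ↦
    HasDirDeriv.apply_along (Λ := fun q ↦ β (f q) (coordExt y (f q))) h₂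
      (fun w ↦ (HasDirDeriv.comp_map (v := v) hf (hβ y w)).mdiff)
      (HasDirDeriv.comp_map hf (hβ y (s₂ p)))
  have e1 := HasDirDeriv.apply_along (Λ := fun q ↦ (β (f q)).flip (s₂ q)) h₁
      (fun w ↦ (e2 w).mdiff) (e2 (s₁ p))
  refine ⟨e1.mdiff, e1.eq.trans ?_⟩
  simp only [alongDeriv, coordExt_self, map_add, LinearMap.add_apply, LinearMap.flip_apply]
  ring

/-- The product rule for a trilinear form evaluated on vector fields along `f`. -/
theorem HasDirDeriv.trilin_along (D : Connection b N)
    {β : ∀ x : N, TangentSpace (𝓡 b) x →ₗ[ℝ] TangentSpace (𝓡 b) x →ₗ[ℝ]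
      TangentSpace (𝓡 b) x →ₗ[ℝ] ℝ}
    {s₁ s₂ s₃ : ∀ q, TangentSpace (𝓡 b) (f q)}
    (hβ : ∀ y z u : TangentSpace (𝓡 b) (f p), MDifferentiableAt (𝓡 b) 𝓘(ℝ, ℝ)
      (fun x ↦ β x (coordExt y x) (coordExt z x) (coordExt u x)) (f p))
    (h₁ : MDiffAlong (a := a) f s₁ p) (h₂ : MDiffAlong (a := a) f s₂ p)
    (h₃ : MDiffAlong (a := a) f s₃ p) :
    HasDirDeriv (fun q ↦ β (f q) (s₁ q) (s₂ q) (s₃ q)) p v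
      (mvfderiv (𝓡 b) (fun x ↦ β x (coordExt (s₁ p) x) (coordExt (s₂ p) x) (coordExt (s₃ p) x))
          (f p) (mfderiv (𝓡 a) (𝓡 b) f p v)
        - β (f p) (D (coordExt (s₁ p)) (f p) (mfderiv (𝓡 a) (𝓡 b) f p v)) (s₂ p) (s₃ p)
        - β (f p) (s₁ p) (D (coordExt (s₂ p)) (f p) (mfderiv (𝓡 a) (𝓡 b) f p v)) (s₃ p)
        - β (f p) (s₁ p) (s₂ p) (D (coordExt (s₃ p)) (f p) (mfderiv (𝓡 a) (𝓡 b) f p v))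
        + β (f p) (alongDeriv D f s₁ p v) (s₂ p) (s₃ p)
        + β (f p) (s₁ p) (alongDeriv D f s₂ p v) (s₃ p)
        + β (f p) (s₁ p) (s₂ p) (alongDeriv D f s₃ p v)) := by
  have hf := (mdiffAlong_iff.1 h₁).1
  have e3 : ∀ y z, HasDirDeriv
      (fun q ↦ β (f q) (coordExt y (f q)) (coordExt z (f q)) (s₃ q)) p v _ := fun y z ↦
    HasDirDeriv.apply_along (Λ := fun q ↦ β (f q) (coordExt y (f q)) (coordExt z (f q))) h₃
      (fun w ↦ (HasDirDeriv.comp_map (v := v) hf (hβ y z w)).mdiff)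
      (HasDirDeriv.comp_map hf (hβ y z (s₃ p)))
  have e2 : ∀ y, HasDirDeriv (fun q ↦ β (f q) (coordExt y (f q)) (s₂ q) (s₃ q)) p v _ := fun y ↦
    HasDirDeriv.apply_along (Λ := fun q ↦ (β (f q) (coordExt y (f q))).flip (s₃ q)) h₂
      (fun w ↦ (e3 y w).mdiff) (e3 y (s₂ p))
  have e1 := HasDirDeriv.apply_along
      (Λ := fun q ↦ ((β (f q)).flip (s₂ q)).flip (s₃ q)) h₁
      (fun w ↦ (e2 w).mdiff) (e2 (s₁ p))
  refine ⟨e1.mdiff, e1.eq.trans ?_⟩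
  simp only [alongDeriv, coordExt_self, map_add, LinearMap.add_apply, LinearMap.flip_apply]
  ring

end AlongDeriv

/-! ### Vector fields along the identity map -/

section SelfMap

variable {a : ℕ} {M : Type*} [TopologicalSpace M] [ChartedSpace (EuclideanSpace ℝ (Fin a)) M]
  [IsManifold (𝓡 a) ∞ M] {p : M}

/-- The difference between `D` and the derivative of the components is tensorial, so it may be
evaluated on the coordinate extension of Z(p), whose components are constant. -/
theorem alongDeriv_id (D : Connection a M) {Z : ∀ q : M, TangentSpace (𝓡 a) q}
    (hZ : MDifferentiableAt (𝓡 a) (𝓡 a).tangent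
      (fun q ↦ (⟨q, Z q⟩ : TangentBundle (𝓡 a) M)) p) (v : TangentSpace (𝓡 a) p) :
    alongDeriv D (fun q ↦ q) Z p v = D Z p v := by
  have hT : TensorialAt (𝓡 a) (EuclideanSpace ℝ (Fin a))
      (fun Z : ∀ q : M, TangentSpace (𝓡 a) q ↦ D Z p v - alongCoordDeriv (fun q : M ↦ q) Z p v) p := by
    have hsrc := (chartAt (EuclideanSpace ℝ (Fin a)) p).open_source.mem_nhds (mem_chart_source _ p)
    have hc : ∀ {σ : ∀ q : M, TangentSpace (𝓡 a) q}, MDifferentiableAt (𝓡 a) (𝓡 a).tangent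
        (fun q ↦ (⟨q, σ q⟩ : TangentBundle (𝓡 a) M)) p →
        HasDirDeriv (alongCoord (fun q : M ↦ q) σ p) p v _ := fun hσ ↦
      HasDirDeriv.of_mdiff (mdiffAlong_iff.1 hσ).2
    refine ⟨fun {g σ} hg hσ ↦ ?_, fun {σ σ'} hσ hσ' ↦ ?_⟩
    · have h1 := ((HasDirDeriv.of_mdiff hg).smul (hc hσ)).congr
        (g' := alongCoord (fun q : M ↦ q) (g • σ) p) (by
          filter_upwards [hsrc] with q hq
          rw [alongCoord_eq _ hq, alongCoord_eq _ hq]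
          exact ContinuousLinearMap.map_smul _ _ _)
      have h2 : alongCoordDeriv (fun q : M ↦ q) (g • σ) p v
          = g p • alongCoordDeriv (fun q : M ↦ q) σ p v + mvfderiv (𝓡 a) g p v • σ p :=
        h1.eq.trans (by rw [alongCoord_self (f := fun q : M ↦ q) σ]; rfl)
      have h3 := DFunLike.congr_fun (D.isCovariantDerivativeOn.leibniz hσ hg (mem_univ p)) v
      rw [h2, h3]
      simp only [_root_.add_apply, _root_.smul_apply,
        ContinuousLinearMap.smulRight_apply]
      module
    · have h1 := ((hc hσ).add (hc hσ')).congr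
        (g' := alongCoord (fun q : M ↦ q) (σ + σ') p) (by
          filter_upwards [hsrc] with q hq
          rw [alongCoord_eq _ hq, alongCoord_eq _ hq, alongCoord_eq _ hq]
          exact ContinuousLinearMap.map_add _ _ _)
      have h2 : alongCoordDeriv (fun q : M ↦ q) (σ + σ') p v
          = alongCoordDeriv (fun q : M ↦ q) σ p v + alongCoordDeriv (fun q : M ↦ q) σ' p v := h1.eq
      have h3 := DFunLike.congr_fun (D.isCovariantDerivativeOn.add hσ hσ' (mem_univ p)) v
      rw [h2, h3]
      simp only [_root_.add_apply]
      module
  have h := hT.pointwise hZ (mdifferentiableAt_coordExt (Z p)) (coordExt_self _).symm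
  have h2 : alongCoordDeriv (fun q : M ↦ q) (coordExt (Z p)) p v = 0 := by
    refine HasDirDeriv.eq (g := alongCoord (fun q : M ↦ q) (coordExt (Z p)) p)
      ((HasDirDeriv.const (F := EuclideanSpace ℝ (Fin a)) (Z p)).congr ?_)
    filter_upwards [(chartAt (EuclideanSpace ℝ (Fin a)) p).open_source.mem_nhds
      (mem_chart_source _ p)] with q hq
    rw [alongCoord_eq _ hq, coordExt_eq_symmL _ hq]
    exact Trivialization.continuousLinearMapAt_symmL _ hq _
  rw [h2, sub_zero, sub_eq_iff_eq_add'] at h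
  rw [alongDeriv, h, show mfderiv (𝓡 a) (𝓡 a) (fun q : M ↦ q) p = _ from mfderiv_id]
  rfl

end SelfMap

/-! ### The differential of a map and the symmetry of its Hessian -/

section Differential

variable {a b : ℕ} {M : Type*} [TopologicalSpace M] [ChartedSpace (EuclideanSpace ℝ (Fin a)) M]
  [IsManifold (𝓡 a) ∞ M]
  {N : Type*} [TopologicalSpace N] [ChartedSpace (EuclideanSpace ℝ (Fin b)) N]
  [IsManifold (𝓡 b) ∞ N] {f : M → N} {p : M}

/-- `f` read in the charts at `p` and `f p`. -/
noncomputable def chartRep (a b : ℕ) {M : Type*} [TopologicalSpace M]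
    [ChartedSpace (EuclideanSpace ℝ (Fin a)) M] {N : Type*} [TopologicalSpace N]
    [ChartedSpace (EuclideanSpace ℝ (Fin b)) N] (f : M → N) (p : M) :
    EuclideanSpace ℝ (Fin a) → EuclideanSpace ℝ (Fin b) :=
  writtenInExtChartAt (𝓡 a) (𝓡 b) p f

omit [IsManifold (𝓡 a) ∞ M] [IsManifold (𝓡 b) ∞ N] in
theorem contDiffAt_chartRep (hf : ContMDiff (𝓡 a) (𝓡 b) ∞ f) :
    ContDiffAt ℝ ∞ (chartRep a b f p) (extChartAt (𝓡 a) p p) := by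
  have h := (contMDiffAt_iff.1 (hf p)).2
  simpa [chartRep, writtenInExtChartAt, contDiffWithinAt_univ] using h

/-- The chain rule in the charts. One more derivative at p turns this into the second derivative of
the coordinate representation. -/
theorem alongCoord_mfderiv_coordExt (hf : ContMDiff (𝓡 a) (𝓡 b) ∞ f)
    (y : TangentSpace (𝓡 a) p) :
    alongCoord f (fun q ↦ mfderiv (𝓡 a) (𝓡 b) f q (coordExt y q)) p
      =ᶠ[𝓝 p] fun q ↦ fderiv ℝ (chartRep a b f p) (extChartAt (𝓡 a) p q)
        (y : EuclideanSpace ℝ (Fin a)) := by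
  have h1 := (chartAt (EuclideanSpace ℝ (Fin a)) p).open_source.mem_nhds (mem_chart_source _ p)
  have h2 := hf.continuous.continuousAt.eventually_mem (x := p)
    ((chartAt (EuclideanSpace ℝ (Fin b)) (f p)).open_source.mem_nhds (mem_chart_source _ _))
  filter_upwards [h1, h2] with q hq hfq
  have hd : MDifferentiableAt (𝓡 a) (𝓡 b) f q := (hf q).mdifferentiableAt (by simp)
  have e1 := alongCoord_eq (p := p) (fun q ↦ mfderiv (𝓡 a) (𝓡 b) f q (coordExt y q)) hfq
  rw [e1, TangentBundle.continuousLinearMapAt_trivializationAt hfq, coordExt_eq_symmL _ hq]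
  have e2 := TangentBundle.symmL_trivializationAt (I := 𝓡 a) hq
  have hz : extChartAt (𝓡 a) p q ∈ (extChartAt (𝓡 a) p).target :=
    (extChartAt (𝓡 a) p).map_source (by rwa [extChartAt_source])
  have hqq : (extChartAt (𝓡 a) p).symm (extChartAt (𝓡 a) p q) = q :=
    (extChartAt (𝓡 a) p).left_inv (by rwa [extChartAt_source])
  have k1 : HasMFDerivAt 𝓘(ℝ, EuclideanSpace ℝ (Fin a)) (𝓡 a) (extChartAt (𝓡 a) p).symm
      (extChartAt (𝓡 a) p q)
      (mfderivWithin 𝓘(ℝ, EuclideanSpace ℝ (Fin a)) (𝓡 a) (extChartAt (𝓡 a) p).symm (range (𝓡 a))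
        (extChartAt (𝓡 a) p q)) := by
    have := (mdifferentiableWithinAt_extChartAt_symm hz).hasMFDerivWithinAt
    simpa using this
  have k2 : HasMFDerivAt (𝓡 a) (𝓡 b) f ((extChartAt (𝓡 a) p).symm (extChartAt (𝓡 a) p q))
      (mfderiv (𝓡 a) (𝓡 b) f q) := by
    rw [hqq]; exact hd.hasMFDerivAt
  have k3 : HasMFDerivAt (𝓡 b) 𝓘(ℝ, EuclideanSpace ℝ (Fin b)) (extChartAt (𝓡 b) (f p))
      (f ((extChartAt (𝓡 a) p).symm (extChartAt (𝓡 a) p q)))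
      (mfderiv (𝓡 b) 𝓘(ℝ, EuclideanSpace ℝ (Fin b)) (extChartAt (𝓡 b) (f p)) (f q)) := by
    rw [hqq]; exact (mdifferentiableAt_extChartAt hfq).hasMFDerivAt
  have k4 := k3.comp (extChartAt (𝓡 a) p q) (k2.comp (extChartAt (𝓡 a) p q) k1)
  have k5 := mfderiv_eq_fderiv.symm.trans k4.mfderiv
  refine Eq.trans ?_ (congrArg (fun T : EuclideanSpace ℝ (Fin a) →L[ℝ] EuclideanSpace ℝ (Fin b) ↦
    T y) k5.symm)
  rw [e2]
  rfl

theorem mdiffAlong_mfderiv_coordExt (hf : ContMDiff (𝓡 a) (𝓡 b) ∞ f)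
    (y : TangentSpace (𝓡 a) p) :
    MDiffAlong (a := a) f (fun q ↦ mfderiv (𝓡 a) (𝓡 b) f q (coordExt y q)) p ∧
      ∀ x, alongCoordDeriv f (fun q ↦ mfderiv (𝓡 a) (𝓡 b) f q (coordExt y q)) p x
        = (fderiv ℝ (fderiv ℝ (chartRep a b f p)) (extChartAt (𝓡 a) p p)
          (x : EuclideanSpace ℝ (Fin a)) (y : EuclideanSpace ℝ (Fin a))) := by
  have hg := contDiffAt_chartRep (p := p) hf
  have h2 : DifferentiableAt ℝ (fderiv ℝ (chartRep a b f p)) (extChartAt (𝓡 a) p p) :=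
    (hg.fderiv_right (m := 1) (by norm_cast)).differentiableAt (by simp)
  have h3 : ∀ w : EuclideanSpace ℝ (Fin a), HasFDerivAt (fun z ↦ fderiv ℝ (chartRep a b f p) z w)
      ((fderiv ℝ (fderiv ℝ (chartRep a b f p)) (extChartAt (𝓡 a) p p)).flip w)
      (extChartAt (𝓡 a) p p) := fun w ↦ by
    simpa using h2.hasFDerivAt.clm_apply (hasFDerivAt_const w _)
  have h4 := (mdifferentiableAt_extChartAt (I := 𝓡 a) (mem_chart_source _ p)).hasMFDerivAt
  have h5 := (h3 y).hasMFDerivAt.comp p h4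
  have h6 : HasMFDerivAt (𝓡 a) 𝓘(ℝ, EuclideanSpace ℝ (Fin b)) _ p _ :=
    h5.congr_of_eventuallyEq (alongCoord_mfderiv_coordExt hf y)
  refine ⟨mdiffAlong_iff.2 ⟨(hf p).mdifferentiableAt (by simp), h6.mdifferentiableAt⟩, fun x ↦ ?_⟩
  rw [alongCoordDeriv, mvfderiv, h6.mfderiv, mfderiv_extChartAt_self]
  rfl

/-- The coordinate part is a second derivative, hence symmetric, and the connection part is
symmetric because `D` is torsion-free. The symmetry of the second fundamental form rests on this. -/
theorem alongDeriv_mfderiv_comm (hf : ContMDiff (𝓡 a) (𝓡 b) ∞ f) {D : Connection b N}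
    (hD : D.torsion = 0) (x y : TangentSpace (𝓡 a) p) :
    alongDeriv D f (fun q ↦ mfderiv (𝓡 a) (𝓡 b) f q (coordExt y q)) p x
      = alongDeriv D f (fun q ↦ mfderiv (𝓡 a) (𝓡 b) f q (coordExt x q)) p y := by
  have hs : IsSymmSndFDerivAt ℝ (chartRep a b f p) (extChartAt (𝓡 a) p p) :=
    (contDiffAt_chartRep (p := p) hf).isSymmSndFDerivAt (by
      rw [minSmoothness_of_isRCLikeNormedField]; exact ENat.LEInfty.out)
  rw [alongDeriv, alongDeriv, (mdiffAlong_mfderiv_coordExt hf y).2,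
    (mdiffAlong_mfderiv_coordExt hf x).2, coordExt_self, coordExt_self,
    torsion_free_coordExt hD (mfderiv (𝓡 a) (𝓡 b) f p x)]
  exact congrArg (· + _) (hs x y)

end Differential

/-! ### Metric compatibility along a map -/

section Metric

open scoped InnerProductSpace

variable {a b : ℕ} {M : Type*} [TopologicalSpace M] [ChartedSpace (EuclideanSpace ℝ (Fin a)) M]
  {N : Type*} [TopologicalSpace N] [ChartedSpace (EuclideanSpace ℝ (Fin b)) N]
  [IsManifold (𝓡 b) ∞ N] [RiemannianBundle (fun x : N ↦ TangentSpace (𝓡 b) x)]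
  [IsContMDiffRiemannianBundle (𝓡 b) ∞ (EuclideanSpace ℝ (Fin b))
      (fun x : N ↦ TangentSpace (𝓡 b) x)]
  {D : Connection b N} {f : M → N} {p : M}

theorem mdifferentiableAt_inner {x : N} {Y Z : ∀ x : N, TangentSpace (𝓡 b) x}
    (hY : MDifferentiableAt (𝓡 b) (𝓡 b).tangent
      (fun y ↦ (⟨y, Y y⟩ : TangentBundle (𝓡 b) N)) x)
    (hZ : MDifferentiableAt (𝓡 b) (𝓡 b).tangent
      (fun y ↦ (⟨y, Z y⟩ : TangentBundle (𝓡 b) N)) x) :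
    MDifferentiableAt (𝓡 b) 𝓘(ℝ, ℝ) (fun y ↦ ⟪Y y, Z y⟫_ℝ) x := by
  have : IsContMDiffRiemannianBundle (𝓡 b) 1 (EuclideanSpace ℝ (Fin b))
    (fun x : N ↦ TangentSpace (𝓡 b) x) := IsContMDiffRiemannianBundle.of_le (n := ∞) (by simp)
  exact MDifferentiableAt.inner_bundle hY hZ

theorem G2Hyp.IsLeviCivita.hasDirDeriv_inner (hD : IsLeviCivita D) {x : N}
    {Y Z : ∀ x : N, TangentSpace (𝓡 b) x}
    (hY : MDifferentiableAt (𝓡 b) (𝓡 b).tangent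
      (fun y ↦ (⟨y, Y y⟩ : TangentBundle (𝓡 b) N)) x)
    (hZ : MDifferentiableAt (𝓡 b) (𝓡 b).tangent
      (fun y ↦ (⟨y, Z y⟩ : TangentBundle (𝓡 b) N)) x) (v : TangentSpace (𝓡 b) x) :
    HasDirDeriv (fun y ↦ ⟪Y y, Z y⟫_ℝ) x v (⟪D Y x v, Z x⟫_ℝ + ⟪Y x, D Z x v⟫_ℝ) := by
  refine ⟨mdifferentiableAt_inner hY hZ, ?_⟩
  have : IsContMDiffRiemannianBundle (𝓡 b) 1 (EuclideanSpace ℝ (Fin b))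
    (fun x : N ↦ TangentSpace (𝓡 b) x) := IsContMDiffRiemannianBundle.of_le (n := ∞) (by simp)
  have h := hD.2.mvfderiv_inner_eq (coordExt v) hY hZ
  dsimp only at h
  rwa [coordExt_self] at h

/-- The product rule for the metric evaluated on vector fields along `f`. -/
theorem G2Hyp.IsLeviCivita.hasDirDeriv_inner_along (hD : IsLeviCivita D)
    {s₁ s₂ : ∀ q, TangentSpace (𝓡 b) (f q)} (h₁ : MDiffAlong (a := a) f s₁ p)
    (h₂ : MDiffAlong (a := a) f s₂ p) (v : TangentSpace (𝓡 a) p) :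
    HasDirDeriv (fun q ↦ ⟪s₁ q, s₂ q⟫_ℝ) p v
      (⟪alongDeriv D f s₁ p v, s₂ p⟫_ℝ + ⟪s₁ p, alongDeriv D f s₂ p v⟫_ℝ) := by
  have h := HasDirDeriv.bilin_along (v := v) D
    (β := fun x ↦ innerₗ (TangentSpace (𝓡 b) x)) (fun y z ↦
    mdifferentiableAt_inner (mdifferentiableAt_coordExt y) (mdifferentiableAt_coordExt z)) h₁ h₂
  have h2 := (hD.hasDirDeriv_inner (mdifferentiableAt_coordExt (s₁ p))
    (mdifferentiableAt_coordExt (s₂ p)) (mfderiv (𝓡 a) (𝓡 b) f p v)).eq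
  simp only [coordExt_self] at h2
  refine ⟨h.mdiff, h.eq.trans ?_⟩
  simp only [innerₗ_apply_apply]
  rw [h2]
  ring

end Metric

/-! ### Second fundamental form and the Gauss and Weingarten formulas -/

noncomputable section HypersurfaceGeometry

open scoped InnerProductSpace

variable {N : Type*} [TopologicalSpace N] [ChartedSpace (EuclideanSpace ℝ (Fin 7)) N]
  [IsManifold (𝓡 7) ∞ N] [RiemannianBundle (fun x : N ↦ TangentSpace (𝓡 7) x)]
  {M : Type*} [TopologicalSpace M] [ChartedSpace (EuclideanSpace ℝ (Fin 6)) M]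
  [IsManifold (𝓡 6) ∞ M] [RiemannianBundle (fun p : M ↦ TangentSpace (𝓡 6) p)]

namespace G2Hyp.Hypersurface

variable (S : Hypersurface N M) (DN : Connection 7 N) (p : M)

omit [IsManifold (𝓡 6) ∞ M] in
theorem derivAlong_eq (s : ∀ p : M, TangentSpace (𝓡 7) (S.ι p)) (v : TangentSpace (𝓡 6) p) :
    S.derivAlong DN s p v = alongDeriv DN S.ι s p v :=
  congrArg (· + _) (trivializationAt_symm_self _ _)

omit [IsManifold (𝓡 6) ∞ M] in
theorem mdiffAlong_n : MDiffAlong (a := 6) S.ι S.n p :=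
  (S.smooth_n p).mdifferentiableAt (by simp)

/-- The vector field along `ι` given by the coordinate extension of a tangent vector. -/
def pushExt {p : M} (y : TangentSpace (𝓡 6) p) (q : M) : TangentSpace (𝓡 7) (S.ι q) :=
  S.dι q (coordExt y q)

theorem mdiffAlong_pushExt {p : M} (y : TangentSpace (𝓡 6) p) :
    MDiffAlong (a := 6) S.ι (S.pushExt y) p :=
  (mdiffAlong_mfderiv_coordExt S.smooth y).1

@[simp] theorem pushExt_self {p : M} (y : TangentSpace (𝓡 6) p) : S.pushExt y p = S.dι p y := by
  rw [pushExt, coordExt_self]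

omit [IsManifold (𝓡 6) ∞ M] in
theorem isHyperplane : IsHyperplane (S.dι p) (S.n p) where
  isometry := S.isometric p
  norm_n := by rw [real_inner_self_eq_norm_sq, S.norm_n]; norm_num
  inner_n := S.inner_n p
  finrank_W := finrank_euclideanSpace_fin
  finrank_V := finrank_euclideanSpace_fin

theorem B_eq (x y : TangentSpace (𝓡 6) p) :
    S.B DN p x y = ⟪alongDeriv DN S.ι (S.pushExt y) p x, S.n p⟫_ℝ := by
  rw [B, derivAlong_eq]; rfl

variable {DN}
  [IsContMDiffRiemannianBundle (𝓡 7) ∞ (EuclideanSpace ℝ (Fin 7))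
      (fun x : N ↦ TangentSpace (𝓡 7) x)]
  (hDN : IsLeviCivita DN)

include hDN in
theorem alongDeriv_pushExt_comm (x y : TangentSpace (𝓡 6) p) :
    alongDeriv DN S.ι (S.pushExt y) p x = alongDeriv DN S.ι (S.pushExt x) p y :=
  alongDeriv_mfderiv_comm S.smooth hDN.1 x y

include hDN in
theorem B_comm (x y : TangentSpace (𝓡 6) p) : S.B DN p x y = S.B DN p y x := by
  rw [B_eq, B_eq, S.alongDeriv_pushExt_comm p hDN]

/-- The Weingarten map `x ↦ -∇_x n`. -/
def weingarten (DN : Connection 7 N) (p : M) :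
    TangentSpace (𝓡 6) p →ₗ[ℝ] TangentSpace (𝓡 6) p where
  toFun v := -LinearMap.adjoint (S.dι p) (alongDeriv DN S.ι S.n p v)
  map_add' v w := by
    have : alongDeriv DN S.ι S.n p (v + w)
        = alongDeriv DN S.ι S.n p v + alongDeriv DN S.ι S.n p w := by
      simp only [alongDeriv, alongCoordDeriv, map_add]
      abel
    rw [this, map_add, neg_add]
  map_smul' c v := by
    have : alongDeriv DN S.ι S.n p (c • v) = c • alongDeriv DN S.ι S.n p v := by
      simp only [alongDeriv, alongCoordDeriv, map_smul]
      exact (smul_add c (alongCoordDeriv S.ι S.n p v) _).symm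
    rw [this, map_smul, smul_neg, RingHom.id_apply]

omit [IsManifold (𝓡 6) ∞ M] in
include hDN in
theorem inner_alongDeriv_n (v : TangentSpace (𝓡 6) p) :
    ⟪alongDeriv DN S.ι S.n p v, S.n p⟫_ℝ = 0 := by
  have e1 := (hDN.hasDirDeriv_inner_along (S.mdiffAlong_n p) (S.mdiffAlong_n p) v).eq
  have e2 : (fun q ↦ ⟪S.n q, S.n q⟫_ℝ) = fun _ ↦ 1 := by
    funext q; exact (S.isHyperplane q).norm_n
  rw [e2, (HasDirDeriv.const (1 : ℝ)).eq, real_inner_comm] at e1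
  rw [real_inner_comm]
  linarith

omit [IsManifold (𝓡 6) ∞ M] in
include hDN in
theorem alongDeriv_n (v : TangentSpace (𝓡 6) p) :
    alongDeriv DN S.ι S.n p v = -S.dι p (S.weingarten DN p v) := by
  have H := S.isHyperplane p
  rw [H.decomp (alongDeriv DN S.ι S.n p v), real_inner_comm, S.inner_alongDeriv_n p hDN]
  simp [weingarten]

-- Differentiate the identity ⟪n, dι Y⟫ = 0.
include hDN in
theorem inner_weingarten (x y : TangentSpace (𝓡 6) p) :
    ⟪S.weingarten DN p x, y⟫_ℝ = S.B DN p x y := by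
  have e1 := (hDN.hasDirDeriv_inner_along (S.mdiffAlong_n p) (S.mdiffAlong_pushExt y) x).eq
  have e2 : (fun q ↦ ⟪S.n q, S.pushExt y q⟫_ℝ) = fun _ ↦ 0 := by
    funext q; exact S.inner_n q _
  rw [e2, (HasDirDeriv.const (0 : ℝ)).eq, S.alongDeriv_n p hDN, pushExt_self, inner_neg_left,
    (S.isHyperplane p).isometry, real_inner_comm _ (S.n p), ← B_eq] at e1
  linarith

variable [IsContMDiffRiemannianBundle (𝓡 6) ∞ (EuclideanSpace ℝ (Fin 6))
      (fun p : M ↦ TangentSpace (𝓡 6) p)]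
  {DM : Connection 6 M} (hDM : IsLeviCivita DM)

-- The uniqueness argument for the Levi-Civita connection. The difference of the two sides is
-- symmetric in x, y since both connections are torsion-free and skew in y, z since both are metric,
-- and such an expression is zero.
include hDN hDM in
theorem inner_alongDeriv_pushExt (x y z : TangentSpace (𝓡 6) p) :
    ⟪alongDeriv DN S.ι (S.pushExt y) p x, S.dι p z⟫_ℝ = ⟪DM (coordExt y) p x, z⟫_ℝ := by
  set T : TangentSpace (𝓡 6) p → TangentSpace (𝓡 6) p → TangentSpace (𝓡 6) p → ℝ := fun x y z ↦
    ⟪alongDeriv DN S.ι (S.pushExt y) p x, S.dι p z⟫_ℝ - ⟪DM (coordExt y) p x, z⟫_ℝ with hT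
  have h1 : ∀ x y z, T x y z = T y x z := fun x y z ↦ by
    simp only [hT]
    rw [S.alongDeriv_pushExt_comm p hDN, torsion_free_coordExt hDM.1]
  have h2 : ∀ x y z, T x y z = -T x z y := fun x y z ↦ by
    have e1 := (hDN.hasDirDeriv_inner_along (S.mdiffAlong_pushExt y) (S.mdiffAlong_pushExt z) x).eq
    have e2 := (hDM.hasDirDeriv_inner (mdifferentiableAt_coordExt y)
      (mdifferentiableAt_coordExt z) x).eq
    have e3 : (fun q ↦ ⟪S.pushExt y q, S.pushExt z q⟫_ℝ)
        = fun q ↦ ⟪coordExt y q, coordExt z q⟫_ℝ := by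
      funext q; exact S.isometric q _ _
    rw [e3, e2] at e1
    simp only [pushExt_self, coordExt_self] at e1
    rw [real_inner_comm _ (S.dι p y), real_inner_comm _ y] at e1
    simp only [hT]
    linarith
  have h3 : T x y z = 0 := by
    have a1 := h1 x y z
    have a2 := h2 y x z
    have a3 := h1 y z x
    have a4 := h2 z y x
    have a5 := h1 z x y
    have a6 := h2 x z y
    linarith
  exact sub_eq_zero.1 h3

include hDN hDM in
/-- The Gauss formula. -/
theorem alongDeriv_pushExt (x y : TangentSpace (𝓡 6) p) :
    alongDeriv DN S.ι (S.pushExt y) p x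
      = S.dι p (DM (coordExt y) p x) + S.B DN p x y • S.n p := by
  have H := S.isHyperplane p
  rw [H.decomp (alongDeriv DN S.ι (S.pushExt y) p x), real_inner_comm, ← B_eq]
  congr 2
  refine ext_inner_right ℝ fun z ↦ ?_
  rw [LinearMap.adjoint_inner_left, S.inner_alongDeriv_pushExt p hDN hDM]

end G2Hyp.Hypersurface

end HypersurfaceGeometry

theorem update_vec3 {V : Type*} (x y z t : V) : Function.update ![x, y, z] 0 t = ![t, y, z] ∧
    Function.update ![x, y, z] 1 t = ![x, t, z] ∧ Function.update ![x, y, z] 2 t = ![x, y, t] := by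
  refine ⟨?_, ?_, ?_⟩ <;> funext i <;> fin_cases i <;> rfl

/-! ### Covariant derivatives of forms of low degree -/

section CovDeriv

variable {m : ℕ} {X : Type*} [TopologicalSpace X] [ChartedSpace (EuclideanSpace ℝ (Fin m)) X]
  [IsManifold (𝓡 m) ∞ X] (D : Connection m X)

theorem covDeriv_two (α : ∀ x : X, (Fin 2 → TangentSpace (𝓡 m) x) → ℝ) (x : X)
    (v y z : TangentSpace (𝓡 m) x) :
    covDeriv D α x v ![y, z]
      = mvfderiv (𝓡 m) (fun q ↦ α q ![coordExt y q, coordExt z q]) x v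
        - (α x ![D (coordExt y) x v, z] + α x ![y, D (coordExt z) x v]) := by
  have h1 : ∀ q : X, (fun i ↦ coordExt (![y, z] i) q) = ![coordExt y q, coordExt z q] := fun q ↦ by
    funext i; fin_cases i <;> rfl
  simp only [covDeriv, h1, Fin.sum_univ_two]
  congr 3 <;> funext i <;> fin_cases i <;> rfl

theorem covDeriv_three (α : ∀ x : X, (Fin 3 → TangentSpace (𝓡 m) x) → ℝ) (x : X)
    (v y z u : TangentSpace (𝓡 m) x) :
    covDeriv D α x v ![y, z, u]
      = mvfderiv (𝓡 m) (fun q ↦ α q ![coordExt y q, coordExt z q, coordExt u q]) x v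
        - (α x ![D (coordExt y) x v, z, u] + α x ![y, D (coordExt z) x v, u]
          + α x ![y, z, D (coordExt u) x v]) := by
  have h1 : ∀ q : X, (fun i ↦ coordExt (![y, z, u] i) q)
      = ![coordExt y q, coordExt z q, coordExt u q] := fun q ↦ by
    funext i; fin_cases i <;> rfl
  simp only [covDeriv, h1, Fin.sum_univ_three]
  rw [(update_vec3 ..).1, (update_vec3 ..).2.1, (update_vec3 ..).2.2]
  rfl

theorem vec3_eta {V : Type*} (w : Fin 3 → V) : w = ![w 0, w 1, w 2] := by
  funext i; fin_cases i <;> rfl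

theorem vec4_eta {V : Type*} (w : Fin 4 → V) : w = ![w 0, w 1, w 2, w 3] := by
  funext i; fin_cases i <;> rfl

end CovDeriv

/-! ### Skew-symmetry of the four-form -/

section StarForm

variable {V : Type*} [NormedAddCommGroup V] [InnerProductSpace ℝ V] [FiniteDimensional ℝ V]
  (φ : V [⋀^Fin 3]→ₗ[ℝ] ℝ)

theorem starForm_swap₁₂ (x y z u : V) : starForm φ ![x, y, z, u] = -starForm φ ![y, x, z, u] := by
  simp only [starForm, Matrix.cons_val]
  rw [cross_swap φ x y, cross_swap φ y u, cross_swap φ u x]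
  simp only [inner_neg_left, inner_neg_right]
  rw [real_inner_comm (cross φ x u), real_inner_comm (cross φ x z)]
  ring

theorem starForm_swap₂₃ (x y z u : V) : starForm φ ![x, y, z, u] = -starForm φ ![x, z, y, u] := by
  simp only [starForm, Matrix.cons_val]
  rw [cross_swap φ z u, cross_swap φ u y, cross_swap φ y z]
  simp only [inner_neg_right]
  ring

theorem starForm_swap₃₄ (x y z u : V) : starForm φ ![x, y, z, u] = -starForm φ ![x, y, u, z] := by
  simp only [starForm, Matrix.cons_val]
  rw [cross_swap φ z u, cross_swap φ u y, cross_swap φ y z]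
  simp only [inner_neg_right]
  ring

end StarForm

/-! ### Structures of type X₁ and the constant k -/

section NearlyParallel

variable {N : Type*} [TopologicalSpace N] [ChartedSpace (EuclideanSpace ℝ (Fin 7)) N]
  [IsManifold (𝓡 7) ∞ N] [RiemannianBundle (fun x : N ↦ TangentSpace (𝓡 7) x)]
  (φ : G2Structure N)

namespace G2Hyp.G2Structure

theorem mdifferentiableAt_form {x : N} (y z u : TangentSpace (𝓡 7) x) :
    MDifferentiableAt (𝓡 7) 𝓘(ℝ, ℝ)
      (fun q ↦ altTrilin (φ.form q) (coordExt y q) (coordExt z q) (coordExt u q)) x := by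
  have h := (φ.smooth x ![coordExt y, coordExt z, coordExt u] (fun i ↦ by
    fin_cases i <;> exact smoothFieldAt_coordExt _)).mdifferentiableAt (by simp)
  convert h using 2 with q
  rw [altTrilin_apply]
  congr 1
  funext i; fin_cases i <;> rfl

theorem isCrossProduct (x : N) : IsCrossProduct (φ.form x) := by
  obtain ⟨b, hb⟩ := φ.cayley x
  exact cayley_inner_cross_cross hb

/-- The exterior derivative is the alternation of ∇φ: for a torsion-free connection the terms
differentiating the arguments cancel in pairs. -/
theorem extDer_eq {D : Connection 7 N} (hD : D.torsion = 0) (x : N)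
    (w₀ w₁ w₂ w₃ : TangentSpace (𝓡 7) x) :
    extDer (fun y ↦ φ.form y) x ![w₀, w₁, w₂, w₃]
      = covDeriv D (fun y ↦ φ.form y) x w₀ ![w₁, w₂, w₃]
        - covDeriv D (fun y ↦ φ.form y) x w₁ ![w₀, w₂, w₃]
        + covDeriv D (fun y ↦ φ.form y) x w₂ ![w₀, w₁, w₃]
        - covDeriv D (fun y ↦ φ.form y) x w₃ ![w₀, w₁, w₂] := by
  have h1 : ∀ (i : Fin 4) (a b c : TangentSpace (𝓡 7) x),
      (fun j ↦ ![w₀, w₁, w₂, w₃] (i.succAbove j)) = ![a, b, c] →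
      ∀ q : N, (fun j ↦ coordExt (![w₀, w₁, w₂, w₃] (i.succAbove j)) q)
        = ![coordExt a q, coordExt b q, coordExt c q] := fun i a b c h q ↦ by
    funext j
    have := congrFun h j
    rw [show ![w₀, w₁, w₂, w₃] (i.succAbove j) = ![a, b, c] j from this]
    fin_cases j <;> rfl
  have k0 := h1 0 w₁ w₂ w₃ (by funext j; fin_cases j <;> rfl)
  have k1 := h1 1 w₀ w₂ w₃ (by funext j; fin_cases j <;> rfl)
  have k2 := h1 2 w₀ w₁ w₃ (by funext j; fin_cases j <;> rfl)
  have k3 := h1 3 w₀ w₁ w₂ (by funext j; fin_cases j <;> rfl)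
  refine (Fin.sum_univ_four _).trans ?_
  simp only [k0, k1, k2, k3, covDeriv_three]
  simp only [Fin.coe_ofNat_eq_mod, Matrix.cons_val]
  rw [torsion_free_coordExt hD w₁ w₀, torsion_free_coordExt hD w₂ w₀, torsion_free_coordExt hD w₃ w₀,
    torsion_free_coordExt hD w₂ w₁, torsion_free_coordExt hD w₃ w₁, torsion_free_coordExt hD w₃ w₂]
  rw [alt3_swap₁₂ (φ.form x) w₁ (D (coordExt w₂) x w₀),
    alt3_swap₂₃ (φ.form x) w₀ (D (coordExt w₃) x w₁), ← alt3_cyclic (φ.form x) (D (coordExt w₃) x w₀)]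
  norm_num
  ring

/-- If `∇φ` is pointwise a multiple of `*φ`, the multiple is determined by `dφ`. -/
theorem IsTypeX1.covDeriv_eq {D : Connection 7 N} (h : φ.IsTypeX1 D) (hD : D.torsion = 0) {k : ℝ}
    (hk : ∀ x w, extDer (fun y ↦ φ.form y) x w = k * φ.star x w) (x : N)
    (v : TangentSpace (𝓡 7) x) (w : Fin 3 → TangentSpace (𝓡 7) x) :
    covDeriv D (fun y ↦ φ.form y) x v w = k / 4 * φ.star x (Matrix.vecCons v w) := by
  obtain ⟨c, hc⟩ := h x
  obtain ⟨b, hb⟩ := φ.cayley x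
  obtain ⟨u, hu⟩ := exists_starForm_ne_zero hb
  have h1 := hk x u
  rw [vec4_eta u] at h1 hu
  rw [φ.extDer_eq hD, hc, hc, hc, hc] at h1
  simp only [star] at h1
  rw [starForm_swap₁₂ (φ.form x) (u 1), starForm_swap₁₂ (φ.form x) (u 2), starForm_swap₂₃ (φ.form x) (u 0) (u 2),
    starForm_swap₁₂ (φ.form x) (u 3), starForm_swap₂₃ (φ.form x) (u 0) (u 3), starForm_swap₃₄ (φ.form x) _ _ (u 3)] at h1
  rw [hc]
  congr 1
  -- After reordering arguments, all four terms of the alternation equal c *φ. This is the origin of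
  -- k/4.
  have h2 : (4 * c) * starForm (φ.form x) ![u 0, u 1, u 2, u 3]
    = k * starForm (φ.form x) ![u 0, u 1, u 2, u 3] := by rw [← h1]; ring
  have := mul_right_cancel₀ hu h2
  linarith

theorem isTypeP_iff [Nonempty N] {D : Connection 7 N} {k : ℝ}
    (hk : ∀ x v w, covDeriv D (fun y ↦ φ.form y) x v w = k / 4 * φ.star x (Matrix.vecCons v w)) :
    φ.IsTypeP D ↔ k = 0 := by
  constructor
  · intro h
    obtain ⟨x⟩ := ‹Nonempty N›
    obtain ⟨b, hb⟩ := φ.cayley x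
    obtain ⟨u, hu⟩ := exists_starForm_ne_zero hb
    have h1 := hk x (u 0) ![u 1, u 2, u 3]
    rw [h] at h1
    rw [vec4_eta u] at hu
    have h2 := (mul_eq_zero.1 h1.symm).resolve_right hu
    linarith
  · rintro rfl x v w
    rw [hk]; ring

end G2Hyp.G2Structure

end NearlyParallel

/-! ### Differentiability of vector fields tested by inner products -/

section MusicalRegularity

open scoped InnerProductSpace

variable {m : ℕ} {X : Type*} [TopologicalSpace X] [ChartedSpace (EuclideanSpace ℝ (Fin m)) X]
  [IsManifold (𝓡 m) ∞ X] [RiemannianBundle (fun x : X ↦ TangentSpace (𝓡 m) x)]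
  [IsContMDiffRiemannianBundle (𝓡 m) ∞ (EuclideanSpace ℝ (Fin m))
      (fun x : X ↦ TangentSpace (𝓡 m) x)]

local notation "E" => EuclideanSpace ℝ (Fin m)

/-- The coordinate frame at `x`. -/
noncomputable def coordFrame (x : X) (i : Fin m) (q : X) : TangentSpace (𝓡 m) q :=
  coordExt (x := x) (EuclideanSpace.single i (1 : ℝ) : E) q

/-- The metric in the coordinate frame at `x`, as an operator. -/
noncomputable def gramOp (x q : X) : E →L[ℝ] E :=
  ∑ i, ∑ j, ⟪coordFrame x i q, coordFrame x j q⟫_ℝ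
    • (EuclideanSpace.proj i : E →L[ℝ] ℝ).smulRight (EuclideanSpace.single j (1 : ℝ) : E)

omit [IsContMDiffRiemannianBundle (𝓡 m) ∞ (EuclideanSpace ℝ (Fin m))
      (fun x : X ↦ TangentSpace (𝓡 m) x)] in
theorem gramOp_apply (x q : X) (a : E) (j : Fin m) :
    gramOp x q a j = ⟪∑ i, a i • coordFrame x i q, coordFrame x j q⟫_ℝ := by
  rw [sum_inner]
  simp only [gramOp, real_inner_smul_left, _root_.sum_apply, _root_.smul_apply,
    ContinuousLinearMap.smulRight_apply, PiLp.proj_apply, PiLp.smul_apply,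
    WithLp.ofLp_sum, Finset.sum_apply, smul_eq_mul, PiLp.single_apply]
  refine Finset.sum_congr rfl fun i _ ↦ ?_
  rw [Finset.sum_eq_single j (fun k _ hk ↦ by simp [hk.symm]) (by simp)]
  simp [mul_comm]

-- Positive definiteness of the metric: a combination of frame vectors orthogonal to the whole frame
-- is zero.
omit [IsContMDiffRiemannianBundle (𝓡 m) ∞ (EuclideanSpace ℝ (Fin m))
      (fun x : X ↦ TangentSpace (𝓡 m) x)] in
theorem gramOp_isInvertible {x q : X} (hq : q ∈ (chartAt (EuclideanSpace ℝ (Fin m)) x).source) :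
    (gramOp (m := m) x q).IsInvertible := by
  have hinj : Function.Injective (gramOp (m := m) x q) := by
    rw [injective_iff_map_eq_zero]
    intro a ha
    have h1 : ∀ j, ⟪∑ i, a i • coordFrame x i q, coordFrame x j q⟫_ℝ = 0 := fun j ↦ by
      rw [← gramOp_apply, ha]; rfl
    have h2 : ∑ i, a i • coordFrame x i q = 0 := by
      rw [← inner_self_eq_zero (𝕜 := ℝ), inner_sum]
      refine Finset.sum_eq_zero fun j _ ↦ ?_
      rw [real_inner_smul_right, h1, mul_zero]
    have h3 := (coordExt_eq_symmL (x := x) a hq).symm.trans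
      ((coordExt_eq_sum (x := x) a hq).trans h2)
    have h4 := Trivialization.continuousLinearMapAt_symmL (R := ℝ) (trivializationAt E
      (fun x : X ↦ TangentSpace (𝓡 m) x) x) hq a
    exact h4.symm.trans ((congrArg _ h3).trans (map_zero _))
  exact ⟨(LinearEquiv.ofInjectiveEndo (gramOp (m := m) x q).toLinearMap hinj).toContinuousLinearEquiv,
    by ext; rfl⟩

theorem mdifferentiableAt_gramOp (x : X) :
    MDifferentiableAt (𝓡 m) 𝓘(ℝ, E →L[ℝ] E) (gramOp (m := m) x) x :=
  (HasDirDeriv.sum (v := (0 : TangentSpace (𝓡 m) x)) Finset.univ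
    fun i (_ : i ∈ Finset.univ) ↦
    HasDirDeriv.sum Finset.univ fun j (_ : j ∈ Finset.univ) ↦
    (HasDirDeriv.of_mdiff (mdifferentiableAt_inner
      (mdifferentiableAt_coordExt (EuclideanSpace.single i (1 : ℝ) : E))
      (mdifferentiableAt_coordExt (EuclideanSpace.single j (1 : ℝ) : E)))).smul
      (HasDirDeriv.const _)).mdiff

/-- A vector field is differentiable as soon as its inner products with the coordinate fields
are. -/
theorem mdifferentiableAt_of_inner {x : X} {Y : ∀ q : X, TangentSpace (𝓡 m) q}
    (h : ∀ w : TangentSpace (𝓡 m) x,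
      MDifferentiableAt (𝓡 m) 𝓘(ℝ, ℝ) (fun q ↦ ⟪Y q, coordExt w q⟫_ℝ) x) :
    MDifferentiableAt (𝓡 m) (𝓡 m).tangent
      (fun q ↦ (⟨q, Y q⟩ : TangentBundle (𝓡 m) X)) x := by
  refine mdiffAlong_iff (f := fun q : X ↦ q).2 ⟨mdifferentiableAt_id, ?_⟩
  -- The components of `Y` are the inverse Gram operator applied to its inner products with the
  -- frame, and operator inversion is smooth at invertible operators.
  have h1 : MDifferentiableAt (𝓡 m) 𝓘(ℝ, E →L[ℝ] E) (fun q ↦ (gramOp (m := m) x q).inverse) x :=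
    ((gramOp_isInvertible (mem_chart_source _ x)).contDiffAt_map_inverse (n := 1)
      |>.differentiableAt (by simp)).mdifferentiableAt.comp x (mdifferentiableAt_gramOp (m := m) x)
  have h2 : MDifferentiableAt (𝓡 m) 𝓘(ℝ, E)
      (fun q ↦ ∑ j, ⟪Y q, coordFrame x j q⟫_ℝ • (EuclideanSpace.single j (1 : ℝ) : E)) x :=
    (HasDirDeriv.sum (v := (0 : TangentSpace (𝓡 m) x)) Finset.univ
      fun j (_ : j ∈ Finset.univ) ↦ (HasDirDeriv.of_mdiff
        (h (EuclideanSpace.single j (1 : ℝ) : E))).smul (HasDirDeriv.const _)).mdiff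
  refine (h1.clm_apply h2).congr_of_eventuallyEq ?_
  filter_upwards [(chartAt E x).open_source.mem_nhds (mem_chart_source _ x)] with q hq
  have h3 : gramOp (m := m) x q (alongCoord (fun q : X ↦ q) Y x q)
      = ∑ j, ⟪Y q, coordFrame x j q⟫_ℝ • (EuclideanSpace.single j (1 : ℝ) : E) := by
    ext j
    rw [gramOp_apply]
    have := (eq_coordExt_alongCoord (f := fun q : X ↦ q) Y hq).trans (coordExt_eq_sum (x := x) _ hq)
    simp only [coordFrame] at this ⊢
    rw [← this]
    simp only [WithLp.ofLp_sum, Finset.sum_apply, PiLp.smul_apply, PiLp.single_apply, smul_eq_mul]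
    rw [Finset.sum_eq_single j (fun k _ hk ↦ by simp [hk.symm]) (by simp)]
    simp
  rw [← h3]
  exact ((gramOp_isInvertible hq).inverse_apply_eq.2 rfl).symm

end MusicalRegularity

/-! ### First derivatives of the induced structure -/

noncomputable section InducedStructure

open scoped InnerProductSpace

variable {N : Type*} [TopologicalSpace N] [ChartedSpace (EuclideanSpace ℝ (Fin 7)) N]
  [IsManifold (𝓡 7) ∞ N] [RiemannianBundle (fun x : N ↦ TangentSpace (𝓡 7) x)]
  {M : Type*} [TopologicalSpace M] [ChartedSpace (EuclideanSpace ℝ (Fin 6)) M]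
  [RiemannianBundle (fun p : M ↦ TangentSpace (𝓡 6) p)]

namespace G2Hyp.Hypersurface

variable (S : Hypersurface N M) (φ : G2Structure N)

/-- The pullback of `φ` as a trilinear form. -/
def pullTrilin (p : M) : Trilin (TangentSpace (𝓡 6) p) := hypForm (S.dι p) (φ.form (S.ι p))

theorem isSU3 (p : M) : IsSU3 (S.I φ p) (S.pullTrilin φ p) :=
  (S.isHyperplane p).isSU3 (φ.isCrossProduct _)

theorem pullTrilin_apply (p : M) (x y z : TangentSpace (𝓡 6) p) : S.pullTrilin φ p x y z
    = altTrilin (φ.form (S.ι p)) (S.dι p x) (S.dι p y) (S.dι p z) := rfl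

theorem pullForm_vec (p : M) (x y z : TangentSpace (𝓡 6) p) :
    S.pullForm φ p ![x, y, z] = S.pullTrilin φ p x y z := by
  rw [pullTrilin, hypForm_apply, pullForm]
  congr 1
  funext i; fin_cases i <;> rfl

theorem pullStar_vec (p : M) (x y z : TangentSpace (𝓡 6) p) :
    S.pullStar φ p ![x, y, z] = -S.pullTrilin φ p (S.I φ p x) y z := by
  refine Eq.trans ?_ ((S.isHyperplane p).starForm_n (φ.isCrossProduct _) x y z)
  rw [pullStar, G2Structure.star]
  congr 1
  funext i; fin_cases i <;> rfl

theorem ψp_vec (θ : M → ℝ) (p : M) (x y z : TangentSpace (𝓡 6) p) : S.ψp φ θ p ![x, y, z]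
    = Real.cos (θ p) * S.pullTrilin φ p x y z
      + Real.sin (θ p) * S.pullTrilin φ p (S.I φ p x) y z := by
  rw [ψp, pullForm_vec, pullStar_vec]; ring

theorem ψm_vec (θ : M → ℝ) (p : M) (x y z : TangentSpace (𝓡 6) p) : S.ψm φ θ p ![x, y, z]
    = Real.sin (θ p) * S.pullTrilin φ p x y z
      - Real.cos (θ p) * S.pullTrilin φ p (S.I φ p x) y z := by
  rw [ψm, pullForm_vec, pullStar_vec]; ring

theorem kahler_vec (p : M) (y z : TangentSpace (𝓡 6) p) :
    S.kahler φ p ![y, z] = φ.form (S.ι p) ![S.n p, S.dι p z, S.dι p y] := by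
  rw [← (S.isHyperplane p).inner_hypJ, real_inner_comm]
  rfl

theorem inner_I (p : M) (y z : TangentSpace (𝓡 6) p) :
    ⟪S.I φ p y, z⟫_ℝ = φ.form (S.ι p) ![S.n p, S.dι p y, S.dι p z] :=
  (S.isHyperplane p).inner_hypJ y z

variable {DN : Connection 7 N} {κ : ℝ}
  (hκ : ∀ x v w, covDeriv DN (fun y ↦ φ.form y) x v w = κ * φ.star x (Matrix.vecCons v w))
  {p : M}

include hκ in
/-- The derivative of `φ` evaluated on vector fields along the hypersurface. -/
theorem hasDirDeriv_form {s₁ s₂ s₃ : ∀ q : M, TangentSpace (𝓡 7) (S.ι q)}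
    (h₁ : MDiffAlong (a := 6) S.ι s₁ p) (h₂ : MDiffAlong (a := 6) S.ι s₂ p)
    (h₃ : MDiffAlong (a := 6) S.ι s₃ p) (v : TangentSpace (𝓡 6) p) :
    HasDirDeriv (fun q ↦ φ.form (S.ι q) ![s₁ q, s₂ q, s₃ q]) p v
      (κ * starForm (φ.form (S.ι p)) ![S.dι p v, s₁ p, s₂ p, s₃ p]
        + φ.form (S.ι p) ![alongDeriv DN S.ι s₁ p v, s₂ p, s₃ p]
        + φ.form (S.ι p) ![s₁ p, alongDeriv DN S.ι s₂ p v, s₃ p]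
        + φ.form (S.ι p) ![s₁ p, s₂ p, alongDeriv DN S.ι s₃ p v]) := by
  have h := HasDirDeriv.trilin_along (v := v) DN (β := fun x ↦ altTrilin (φ.form x))
    (fun y z u ↦ φ.mdifferentiableAt_form y z u) h₁ h₂ h₃
  simp only [altTrilin_apply] at h
  refine ⟨h.mdiff, h.eq.trans ?_⟩
  have h2 := hκ (S.ι p) (S.dι p v) ![s₁ p, s₂ p, s₃ p]
  rw [covDeriv_three] at h2
  rw [show starForm (φ.form (S.ι p)) ![S.dι p v, s₁ p, s₂ p, s₃ p]
    = φ.star (S.ι p) (Matrix.vecCons (S.dι p v) ![s₁ p, s₂ p, s₃ p]) from rfl, ← h2]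
  simp only [dι, ContinuousLinearMap.coe_coe]
  ring

variable [IsManifold (𝓡 6) ∞ M] [IsContMDiffRiemannianBundle (𝓡 7) ∞ (EuclideanSpace ℝ (Fin 7))
      (fun x : N ↦ TangentSpace (𝓡 7) x)]
  [IsContMDiffRiemannianBundle (𝓡 6) ∞ (EuclideanSpace ℝ (Fin 6))
      (fun p : M ↦ TangentSpace (𝓡 6) p)]
  (hDN : IsLeviCivita DN) {DM : Connection 6 M} (hDM : IsLeviCivita DM)

include hκ

/-- Differentiate ω(y, z) = φ(n, z, y). The derivative of n contributes Φ(A v, y, z) and ∇φ = κ *φ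
contributes -κ Φ(I v, y, z). The normal parts in the Gauss formula drop out because n then occurs
twice in φ. -/
theorem hasDirDeriv_kahler (hDN : IsLeviCivita DN) {DM : Connection 6 M} (hDM : IsLeviCivita DM)
    (v y z : TangentSpace (𝓡 6) p) :
    HasDirDeriv (fun q ↦ S.kahler φ q ![coordExt y q, coordExt z q]) p v
      (S.pullTrilin φ p ((S.weingarten DN p - κ • S.I φ p) v) y z
        + S.kahler φ p ![DM (coordExt y) p v, z] + S.kahler φ p ![y, DM (coordExt z) p v]) := by
  have h := S.hasDirDeriv_form φ hκ (S.mdiffAlong_n p) (S.mdiffAlong_pushExt z)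
    (S.mdiffAlong_pushExt y) v
  have e : (fun q ↦ S.kahler φ q ![coordExt y q, coordExt z q])
      = fun q ↦ φ.form (S.ι q) ![S.n q, S.pushExt z q, S.pushExt y q] := by
    funext q; rw [kahler_vec]; rfl
  rw [e]
  refine ⟨h.mdiff, h.eq.trans ?_⟩
  simp only [pushExt_self]
  rw [S.alongDeriv_n p hDN, S.alongDeriv_pushExt p hDN hDM, S.alongDeriv_pushExt p hDN hDM,
    starForm_swap₁₂, (S.isHyperplane p).starForm_n (φ.isCrossProduct _), kahler_vec, kahler_vec]
  have h0 : ∀ x, altTrilin (φ.form (S.ι p)) (S.n p) (S.n p) x = 0 := fun x ↦ by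
    rw [altTrilin_apply]
    exact (φ.form (S.ι p)).map_eq_zero_of_eq _ (i := 0) (j := 1) rfl (by decide)
  have h1 : ∀ x, altTrilin (φ.form (S.ι p)) (S.n p) x (S.n p) = 0 := fun x ↦ by
    rw [altTrilin_apply]
    exact (φ.form (S.ι p)).map_eq_zero_of_eq _ (i := 0) (j := 2) rfl (by decide)
  change κ * -(-S.pullTrilin φ p (S.I φ p v) z y) + _ + _ + _ = _
  simp only [← altTrilin_apply, map_add, map_neg, map_smul, map_sub, LinearMap.add_apply,
    LinearMap.neg_apply, LinearMap.smul_apply, LinearMap.sub_apply, h0, h1, smul_eq_mul,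
    ← pullTrilin_apply]
  rw [(S.isSU3 φ p).swap₂₃ _ z y, (S.isSU3 φ p).swap₂₃ _ z y]
  ring

theorem mdifferentiableAt_I_coordExt (hDN : IsLeviCivita DN) {DM : Connection 6 M}
    (hDM : IsLeviCivita DM) (y : TangentSpace (𝓡 6) p) :
    MDifferentiableAt (𝓡 6) (𝓡 6).tangent
      (fun q ↦ (⟨q, S.I φ q (coordExt y q)⟩ : TangentBundle (𝓡 6) M)) p := by
  refine mdifferentiableAt_of_inner fun w ↦ ?_
  -- Only differentiability is wanted here, so the direction is taken to be zero.
  have h := (S.hasDirDeriv_kahler φ hκ hDN hDM 0 w y).mdiff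
  refine h.congr_of_eventuallyEq (Filter.Eventually.of_forall fun q ↦ ?_)
  exact real_inner_comm _ _

/-- The derivative of ω(x, y) = ⟪x, I y⟫ is computed in a second way, by metric compatibility of the
connection of M, and the results are compared. -/
theorem inner_covDerivI (hDN : IsLeviCivita DN) {DM : Connection 6 M} (hDM : IsLeviCivita DM)
    (v x y : TangentSpace (𝓡 6) p) :
    ⟪x, S.covDerivI φ DM p v y⟫_ℝ
      = S.pullTrilin φ p ((S.weingarten DN p - κ • S.I φ p) v) x y := by
  have h1 := (S.hasDirDeriv_kahler φ hκ hDN hDM v x y).eq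
  have h2 := (hDM.hasDirDeriv_inner (mdifferentiableAt_coordExt x)
    (S.mdifferentiableAt_I_coordExt φ hκ hDN hDM y) v).eq
  have h3 := h1.symm.trans h2
  simp only [coordExt_self] at h3
  rw [covDerivI, inner_sub_right]
  simp only [kahler, Matrix.cons_val] at h3
  linarith

theorem covDeriv_kahler (hDN : IsLeviCivita DN) {DM : Connection 6 M} (hDM : IsLeviCivita DM)
    (v y z : TangentSpace (𝓡 6) p) :
    covDeriv DM (S.kahler φ) p v ![y, z]
      = S.pullTrilin φ p ((S.weingarten DN p - κ • S.I φ p) v) y z := by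
  rw [covDeriv_two, (S.hasDirDeriv_kahler φ hκ hDN hDM v y z).eq]
  ring

/-- In other words ∇ + ξ annihilates ι*φ. The Gauss formula gives the Levi-Civita terms and normal
terms B(v, yᵢ) paired with ω. Together with κ ι*(*φ) the latter make up the action of ξ, by
`nabla_form_eq`. -/
theorem hasDirDeriv_pullForm (hDN : IsLeviCivita DN) {DM : Connection 6 M} (hDM : IsLeviCivita DM)
    (v y₁ y₂ y₃ : TangentSpace (𝓡 6) p) :
    HasDirDeriv (fun q ↦ S.pullForm φ q ![coordExt y₁ q, coordExt y₂ q, coordExt y₃ q]) p v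
      (S.pullTrilin φ p (-(1 / 2 : ℝ) • S.I φ p (S.covDerivI φ DM p v y₁)) y₂ y₃
        + S.pullTrilin φ p y₁ (-(1 / 2 : ℝ) • S.I φ p (S.covDerivI φ DM p v y₂)) y₃
        + S.pullTrilin φ p y₁ y₂ (-(1 / 2 : ℝ) • S.I φ p (S.covDerivI φ DM p v y₃))
        + S.pullTrilin φ p (DM (coordExt y₁) p v) y₂ y₃
        + S.pullTrilin φ p y₁ (DM (coordExt y₂) p v) y₃
        + S.pullTrilin φ p y₁ y₂ (DM (coordExt y₃) p v)) := by
  have h := S.hasDirDeriv_form φ hκ (S.mdiffAlong_pushExt y₁) (S.mdiffAlong_pushExt y₂)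
    (S.mdiffAlong_pushExt y₃) v
  have e : (fun q ↦ S.pullForm φ q ![coordExt y₁ q, coordExt y₂ q, coordExt y₃ q])
      = fun q ↦ φ.form (S.ι q) ![S.pushExt y₁ q, S.pushExt y₂ q, S.pushExt y₃ q] := by
    funext q; rw [pullForm_vec, pullTrilin, hypForm_apply]; rfl
  rw [e, ← (S.isSU3 φ p).nabla_form_eq (A := S.weingarten DN p) κ v y₁ y₂ y₃
    (fun x ↦ S.inner_covDerivI φ hκ hDN hDM v x y₁)
    (fun x ↦ S.inner_covDerivI φ hκ hDN hDM v x y₂)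
    (fun x ↦ S.inner_covDerivI φ hκ hDN hDM v x y₃)]
  refine ⟨h.mdiff, h.eq.trans ?_⟩
  simp only [pushExt_self]
  rw [S.alongDeriv_pushExt p hDN hDM, S.alongDeriv_pushExt p hDN hDM,
    S.alongDeriv_pushExt p hDN hDM, (S.isHyperplane p).starForm_tangent (φ.isCrossProduct _)]
  have h0 : ∀ x y, altTrilin (φ.form (S.ι p)) (S.n p) (S.dι p x) (S.dι p y)
      = ⟪S.I φ p x, y⟫_ℝ := fun x y ↦ by rw [altTrilin_apply, inner_I]
  have h1 : ∀ x y, altTrilin (φ.form (S.ι p)) (S.dι p x) (S.n p) (S.dι p y)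
      = ⟪S.I φ p y, x⟫_ℝ := fun x y ↦ by rw [altTrilin_apply, alt3_cyclic, inner_I]
  have h2 : ∀ x y, altTrilin (φ.form (S.ι p)) (S.dι p x) (S.dι p y) (S.n p)
      = ⟪S.I φ p x, y⟫_ℝ := fun x y ↦ by rw [altTrilin_apply, ← alt3_cyclic, inner_I]
  simp only [← altTrilin_apply, map_add, map_smul, LinearMap.add_apply,
    LinearMap.smul_apply, h0, h1, h2, smul_eq_mul, ← pullTrilin_apply, S.inner_weingarten p hDN]
  change κ * (⟪v, S.I φ p y₂⟫_ℝ * ⟪y₁, S.I φ p y₃⟫_ℝ - ⟪v, S.I φ p y₃⟫_ℝ * ⟪y₁, S.I φ p y₂⟫_ℝ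
    - ⟪S.I φ p v, y₁⟫_ℝ * ⟪S.I φ p y₂, y₃⟫_ℝ) + _ + _ + _ = _
  ring

end G2Hyp.Hypersurface

end InducedStructure

/-! ### The intrinsic torsion of the induced structure -/

noncomputable section InducedTorsion

open scoped InnerProductSpace

variable {N : Type*} [TopologicalSpace N] [ChartedSpace (EuclideanSpace ℝ (Fin 7)) N]
  [IsManifold (𝓡 7) ∞ N] [RiemannianBundle (fun x : N ↦ TangentSpace (𝓡 7) x)]
  [IsContMDiffRiemannianBundle (𝓡 7) ∞ (EuclideanSpace ℝ (Fin 7))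
      (fun x : N ↦ TangentSpace (𝓡 7) x)]
  {M : Type*} [TopologicalSpace M] [ChartedSpace (EuclideanSpace ℝ (Fin 6)) M]
  [IsManifold (𝓡 6) ∞ M] [RiemannianBundle (fun p : M ↦ TangentSpace (𝓡 6) p)]
  [IsContMDiffRiemannianBundle (𝓡 6) ∞ (EuclideanSpace ℝ (Fin 6))
      (fun p : M ↦ TangentSpace (𝓡 6) p)]

namespace G2Hyp.Hypersurface

variable (S : Hypersurface N M) (φ : G2Structure N) {DN : Connection 7 N} {κ : ℝ}
  (hκ : ∀ x v w, covDeriv DN (fun y ↦ φ.form y) x v w = κ * φ.star x (Matrix.vecCons v w))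
  (hDN : IsLeviCivita DN) {DM : Connection 6 M} (hDM : IsLeviCivita DM) {p : M}

/-- The action of `ξ_v = -1/2 I (∇_v I)` on tangent vectors. -/
def xi (DM : Connection 6 M) (p : M) (v y : TangentSpace (𝓡 6) p) : TangentSpace (𝓡 6) p :=
  -(1 / 2 : ℝ) • S.I φ p (S.covDerivI φ DM p v y)

include hκ hDN hDM

theorem covDerivI_I (v y : TangentSpace (𝓡 6) p) :
    S.covDerivI φ DM p v (S.I φ p y) = -S.I φ p (S.covDerivI φ DM p v y) := by
  refine ext_inner_left ℝ fun x ↦ ?_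
  rw [inner_neg_right, ← (S.isSU3 φ p).J_skew, S.inner_covDerivI φ hκ hDN hDM,
    S.inner_covDerivI φ hκ hDN hDM, (S.isSU3 φ p).J_right]

theorem xi_I (v y : TangentSpace (𝓡 6) p) :
    S.xi φ DM p v (S.I φ p y) = -(1 / 2 : ℝ) • S.covDerivI φ DM p v y := by
  rw [xi, S.covDerivI_I φ hκ hDN hDM, map_neg, (S.isSU3 φ p).J_sq, neg_neg]

/-- The form is -Φ(I·, ·, ·), and ∇ + ξ annihilates both Φ and I: indeed (∇_v I) y + ξ_v(I y) = ½
(∇_v I) y = I(ξ_v y). -/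
theorem hasDirDeriv_pullStar (v y₁ y₂ y₃ : TangentSpace (𝓡 6) p) :
    HasDirDeriv (fun q ↦ S.pullStar φ q ![coordExt y₁ q, coordExt y₂ q, coordExt y₃ q]) p v
      (S.pullStar φ p ![S.xi φ DM p v y₁, y₂, y₃] + S.pullStar φ p ![y₁, S.xi φ DM p v y₂, y₃]
        + S.pullStar φ p ![y₁, y₂, S.xi φ DM p v y₃]
        + S.pullStar φ p ![DM (coordExt y₁) p v, y₂, y₃]
        + S.pullStar φ p ![y₁, DM (coordExt y₂) p v, y₃]
        + S.pullStar φ p ![y₁, y₂, DM (coordExt y₃) p v]) := by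
  have hpf : ∀ y₁ y₂ y₃ : TangentSpace (𝓡 6) p, HasDirDeriv (fun q ↦ S.pullTrilin φ q
      (coordExt y₁ q) (coordExt y₂ q) (coordExt y₃ q)) p v _ := fun y₁ y₂ y₃ ↦
    (S.hasDirDeriv_pullForm φ hκ hDN hDM v y₁ y₂ y₃).congr
      (Filter.Eventually.of_forall fun q ↦ (S.pullForm_vec φ q _ _ _).symm)
  have hW := S.mdifferentiableAt_I_coordExt φ hκ hDN hDM y₁
  have h := (HasDirDeriv.trilin_along (v := v) DM (f := fun q : M ↦ q) (β := S.pullTrilin φ)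
    (fun y z u ↦ (hpf y z u).mdiff) hW (mdifferentiableAt_coordExt y₂)
    (mdifferentiableAt_coordExt y₃)).neg
  rw [alongDeriv_id DM hW, alongDeriv_id DM (mdifferentiableAt_coordExt y₂),
    alongDeriv_id DM (mdifferentiableAt_coordExt y₃),
    show mfderiv (𝓡 6) (𝓡 6) (fun q : M ↦ q) p = _ from mfderiv_id] at h
  have h1 := h.congr (g' := fun q ↦ S.pullStar φ q ![coordExt y₁ q, coordExt y₂ q, coordExt y₃ q])
    (Filter.Eventually.of_forall fun q ↦ S.pullStar_vec φ q _ _ _)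
  refine ⟨h1.mdiff, h1.eq.trans ?_⟩
  simp only [coordExt_self]
  change -(mvfderiv (𝓡 6) _ p v - S.pullTrilin φ p (DM _ p v) _ _
    - S.pullTrilin φ p _ (DM _ p v) _ - S.pullTrilin φ p _ _ (DM _ p v) + _ + _ + _) = _
  rw [(hpf (S.I φ p y₁) y₂ y₃).eq]
  have e1 : DM (fun q ↦ S.I φ q (coordExt y₁ q)) p v
      = S.covDerivI φ DM p v y₁ + S.I φ p (DM (coordExt y₁) p v) := by
    rw [covDerivI]; abel
  have e2 := S.xi_I φ hκ hDN hDM v y₁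
  rw [xi] at e2
  rw [e1, e2]
  simp only [pullStar_vec, xi, map_add, map_smul, LinearMap.add_apply, LinearMap.smul_apply,
    smul_eq_mul, (S.isSU3 φ p).J_sq, map_neg, LinearMap.neg_apply]
  ring

/-- Since ∇ + ξ annihilates the two pulled-back forms, only the derivatives of cos θ and sin θ
remain beside the ξ terms. -/
theorem hasDirDeriv_angle {θ : M → ℝ} (hθ : MDifferentiableAt (𝓡 6) 𝓘(ℝ, ℝ) θ p)
    (v y₁ y₂ y₃ : TangentSpace (𝓡 6) p) :
    covDeriv DM (S.ψp φ θ) p v ![y₁, y₂, y₃]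
      = S.ψp φ θ p ![S.xi φ DM p v y₁, y₂, y₃] + S.ψp φ θ p ![y₁, S.xi φ DM p v y₂, y₃]
        + S.ψp φ θ p ![y₁, y₂, S.xi φ DM p v y₃]
        - mvfderiv (𝓡 6) θ p v * S.ψm φ θ p ![y₁, y₂, y₃] ∧
    covDeriv DM (S.ψm φ θ) p v ![y₁, y₂, y₃]
      = S.ψm φ θ p ![S.xi φ DM p v y₁, y₂, y₃] + S.ψm φ θ p ![y₁, S.xi φ DM p v y₂, y₃]
        + S.ψm φ θ p ![y₁, y₂, S.xi φ DM p v y₃]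
        + mvfderiv (𝓡 6) θ p v * S.ψp φ θ p ![y₁, y₂, y₃] := by
  have hf := S.hasDirDeriv_pullForm φ hκ hDN hDM v y₁ y₂ y₃
  have hs := S.hasDirDeriv_pullStar φ hκ hDN hDM v y₁ y₂ y₃
  have ht := HasDirDeriv.of_mdiff (v := v) hθ
  have hcos := ht.comp_of_hasDerivAt (Real.hasDerivAt_cos (θ p))
  have hsin := ht.comp_of_hasDerivAt (Real.hasDerivAt_sin (θ p))
  constructor
  · rw [covDeriv_three]
    rw [show mvfderiv (𝓡 6) (fun q ↦ S.ψp φ θ q ![coordExt y₁ q, coordExt y₂ q, coordExt y₃ q]) p v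
      = _ from ((hcos.mul hf).sub (hsin.mul hs)).eq]
    simp only [ψp, ψm, coordExt_self, pullForm_vec, xi]
    ring
  · rw [covDeriv_three]
    rw [show mvfderiv (𝓡 6) (fun q ↦ S.ψm φ θ q ![coordExt y₁ q, coordExt y₂ q, coordExt y₃ q]) p v
      = _ from ((hsin.mul hf).add (hcos.mul hs)).eq]
    simp only [ψp, ψm, coordExt_self, pullForm_vec, xi]
    ring

/-- The endomorphism η_v is -η(I v) times I, and applying I in any one of the three arguments of ψ₊
gives -ψ₋, in those of ψ₋ gives ψ₊. So both conditions say that dθ(v) + 3 η(I v) multiplies a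
nonzero form to zero. -/
theorem annihilates_iff {θ : M → ℝ} (hθ : MDifferentiableAt (𝓡 6) 𝓘(ℝ, ℝ) θ p)
    (η : Module.Dual ℝ (TangentSpace (𝓡 6) p)) :
    (S.Annihilates φ DM p η (S.ψp φ θ) ∧ S.Annihilates φ DM p η (S.ψm φ θ)) ↔
      ∀ v, mvfderiv (𝓡 6) θ p v = -3 * η (S.I φ p v) := by
  have hsu := S.isSU3 φ p
  have hE : ∀ v y, S.torsionEnd φ DM p η v y = (-η (S.I φ p v)) • S.I φ p y + S.xi φ DM p v y :=
    fun v y ↦ by rw [torsionEnd, xi, neg_smul (1 / 2 : ℝ), sub_eq_add_neg]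
  have hp : ∀ v y₁ y₂ y₃, covDeriv DM (S.ψp φ θ) p v ![y₁, y₂, y₃]
      - ∑ i, S.ψp φ θ p (Function.update ![y₁, y₂, y₃] i
        (S.torsionEnd φ DM p η v (![y₁, y₂, y₃] i)))
      = -(mvfderiv (𝓡 6) θ p v + 3 * η (S.I φ p v)) * S.ψm φ θ p ![y₁, y₂, y₃] := by
    intro v y₁ y₂ y₃
    rw [(S.hasDirDeriv_angle φ hκ hDN hDM hθ v y₁ y₂ y₃).1, Fin.sum_univ_three]
    simp only [(update_vec3 ..).1, (update_vec3 ..).2.1, (update_vec3 ..).2.2, Matrix.cons_val, hE,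
      ψp_vec, ψm_vec, map_add, map_smul, LinearMap.add_apply, LinearMap.smul_apply, smul_eq_mul,
      hsu.J_right, ← hsu.J_left, hsu.J_sq, map_neg, LinearMap.neg_apply]
    ring
  have hm : ∀ v y₁ y₂ y₃, covDeriv DM (S.ψm φ θ) p v ![y₁, y₂, y₃]
      - ∑ i, S.ψm φ θ p (Function.update ![y₁, y₂, y₃] i
        (S.torsionEnd φ DM p η v (![y₁, y₂, y₃] i)))
      = (mvfderiv (𝓡 6) θ p v + 3 * η (S.I φ p v)) * S.ψp φ θ p ![y₁, y₂, y₃] := by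
    intro v y₁ y₂ y₃
    rw [(S.hasDirDeriv_angle φ hκ hDN hDM hθ v y₁ y₂ y₃).2, Fin.sum_univ_three]
    simp only [(update_vec3 ..).1, (update_vec3 ..).2.1, (update_vec3 ..).2.2, Matrix.cons_val, hE,
      ψp_vec, ψm_vec, map_add, map_smul, LinearMap.add_apply, LinearMap.smul_apply, smul_eq_mul,
      hsu.J_right, ← hsu.J_left, hsu.J_sq, map_neg, LinearMap.neg_apply]
    ring
  constructor
  · rintro ⟨h, -⟩ v
    obtain ⟨x, y, z, hne⟩ : ∃ x y z, S.ψm φ θ p ![x, y, z] ≠ 0 := by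
      by_contra! hc
      -- ψ₋ is itself a rotation of Φ, with coefficients sin θ and -cos θ, hence nonzero.
      have := (hsu.rotate (c := Real.sin (θ p)) (s := -Real.cos (θ p)) (by
        rw [neg_sq, Real.sin_sq_add_cos_sq])).exists_ne_zero
      obtain ⟨x, y, z, h1⟩ := this
      refine h1 (Eq.trans ?_ (hc x y z))
      rw [ψm_vec]
      simp only [LinearMap.add_apply, LinearMap.smul_apply, LinearMap.comp_apply, smul_eq_mul]
      ring
    have h1 := h v ![x, y, z]
    rw [hp] at h1
    have := (mul_eq_zero.1 h1).resolve_right hne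
    linarith
  · intro h
    constructor <;> intro v w <;> rw [vec3_eta w]
    · rw [hp, h]; ring
    · rw [hm, h]; ring

/-- The intrinsic torsion of the induced structure. -/
theorem isIntrinsicTorsion_iff {θ : M → ℝ} (hθ : MDifferentiableAt (𝓡 6) 𝓘(ℝ, ℝ) θ p)
    (τ : Trilin (TangentSpace (𝓡 6) p) × Module.Dual ℝ (TangentSpace (𝓡 6) p)) :
    S.IsIntrinsicTorsion φ θ DM p τ ↔
      τ.1 = S.pullTrilin φ p ∘ₗ (S.weingarten DN p - κ • S.I φ p) ∧
      ∀ v, mvfderiv (𝓡 6) θ p v = -3 * τ.2 (S.I φ p v) := by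
  rw [IsIntrinsicTorsion, S.annihilates_iff φ hκ hDN hDM hθ]
  refine and_congr_left fun _ ↦ ?_
  simp only [S.covDeriv_kahler φ hκ hDN hDM]
  constructor
  · intro h; ext v y z; exact h v y z
  · intro h v y z; rw [h]; rfl

/-- The induced structure is of type `∑ c ∈ T, W_c` with `W₄` not among the summands. -/
theorem isOfType_iff {θ : M → ℝ} (hθ : ContMDiff (𝓡 6) 𝓘(ℝ, ℝ) ∞ θ) (T : Set TorsionClass)
    (hT : W4 ∉ T) :
    S.IsOfType φ θ DM T ↔ ∀ p,
      (W1p ∉ T → Real.cos (θ p) * S.h DN p = κ * Real.sin (θ p)) ∧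
      (W1m ∉ T → κ * Real.cos (θ p) + Real.sin (θ p) * S.h DN p = 0) ∧
      (W2p ∉ T → ∀ x y, Real.cos (θ p) * (S.B DN p x y + S.B DN p (S.I φ p x) (S.I φ p y))
        = 2 * S.h DN p * Real.cos (θ p) * ⟪x, y⟫_ℝ) ∧
      (W2m ∉ T → ∀ x y, Real.sin (θ p) * (S.B DN p x y + S.B DN p (S.I φ p x) (S.I φ p y))
        = 2 * S.h DN p * Real.sin (θ p) * ⟪x, y⟫_ℝ) ∧
      (W3 ∉ T → ∀ x y, S.B DN p (S.I φ p x) (S.I φ p y) = S.B DN p x y) ∧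
      (W5 ∉ T → mvfderiv (𝓡 6) θ p = 0) := by
  refine forall_congr' fun p ↦ ?_
  have hsu := S.isSU3 φ p
  have hθp : MDifferentiableAt (𝓡 6) 𝓘(ℝ, ℝ) θ p := (hθ p).mdifferentiableAt (by simp)
  -- Solving dθ(v) = -3 η(I v) with I² = -1 gives η = ⅓ dθ ∘ I, the only candidate for the one-form.
  set η : Module.Dual ℝ (TangentSpace (𝓡 6) p) :=
    (1 / 3 : ℝ) • (mvfderiv (𝓡 6) θ p).toLinearMap ∘ₗ S.I φ p with hη
  have h1 : (∃ τ ∈ ⨆ c ∈ T, torsionModule (S.I φ p) (S.ψp φ θ p) c,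
      S.IsIntrinsicTorsion φ θ DM p τ) ↔
      (S.pullTrilin φ p ∘ₗ (S.weingarten DN p - κ • S.I φ p), η)
        ∈ ⨆ c ∈ T, torsionModule (S.I φ p) (S.ψp φ θ p) c := by
    simp only [S.isIntrinsicTorsion_iff φ hκ hDN hDM hθp]
    constructor
    · rintro ⟨⟨a, ε⟩, hmem, ha, hε⟩
      dsimp only at ha hε
      have : ε = η := by
        ext v
        have := hε (S.I φ p v)
        rw [hsu.J_sq, map_neg] at this
        simp only [hη, LinearMap.smul_apply, LinearMap.comp_apply, smul_eq_mul,
          ContinuousLinearMap.coe_coe, this]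
        ring
      rwa [← ha, ← this]
    · intro hmem
      refine ⟨_, hmem, rfl, fun v ↦ ?_⟩
      simp only [hη, LinearMap.smul_apply, LinearMap.comp_apply, smul_eq_mul,
        ContinuousLinearMap.coe_coe, hsu.J_sq, map_neg]
      ring
  have h2 : η = 0 ↔ mvfderiv (𝓡 6) θ p = 0 := by
    constructor
    · intro h
      ext v
      have := LinearMap.congr_fun h (S.I φ p v)
      simp only [hη, LinearMap.smul_apply, LinearMap.comp_apply, smul_eq_mul,
        ContinuousLinearMap.coe_coe, hsu.J_sq, map_neg, LinearMap.zero_apply] at this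
      change mvfderiv (𝓡 6) θ p v = 0
      linarith
    · intro h
      ext v
      simp [hη, h]
  rw [h1, hsu.mem_iSup_iff (A := S.weingarten DN p) (fun x y ↦ by
      rw [real_inner_comm (S.weingarten DN p y), S.inner_weingarten p hDN,
        S.inner_weingarten p hDN, S.B_comm p hDN])
    (Real.cos_sq_add_sin_sq (θ p)) (fun x y z ↦ S.ψp_vec φ θ p x y z) (m := S.h DN p) (by
      simp only [h, S.inner_weingarten p hDN]) κ T hT η, h2]
  simp only [S.inner_weingarten p hDN]

end G2Hyp.Hypersurface

end InducedTorsion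

/-! ### Functions with vanishing differential -/

section LocallyConstant

variable {m : ℕ} {X : Type*} [TopologicalSpace X] [ChartedSpace (EuclideanSpace ℝ (Fin m)) X]
  [IsManifold (𝓡 m) ∞ X]

/-- Read in a chart the function has zero derivative on a ball, which is convex. -/
theorem isLocallyConstant_of_mvfderiv_eq_zero {g : X → ℝ}
    (hg : ContMDiff (𝓡 m) 𝓘(ℝ, ℝ) ∞ g) (h : ∀ p, mvfderiv (𝓡 m) g p = 0) :
    IsLocallyConstant g := by
  rw [IsLocallyConstant.iff_eventually_eq]
  intro p
  set c := chartAt (EuclideanSpace ℝ (Fin m)) p with hc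
  have hp : p ∈ c.source := mem_chart_source _ p
  have hopen : IsOpen c.target := c.open_target
  obtain ⟨r, hr, hball⟩ := Metric.isOpen_iff.1 hopen (c p) (c.map_source hp)
  have hd : ∀ u ∈ Metric.ball (c p) r, HasFDerivAt (fun u ↦ g (c.symm u)) (0 : _ →L[ℝ] ℝ) u := by
    intro u hu
    have hu' := hball hu
    have h1 : HasMFDerivAt (𝓡 m) 𝓘(ℝ, ℝ) g (c.symm u) (mfderiv (𝓡 m) 𝓘(ℝ, ℝ) g (c.symm u)) :=
      ((hg (c.symm u)).mdifferentiableAt (by simp)).hasMFDerivAt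
    have h0 : mfderiv (𝓡 m) 𝓘(ℝ, ℝ) g (c.symm u) = 0 := by
      ext v
      exact congrArg (fun l : TangentSpace (𝓡 m) (c.symm u) →L[ℝ] ℝ ↦ l v) (h (c.symm u))
    rw [h0] at h1
    have h2 : MDifferentiableAt (𝓡 m) (𝓡 m) c.symm u :=
      mdifferentiableAt_atlas_symm (chart_mem_atlas _ p) hu'
    have h3 := HasMFDerivAt.comp u h1 h2.hasMFDerivAt
    rw [ContinuousLinearMap.zero_comp] at h3
    exact h3.hasFDerivAt
  have hconst : ∀ u ∈ Metric.ball (c p) r, g (c.symm u) = g p := by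
    intro u hu
    have := (convex_ball (c p) r).is_const_of_fderivWithin_eq_zero (𝕜 := ℝ)
      (f := fun u ↦ g (c.symm u)) (fun u hu ↦ (hd u hu).differentiableAt.differentiableWithinAt)
      (fun u hu ↦ (hd u hu).hasFDerivWithinAt.fderivWithin
        (Metric.isOpen_ball.uniqueDiffWithinAt hu)) hu (Metric.mem_ball_self hr)
    simpa [c.left_inv hp] using this
  filter_upwards [c.open_source.mem_nhds hp,
    (c.continuousAt hp).preimage_mem_nhds (Metric.ball_mem_nhds _ hr)] with q hq hq'
  have := hconst (c q) hq'
  rwa [c.left_inv hq] at this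

/-- A manifold is locally connected, so its components are open and constancy on them is a local
condition. -/
theorem forall_connectedComponent_eq_iff {g : X → ℝ} (hg : ContMDiff (𝓡 m) 𝓘(ℝ, ℝ) ∞ g) :
    (∀ p, ∀ q ∈ connectedComponent p, g q = g p) ↔ ∀ p, mvfderiv (𝓡 m) g p = 0 := by
  constructor
  · intro h p
    have : LocallyConnectedSpace X :=
      ChartedSpace.locallyConnectedSpace (EuclideanSpace ℝ (Fin m)) X
    have he : g =ᶠ[𝓝 p] fun _ ↦ g p := by
      filter_upwards [isOpen_connectedComponent.mem_nhds mem_connectedComponent] with q hq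
      exact h p q hq
    ext v
    exact ((HasDirDeriv.const (g p)).congr he).2
  · intro h p q hq
    exact (isLocallyConstant_of_mvfderiv_eq_zero hg h).apply_eq_of_isPreconnected
      isPreconnected_connectedComponent hq mem_connectedComponent

end LocallyConstant

/-- The two expressions c h - κ s and s h + κ c are the coordinates of (h, κ) after a rotation. This
merges the W₁⁺ and W₁⁻ conditions. -/
theorem rotation_eq_zero_iff {c s h κ : ℝ} (hcs : c ^ 2 + s ^ 2 = 1) :
    (c * h = κ * s ∧ κ * c + s * h = 0) ↔ h = 0 ∧ κ = 0 := by
  constructor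
  · rintro ⟨h1, h2⟩
    constructor
    · linear_combination c * h1 + s * h2 - h * hcs
    · linear_combination c * h2 - s * h1 - κ * hcs
  · rintro ⟨rfl, rfl⟩
    simp

/-- Since c and s do not both vanish, their factors can be removed. This merges the W₂⁺ and W₂⁻
conditions. -/
theorem forall_mul_eq_mul_iff {ι : Type*} {c s : ℝ} (hcs : c ^ 2 + s ^ 2 = 1) {f g : ι → ι → ℝ} {m : ℝ} :
    ((∀ x y, c * f x y = m * c * g x y) ∧ ∀ x y, s * f x y = m * s * g x y) ↔
      ∀ x y, f x y = m * g x y := by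
  constructor
  · rintro ⟨h1, h2⟩ x y
    linear_combination c * h1 x y + s * h2 x y - (f x y - m * g x y) * hcs
  · intro h
    constructor <;> intro x y <;> rw [h] <;> ring

/-! ### Umbilicity and J-type of the second fundamental form -/

section SecondFundamentalForm

open scoped InnerProductSpace

variable {N : Type*} [TopologicalSpace N] [ChartedSpace (EuclideanSpace ℝ (Fin 7)) N]
  [IsManifold (𝓡 7) ∞ N] [RiemannianBundle (fun x : N ↦ TangentSpace (𝓡 7) x)]
  {M : Type*} [TopologicalSpace M] [ChartedSpace (EuclideanSpace ℝ (Fin 6)) M]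
  [IsManifold (𝓡 6) ∞ M]
  [RiemannianBundle (fun p : M ↦ TangentSpace (𝓡 6) p)]

namespace G2Hyp.Hypersurface

variable (S : Hypersurface N M) (φ : G2Structure N) {DN : Connection 7 N} {p : M}

/-- The two conditions say that the J-invariant part of B is pure trace and that the rest of B
vanishes. The multiple has to be h, by taking traces. -/
theorem umbilic_iff : (∃ c : ℝ, ∀ x y, S.B DN p x y = c * ⟪x, y⟫_ℝ) ↔
    (∀ x y, S.B DN p x y + S.B DN p (S.I φ p x) (S.I φ p y) = 2 * S.h DN p * ⟪x, y⟫_ℝ) ∧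
      ∀ x y, S.B DN p (S.I φ p x) (S.I φ p y) = S.B DN p x y := by
  constructor
  · rintro ⟨c, hc⟩
    have hh : S.h DN p = c := by
      simp only [h, hc, ← Finset.mul_sum, (S.isSU3 φ p).sum_inner_self]
      ring
    refine ⟨fun x y ↦ ?_, fun x y ↦ ?_⟩
    · rw [hc, hc, (S.isSU3 φ p).inner_J_J, hh]; ring
    · rw [hc, hc, (S.isSU3 φ p).inner_J_J]
  · rintro ⟨h1, h2⟩
    refine ⟨S.h DN p, fun x y ↦ ?_⟩
    linarith [h1 x y, h2 x y]

/-- J is orthogonal, so a J-anti-invariant form has zero trace. Hence IB = -B already contains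
minimality. -/
theorem h_eq_zero_of_neg [IsContMDiffRiemannianBundle (𝓡 7) ∞ (EuclideanSpace ℝ (Fin 7))
      (fun x : N ↦ TangentSpace (𝓡 7) x)] (hDN : IsLeviCivita DN)
    (hB : ∀ x y, S.B DN p (S.I φ p x) (S.I φ p y) = -S.B DN p x y) : S.h DN p = 0 := by
  have := (S.isSU3 φ p).sum_eq_zero_of_J_J (f := innerₗ _ ∘ₗ S.weingarten DN p) fun x y ↦ by
    simpa only [LinearMap.comp_apply, innerₗ_apply_apply, S.inner_weingarten p hDN] using hB x y
  simp only [LinearMap.comp_apply, innerₗ_apply_apply, S.inner_weingarten p hDN] at this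
  rw [h, this, mul_zero]

end G2Hyp.Hypersurface

end SecondFundamentalForm

/-! ### The classification of the induced structures -/

theorem theorem4p3
    -- the ambient Riemannian seven-manifold
    {N : Type*} [TopologicalSpace N] [ChartedSpace (EuclideanSpace ℝ (Fin 7)) N]
    [IsManifold (𝓡 7) ∞ N] [RiemannianBundle (fun x : N ↦ TangentSpace (𝓡 7) x)]
    [IsContMDiffRiemannianBundle (𝓡 7) ∞ (EuclideanSpace ℝ (Fin 7))
      (fun x : N ↦ TangentSpace (𝓡 7) x)]
    (DN : Connection 7 N) (hDN : IsLeviCivita DN)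
    -- its nearly parallel structure
    (φ : G2Structure N) (hφ : φ.IsTypeX1 DN)
    (k : ℝ) (hk : ∀ x w, extDer (fun y ↦ φ.form y) x w = k * φ.star x w)
    -- the hypersurface, with unit normal `S.n`
    {M : Type*} [TopologicalSpace M] [Nonempty M] [ChartedSpace (EuclideanSpace ℝ (Fin 6)) M]
    [IsManifold (𝓡 6) ∞ M] [RiemannianBundle (fun p : M ↦ TangentSpace (𝓡 6) p)]
    [IsContMDiffRiemannianBundle (𝓡 6) ∞ (EuclideanSpace ℝ (Fin 6))
      (fun p : M ↦ TangentSpace (𝓡 6) p)]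
    (DM : Connection 6 M) (hDM : IsLeviCivita DM)
    (S : Hypersurface N M)
    -- the angle function
    (θ : M → ℝ) (hθ : ContMDiff (𝓡 6) 𝓘(ℝ, ℝ) ∞ θ) :
    S.IsOfType φ θ DM {W1p, W1m, W2p, W2m, W3, W5} ∧
    (S.IsOfType φ θ DM {W1p, W1m, W2p, W2m, W3} ↔
      ∀ p, ∀ q ∈ connectedComponent p, θ q = θ p) ∧
    (S.IsOfType φ θ DM {W1p, W1m, W2p, W2m, W5} ↔
      ∀ p x y, S.B DN p (S.I φ p x) (S.I φ p y) = S.B DN p x y) ∧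
    (S.IsOfType φ θ DM {W1p, W1m, W2p, W3, W5} ↔
      ∀ p x y, Real.sin (θ p) * (S.B DN p x y + S.B DN p (S.I φ p x) (S.I φ p y))
        = 2 * S.h DN p * Real.sin (θ p) * inner ℝ x y) ∧
    (S.IsOfType φ θ DM {W1p, W1m, W2m, W3, W5} ↔
      ∀ p x y, Real.cos (θ p) * (S.B DN p x y + S.B DN p (S.I φ p x) (S.I φ p y))
        = 2 * S.h DN p * Real.cos (θ p) * inner ℝ x y) ∧
    (S.IsOfType φ θ DM {W1p, W2p, W2m, W3, W5} ↔
      ∀ p, -4 * S.h DN p * Real.sin (θ p) = k * Real.cos (θ p)) ∧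
    (S.IsOfType φ θ DM {W1m, W2p, W2m, W3, W5} ↔
      ∀ p, 4 * S.h DN p * Real.cos (θ p) = k * Real.sin (θ p)) ∧
    (S.IsOfType φ θ DM {W1p, W1m, W3, W5} ↔
      ∀ p x y, S.B DN p x y + S.B DN p (S.I φ p x) (S.I φ p y)
        = 2 * S.h DN p * inner ℝ x y) ∧
    (S.IsOfType φ θ DM {W2p, W2m, W3, W5} ↔
      S.IsMinimal DN ∧ φ.IsTypeP DN) ∧
    (S.IsOfType φ θ DM {W1p, W1m, W5} ↔
      S.IsTotallyUmbilic DN) ∧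
    (S.IsOfType φ θ DM {W2p, W2m, W5} ↔
      (∀ p x y, S.B DN p (S.I φ p x) (S.I φ p y) = S.B DN p x y) ∧ S.IsMinimal DN ∧
        φ.IsTypeP DN) ∧
    (S.IsOfType φ θ DM {W3, W5} ↔
      (∀ p x y, S.B DN p (S.I φ p x) (S.I φ p y) = -S.B DN p x y) ∧ φ.IsTypeP DN) ∧
    (S.IsOfType φ θ DM {W5} ↔
      S.IsTotallyGeodesic DN ∧ φ.IsTypeP DN) ∧
    (S.IsOfType φ θ DM ∅ ↔
      S.IsTotallyGeodesic DN ∧ (∀ p, ∀ q ∈ connectedComponent p, θ q = θ p) ∧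
        φ.IsTypeP DN) := by
  have hN : Nonempty N := ‹Nonempty M›.map S.ι
  have hκ := hφ.covDeriv_eq φ hDN.1 hk
  have hP : φ.IsTypeP DN ↔ k / 4 = 0 := by
    rw [φ.isTypeP_iff hκ, div_eq_zero_iff]
    simp
  have hcs (p) := Real.cos_sq_add_sin_sq (θ p)
  have hW1 {p} := rotation_eq_zero_iff (h := S.h DN p) (κ := k / 4) (hcs p)
  have hW2 {p} := forall_mul_eq_mul_iff (m := 2 * S.h DN p)
    (f := fun x y ↦ S.B DN p x y + S.B DN p (S.I φ p x) (S.I φ p y))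
    (g := fun x y : TangentSpace (𝓡 6) p ↦ inner ℝ x y) (hcs p)
  rw [forall_connectedComponent_eq_iff hθ, hP]
  have key (T) (hT : W4 ∉ T) := S.isOfType_iff φ hκ hDN hDM hθ T hT
  have hall {q : M → Prop} {r : Prop} : (∀ p, q p ∧ r) ↔ (∀ p, q p) ∧ r := by
    rw [forall_and, forall_const]
  -- B vanishes exactly when its trace, its trace-free J-invariant part and its anti-invariant part
  -- all do.
  have hgeod {p} : (∀ x y, S.B DN p x y = 0) ↔ S.h DN p = 0 ∧
      (∀ x y, S.B DN p x y + S.B DN p (S.I φ p x) (S.I φ p y) = 2 * S.h DN p * inner ℝ x y) ∧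
        ∀ x y, S.B DN p (S.I φ p x) (S.I φ p y) = S.B DN p x y := by
    constructor
    · intro hB
      have hh : S.h DN p = 0 := by simp [Hypersurface.h, hB]
      exact ⟨hh, by simp [hB, hh], by simp [hB]⟩
    · rintro ⟨hh, h1, h2⟩ x y
      have := h1 x y
      rw [h2, hh] at this
      linarith
  -- Conditions attached to classes that are present become vacuous. This settles the general type
  -- and the first four equivalences; the remaining ones need sign rearrangements or the merging of
  -- cosine and sine conditions by `hW1` and `hW2`.
  refine ⟨?_, ?_, ?_, ?_, ?_, ?_, ?_, ?_, ?_, ?_, ?_, ?_, ?_, ?_⟩ <;> rw [key _ (by simp)] <;>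
    simp only [Set.mem_insert_iff, Set.mem_singleton_iff, Set.mem_empty_iff_false, reduceCtorEq,
      or_false, or_true, not_true_eq_false, not_false_eq_true,
      false_imp_iff, forall_const, and_true, true_and]
  · refine forall_congr' fun p ↦ ⟨fun h ↦ ?_, fun h ↦ ?_⟩ <;> linarith
  · refine forall_congr' fun p ↦ ⟨fun h ↦ ?_, fun h ↦ ?_⟩ <;> linarith
  · exact forall_congr' fun p ↦ hW2
  · simp only [hW1, hall, Hypersurface.IsMinimal]
  · simp only [← and_assoc, hW2, Hypersurface.IsTotallyUmbilic, S.umbilic_iff φ]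
  · simp only [← and_assoc, hW1, Hypersurface.IsMinimal]
    rw [← forall_and, ← hall]
    exact forall_congr' fun p ↦ by tauto
  · rw [← hall]
    refine forall_congr' fun p ↦ ?_
    rw [hW2, ← and_assoc, hW1]
    constructor
    · rintro ⟨⟨hh, hk0⟩, hB⟩
      refine ⟨fun x y ↦ ?_, hk0⟩
      have := hB x y
      rw [hh] at this
      linarith
    · rintro ⟨hB, hk0⟩
      -- With h = 0 the W₂ condition is exactly IB = -B, and conversely IB = -B provides h = 0.
      have hh := S.h_eq_zero_of_neg φ hDN hB
      refine ⟨⟨hh, hk0⟩, fun x y ↦ ?_⟩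
      rw [hB, hh]
      ring
  · rw [Hypersurface.IsTotallyGeodesic, ← hall]
    refine forall_congr' fun p ↦ ?_
    have h1 := hW1 (p := p)
    have h2 := hW2 (p := p)
    rw [hgeod]
    tauto
  · rw [Hypersurface.IsTotallyGeodesic, ← and_assoc, ← forall_and, ← hall]
    refine forall_congr' fun p ↦ ?_
    have h1 := hW1 (p := p)
    have h2 := hW2 (p := p)
    rw [hgeod]
    tauto
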